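/- Let $N\ge 1$ and $l\ge 1$ be integers and let $\varGamma$ be one of the congruence subgroups $\varGamma_0(N)$, $\varGamma_1(N)$, $\varGamma(N)$ of $SL(2,\mathbb Z)$. Let $\kappa$ be the number of inequivalent cusps of $\varGamma$ and $\kappa_0:=-\operatorname{tr}\varphi(1/2)$, where $\varphi(s)$ is the (meromorphically continued) scattering matrix of $\varGamma$, i.e. the matrix of coefficients of $y^{1-s}$ in the constant terms of the Eisenstein series of $\varGamma$ at its cusps. Consider the tuples $(\chi_1,\chi_2,q_1,q_2,m_1,m_2)$ of positive integers $q_i,m_i$ and primitive Dirichlet characters $\chi_i$ modulo $q_i$ such that $(m_1,m_2)=1$ and - for $\varGamma_0(N)$: $\chi_1=\chi_2$, $q_1=q_2$, $m_1=1$, $q_1\mid m_2$, $m_2q_2\mid N$; - for $\varGamma_1(N)$: $m_1=1$, $q_1\mid m_2$, $m_2q_2\mid N$; - for $\varGamma(N)$: $m_1q_1\mid N$, $m_2q_2\mid N$. There are finitely many. Let $X$ be any set of such tuples (for instance the set of all of them, or of those with $\chi_1\chi_2(-1)=1$). To each tuple attach the character $\chi=\chi_1\chi_2\,\omega_{m_1m_2}$,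 $\omega_{m}$ being the principal character modulo $m$; sums and products over $\chi$ below run over the tuples in $X$. Let $\mathcal A=\prod_X \frac{q_1N}{(m_1,N/m_1)}$, $\prod_X q_1N$, $\prod_X m_1m_2q_1N$ for $\varGamma_0(N)$, $\varGamma_1(N)$, $\varGamma(N)$ respectively, and put $$\Xi_{\mathrm{par}}(s)=\Big(\mathcal A\frac{2^\kappa}{\pi^\kappa}\Big)^{-s}\Big(s-\frac12\Big)^{(\kappa-\kappa_0)/2}\Gamma\Big(s+\frac12\Big)^{-\kappa}\Gamma(s)^{-\kappa}\prod_\chi L(2s,\chi)^{-1}.$$ Let $\Gamma_2$ be the Barnes–Vignéras double gamma function, $$\frac1{\Gamma_2(z+1)}=\exp\Big\{\Big(-\frac12-\frac\gamma2\Big)z^2+\Big(-\frac12-\zeta'(0)\Big)z\Big\}\prod_{k\ge1}\Big(1+\frac zk\Big)^k\exp\Big(-z+\frac{z^2}{2k}\Big),$$ let $k_1(l)=(2\pi)^{-(l-1)/2}l^{-1/2}$, $$I_l(s)=\exp\Big\{-\frac sl\log k_1(l)-\frac{s(s+l)}{2l}\log l\Big\}\prod_{r=0}^{l-1}\Gamma_2\Big(\frac{s+l+r}{l}\Big),\qquad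 L_{l\infty}(s,\chi)=\prod_{m=1}^\infty L(s+lm,\chi),$$ with $L(\cdot,\chi)$ continued to $\mathbb C$, and $$\Xi_{l\infty,\mathrm{par}}(s)=\exp\Big\{-\frac{s(s+l)}{2l}\log\Big(\mathcal A\frac{2^\kappa}{\pi^\kappa}\Big)+\frac{\kappa-\kappa_0}2\Big(\frac sl\log l+\log\Gamma\Big(\frac{s+l-\frac12}{l}\Big)\Big)\Big\}\Big\{I_l\Big(s+\frac12\Big)I_l(s)\Big\}^\kappa\prod_\chi L_{2l,\infty}(2s,\chi).$$ Here $(s-\frac12)^{(\kappa-\kappa_0)/2}$ is taken with the principal logarithm and $\log\Gamma$ is the branch on $\mathbb C\setminus(-\infty,0]$ that is real on $(0,\infty)$, extended to the non-poles on the negative axis by using the principal logarithm in its Weierstrass series. For $s\in\mathbb C$ let $$g(u)=\frac{u\,e^{-(s+\frac l2-\frac12)|u|}}{2\sinh\frac{lu}2}-\frac1le^{-(s+\frac l2-\frac12)|u|}\ (u\ne0),\quad g(0)=0,\qquad h(r)=\phi_s(r)+\phi_s(-r),$$ $$\phi_s(r)=\sum_{m=0}^\infty\Big\{\frac1{(s+lm+l-\frac12+ir)^2}-\frac1l\,\frac1{s+lm+\frac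 l2-\frac12+ir}+\frac1l\,\frac1{s+lm+\frac{3l}2-\frac12+ir}\Big\}.$$ (i) Let $\mathrm{Re}(s)>\frac{1-l}2$. Then the series defining $\phi_s(r)$ converges absolutely for every real $r$, the integral and the series over $n$ below converge absolutely, $\Xi_{l\infty,\mathrm{par}}$ is analytic and non-zero at $s$, $\Xi_{\mathrm{par}}$ is analytic and non-zero at $s+\frac l2$, and $$-g(0)\log\Big(\mathcal A\frac{2^\kappa}{\pi^\kappa}\Big)+\frac14(\kappa-\kappa_0)h(0)-\frac{\kappa}{2\pi}\int_{-\infty}^\infty h(r)\Big\{\frac{\Gamma'}\Gamma(1+ir)+\frac{\Gamma'}\Gamma\Big(\frac12+ir\Big)\Big\}dr+2\sum_\chi\sum_{n=1}^\infty\frac{\chi(n)\Lambda(n)}n\,g(2\log n)$$ $$=\frac{d^2}{ds^2}\log\Xi_{l\infty,\mathrm{par}}(s)-\frac1l\frac d{ds}\log\Xi_{\mathrm{par}}\Big(s+\frac l2\Big).$$ (ii) For every $s\in\mathbb C$ such that $2(s+l)$ is not an integer $\le1$, $$\Xi_{l\infty,\mathrm{par}}(s)=\frac{\Xi_{l\infty,\mathrm{par}}(s+l)}{\Xi_{\mathrm{par}}(s+l)},$$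 where the right side is read as $0$ at the zeros of $\prod_\chi L(2s+2l,\chi)$ (the poles of $\Xi_{\mathrm{par}}(s+l)$). -/

import Mathlib

open scoped MatrixGroups UpperHalfPlane

noncomputable section

namespace HigherSelberg

/-! ### The congruence subgroups -/

/-- The three families of congruence subgroups of `SL(2, ℤ)`. -/
inductive CongType where
  | Gamma0
  | Gamma1
  | Gamma

/-- The congruence subgroup `Γ₀(N)`, `Γ₁(N)` or `Γ(N)`. -/
def grp (t : CongType) (N : ℕ) : Subgroup SL(2, ℤ) :=
  match t with
  | .Gamma0 => CongruenceSubgroup.Gamma0 N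
  | .Gamma1 => CongruenceSubgroup.Gamma1 N
  | .Gamma => CongruenceSubgroup.Gamma N

instance instFiniteIndexGrp (t : CongType) (N : ℕ) [NeZero N] : (grp t N).FiniteIndex := by
  cases t
  · exact inferInstanceAs (CongruenceSubgroup.Gamma0 N).FiniteIndex
  · exact inferInstanceAs (CongruenceSubgroup.Gamma1 N).FiniteIndex
  · exact inferInstanceAs (CongruenceSubgroup.Gamma N).FiniteIndex

/-- The congruence subgroup as a subgroup of `GL(2, ℝ)`. -/
abbrev grpGL (t : CongType) (N : ℕ) : Subgroup (GL (Fin 2) ℝ) :=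
  (grp t N).map (Matrix.SpecialLinearGroup.mapGL ℝ)

/-- `κ`, the number of inequivalent cusps. -/
def kappa (t : CongType) (N : ℕ) : ℕ := Nat.card (CuspOrbits (grpGL t N))

/-! ### The scattering matrix and `κ₀` -/

/-- `σ` is a scaling matrix for the cusp `c` of `G`: `σ ∞ = c` and, up to sign, the unipotent
elements `σ (1 x; 0 1) σ⁻¹` lying in `G` are exactly those with `x ∈ ℤ`. -/
def IsScalingMatrix (G : Subgroup (GL (Fin 2) ℝ)) (c : OnePoint ℝ) (σ : SL(2, ℝ)) : Prop :=
  (σ : GL (Fin 2) ℝ) • OnePoint.infty = c ∧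
    ∀ x : ℝ, (σ : GL (Fin 2) ℝ) * Matrix.GeneralLinearGroup.upperRightHom x *
      (σ : GL (Fin 2) ℝ)⁻¹ ∈ G.adjoinNegOne ↔ ∃ n : ℤ, x = n

/-- A scaling matrix of the cusp `c`. -/
def scalingMatrix (G : Subgroup (GL (Fin 2) ℝ)) (c : OnePoint ℝ) : SL(2, ℝ) :=
  Classical.epsilon (IsScalingMatrix G c)

/-- The Eisenstein series `E_c(z, s) = ∑_{γ ∈ G_c \ G} Im(σ_c⁻¹ γ z)^s` of the cusp `c`
(convergent for `Re s > 1`). -/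
def eisenstein (G : Subgroup (GL (Fin 2) ℝ)) (c : OnePoint ℝ) (s : ℂ) (z : ℍ) : ℂ :=
  ∑' q : Quotient (QuotientGroup.rightRel (MulAction.stabilizer G c)),
    (((scalingMatrix G c)⁻¹ • ((q.out : G) • z)).im : ℂ) ^ s

/-- A representative in `ℙ¹(ℝ)` of a class of cusps. -/
def cuspRep {G : Subgroup (GL (Fin 2) ℝ)} (a : CuspOrbits G) : OnePoint ℝ :=
  (a.out : cuspsSubMulAction G)

open Classical in
/-- The entry `φ_{ab}(s)` of the scattering matrix for `Re s > 1`. It is determined by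
`∫₀¹ E_a(σ_b (x + i y), s) dx = δ_{ab} y^s + φ_{ab}(s) y^{1-s}`, which is read off at `y = 1`. -/
def scatteringEntry (G : Subgroup (GL (Fin 2) ℝ)) (a b : CuspOrbits G) (s : ℂ) : ℂ :=
  (∫ x in (0 : ℝ)..1,
    eisenstein G (cuspRep a) s (scalingMatrix G (cuspRep b) • (x +ᵥ UpperHalfPlane.I))) -
    if a = b then 1 else 0

/-- `Φ` is the meromorphic continuation of the scattering matrix to `ℂ` (with every removable
singularity removed). -/
def IsScatteringMatrix (G : Subgroup (GL (Fin 2) ℝ))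
    (Φ : ℂ → Matrix (CuspOrbits G) (CuspOrbits G) ℂ) : Prop :=
  ∀ a b, MeromorphicNFOn (fun s => Φ s a b) Set.univ ∧
    ∀ s : ℂ, 1 < s.re → Φ s a b = scatteringEntry G a b s

/-- The scattering matrix `φ(s)`, `s ∈ ℂ`. -/
def scatteringMatrix (G : Subgroup (GL (Fin 2) ℝ)) :
    ℂ → Matrix (CuspOrbits G) (CuspOrbits G) ℂ :=
  Classical.epsilon (IsScatteringMatrix G)

/-- There are finitely many classes of cusps. -/
instance instFintypeCuspOrbits (t : CongType) (N : ℕ) [NeZero N] :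
    Fintype (CuspOrbits (grpGL t N)) := Fintype.ofFinite _

/-- `κ₀ = - tr φ(1/2)`. -/
def kappa0 (t : CongType) (N : ℕ) [NeZero N] : ℂ :=
  -(scatteringMatrix (grpGL t N) (1 / 2)).trace

/-! ### The Dirichlet characters and the constant `𝒜` -/

/-- A tuple `(χ₁, χ₂, q₁, q₂, m₁, m₂)`, `χᵢ` being a Dirichlet character modulo `qᵢ`. -/
structure CharTuple where
  q₁ : ℕ+
  q₂ : ℕ+
  m₁ : ℕ+
  m₂ : ℕ+
  χ₁ : DirichletCharacter ℂ q₁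
  χ₂ : DirichletCharacter ℂ q₂

/-- The conditions on the tuples for each of the three families. -/
def CharTuple.Admissible (t : CongType) (N : ℕ) (d : CharTuple) : Prop :=
  d.χ₁.IsPrimitive ∧ d.χ₂.IsPrimitive ∧ Nat.Coprime d.m₁ d.m₂ ∧
  match t with
  | .Gamma0 => (d.q₁ = d.q₂ ∧ ∀ n : ℤ, d.χ₁ n = d.χ₂ n) ∧
      d.m₁ = 1 ∧ (d.q₁ : ℕ) ∣ d.m₂ ∧ (d.m₂ * d.q₂ : ℕ) ∣ N
  | .Gamma1 => d.m₁ = 1 ∧ (d.q₁ : ℕ) ∣ d.m₂ ∧ (d.m₂ * d.q₂ : ℕ) ∣ N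
  | .Gamma => (d.m₁ * d.q₁ : ℕ) ∣ N ∧ (d.m₂ * d.q₂ : ℕ) ∣ N

theorem finite_admissible (t : CongType) (N : ℕ) [NeZero N] :
    {d : CharTuple | d.Admissible t N}.Finite := by
  have hN : 0 < N := Nat.pos_of_ne_zero (NeZero.ne N)
  let M : ℕ+ := ⟨N, hN⟩
  let S : Finset ℕ+ := Finset.Icc 1 M
  have hS : ∀ k : ℕ+, (k : ℕ) ∣ N → k ∈ S := fun k hk =>
    Finset.mem_Icc.mpr ⟨_root_.one_le, PNat.coe_le_coe _ _ |>.mp (Nat.le_of_dvd hN hk)⟩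
  have hfin : (⋃ a ∈ S, ⋃ b ∈ S, ⋃ c ∈ S, ⋃ e ∈ S, Set.range
      (fun p : DirichletCharacter ℂ a × DirichletCharacter ℂ b =>
        CharTuple.mk a b c e p.1 p.2)).Finite := by
    refine S.finite_toSet.biUnion fun a _ => S.finite_toSet.biUnion fun b _ =>
      S.finite_toSet.biUnion fun c _ => S.finite_toSet.biUnion fun e _ => Set.finite_range _
  refine hfin.subset fun d hd => ?_
  obtain ⟨-, -, -, h⟩ := hd
  have key : (d.q₁ : ℕ) ∣ N ∧ (d.q₂ : ℕ) ∣ N ∧ (d.m₁ : ℕ) ∣ N ∧ (d.m₂ : ℕ) ∣ N := by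
    cases t
    · obtain ⟨-, h1, h2, h3⟩ := h
      have h4 := dvd_of_mul_right_dvd h3
      exact ⟨h2.trans h4, dvd_of_mul_left_dvd h3, by simp [h1], h4⟩
    · obtain ⟨h1, h2, h3⟩ := h
      have h4 := dvd_of_mul_right_dvd h3
      exact ⟨h2.trans h4, dvd_of_mul_left_dvd h3, by simp [h1], h4⟩
    · obtain ⟨h1, h2⟩ := h
      exact ⟨dvd_of_mul_left_dvd h1, dvd_of_mul_left_dvd h2, dvd_of_mul_right_dvd h1,
        dvd_of_mul_right_dvd h2⟩
  simp only [Set.mem_iUnion, Set.mem_range]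
  exact ⟨d.q₁, hS _ key.1, d.q₂, hS _ key.2.1, d.m₁, hS _ key.2.2.1, d.m₂, hS _ key.2.2.2,
    (d.χ₁, d.χ₂), rfl⟩

/-- The finite set of all admissible tuples. -/
def admissibleTuples (t : CongType) (N : ℕ) [NeZero N] : Finset CharTuple :=
  (finite_admissible t N).toFinset

/-- A modulus for the character attached to a tuple. -/
def CharTuple.modulus (d : CharTuple) : ℕ+ := d.q₁ * d.q₂ * (d.m₁ * d.m₂)

/-- The character `χ = χ₁ χ₂ ω_{m₁ m₂}`, with `ω_{m₁ m₂}` the principal character modulo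
`m₁ m₂`, as a character modulo `q₁ q₂ m₁ m₂`. -/
def CharTuple.char (d : CharTuple) : DirichletCharacter ℂ d.modulus :=
  DirichletCharacter.changeLevel (m := d.modulus)
      ⟨(d.q₂ * (d.m₁ * d.m₂) : ℕ), by simp [CharTuple.modulus, mul_assoc]⟩ d.χ₁ *
    DirichletCharacter.changeLevel (m := d.modulus)
      ⟨(d.q₁ * (d.m₁ * d.m₂) : ℕ), by simp [CharTuple.modulus]; ring⟩ d.χ₂ *
    DirichletCharacter.changeLevel (n := (d.m₁ * d.m₂ : ℕ)) (m := d.modulus)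
      ⟨(d.q₁ * d.q₂ : ℕ), by simp [CharTuple.modulus]; ring⟩ 1

/-- The contribution of one tuple to the constant `𝒜`. -/
def CharTuple.factorA (t : CongType) (N : ℕ) (d : CharTuple) : ℝ :=
  match t with
  | .Gamma0 => (d.q₁ : ℝ) * N / (Nat.gcd d.m₁ (N / d.m₁) : ℝ)
  | .Gamma1 => (d.q₁ : ℝ) * N
  | .Gamma => (d.m₁ : ℝ) * d.m₂ * d.q₁ * N

/-- The constant `𝒜`. -/
def constA (t : CongType) (N : ℕ) (X : Finset CharTuple) : ℝ := ∏ d ∈ X, d.factorA t N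

/-- The constant `𝒜 · 2^κ / π^κ`. -/
def constC (t : CongType) (N : ℕ) (X : Finset CharTuple) : ℝ :=
  constA t N X * 2 ^ kappa t N / Real.pi ^ kappa t N

/-! ### Gamma functions and higher Dirichlet `L`-functions -/

/-- The branch of `log Γ` given by the logarithm of the Weierstrass product of `Γ`; it is
analytic on `ℂ ∖ (-∞, 0]` and real on `(0, ∞)`. -/
def logGamma (z : ℂ) : ℂ :=
  -Real.eulerMascheroniConstant * z - Complex.log z +
    ∑' k : ℕ, (z / (k + 1) - Complex.log (1 + z / (k + 1)))

/-- The function `1 / Γ₂(z + 1)`, as a Weierstrass product. -/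
def invGamma2AddOne (z : ℂ) : ℂ :=
  Complex.exp ((-1 / 2 - Real.eulerMascheroniConstant / 2) * z ^ 2 +
      (-1 / 2 - deriv riemannZeta 0) * z) *
    ∏' k : ℕ, ((1 + z / (k + 1)) ^ (k + 1) * Complex.exp (-z + z ^ 2 / (2 * (k + 1))))

/-- The Barnes-Vignéras double gamma function `Γ₂`. -/
def Gamma2 (z : ℂ) : ℂ := (invGamma2AddOne (z - 1))⁻¹

/-- `k₁(m) = (2π)^{-(m-1)/2} m^{-1/2}`. -/
def k1 (m : ℕ) : ℝ := (2 * Real.pi) ^ (-((m : ℝ) - 1) / 2) * (m : ℝ) ^ (-(1 : ℝ) / 2)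

/-- The function `I_l(s)`. -/
def Ifun (l : ℕ) (s : ℂ) : ℂ :=
  Complex.exp (-(s / l) * Real.log (k1 l) - s * (s + l) / (2 * l) * Real.log l) *
    ∏ r ∈ Finset.range l, Gamma2 ((s + l + r) / l)

/-- The higher Dirichlet `L`-function `L_{l∞}(s, χ) = ∏_{m ≥ 1} L(s + l m, χ)`. -/
def higherL {q : ℕ} [NeZero q] (l : ℕ) (χ : DirichletCharacter ℂ q) (s : ℂ) : ℂ :=
  ∏' m : ℕ, χ.LFunction (s + l * (m + 1))

/-! ### The parabolic factors -/

/-- The parabolic factor `Ξ_par(s)`. -/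
def XiPar (t : CongType) (N : ℕ) [NeZero N] (X : Finset CharTuple) (s : ℂ) : ℂ :=
  (constC t N X : ℂ) ^ (-s) * (s - 1 / 2) ^ ((kappa t N - kappa0 t N) / 2) *
    (Complex.Gamma (s + 1 / 2) ^ kappa t N)⁻¹ * (Complex.Gamma s ^ kappa t N)⁻¹ *
    ∏ d ∈ X, (d.char.LFunction (2 * s))⁻¹

/-- The higher parabolic factor `Ξ_{l∞,par}(s)`. -/
def XiHigherPar (t : CongType) (N : ℕ) [NeZero N] (X : Finset CharTuple) (l : ℕ) (s : ℂ) : ℂ :=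
  Complex.exp (-(s * (s + l) / (2 * l)) * Real.log (constC t N X) +
      (kappa t N - kappa0 t N) / 2 *
        (s / l * Real.log l + logGamma ((s + l - 1 / 2) / l))) *
    (Ifun l (s + 1 / 2) * Ifun l s) ^ kappa t N *
    ∏ d ∈ X, higherL (2 * l) d.char (2 * s)

/-! ### The test function -/

/-- The test function
`g(u) = u e^{-(s + l/2 - 1/2)|u|} / (2 sinh(lu/2)) - (1/l) e^{-(s + l/2 - 1/2)|u|}`,
extended continuously to `u = 0`, where the quotient `u / (2 sinh(lu/2))` tends to `1/l`. -/
def testG (l : ℕ) (s : ℂ) (u : ℝ) : ℂ :=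
  if u = 0 then 0 else
    u * Complex.exp (-(s + l / 2 - 1 / 2) * |u|) / (2 * Real.sinh (l * u / 2)) -
      1 / l * Complex.exp (-(s + l / 2 - 1 / 2) * |u|)

/-- The `m`-th term of the series `φ_s(r)`. -/
def phiTerm (l : ℕ) (s : ℂ) (r : ℝ) (m : ℕ) : ℂ :=
  1 / (s + l * m + l - 1 / 2 + Complex.I * r) ^ 2 -
    1 / l * (1 / (s + l * m + l / 2 - 1 / 2 + Complex.I * r)) +
    1 / l * (1 / (s + l * m + 3 * l / 2 - 1 / 2 + Complex.I * r))

/-- `φ_s(r)`. -/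
def phi (l : ℕ) (s : ℂ) (r : ℝ) : ℂ := ∑' m : ℕ, phiTerm l s r m

/-- `h(r) = φ_s(r) + φ_s(-r)`. -/
def testH (l : ℕ) (s : ℂ) (r : ℝ) : ℂ := phi l s r + phi l s (-r)

/-! ### The parabolic terms of the trace formula -/

/-- The integrand of the digamma term. -/
def digammaIntegrand (l : ℕ) (s : ℂ) (r : ℝ) : ℂ :=
  testH l s r * (Complex.digamma (1 + Complex.I * r) + Complex.digamma (1 / 2 + Complex.I * r))

/-- The `n`-th term `χ(n) Λ(n) / n · g(2 log n)`; it is `0` for `n = 0`. -/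
def primeTerm {q : ℕ} (l : ℕ) (s : ℂ) (χ : DirichletCharacter ℂ q) (n : ℕ) : ℂ :=
  χ n * ArithmeticFunction.vonMangoldt n / n * testG l s (2 * Real.log n)

/-- The parabolic terms of the trace formula for the pair `(g, h)`. -/
def parabolicTerms (t : CongType) (N : ℕ) [NeZero N] (X : Finset CharTuple) (l : ℕ) (s : ℂ) : ℂ :=
  -testG l s 0 * Real.log (constC t N X) +
    1 / 4 * (kappa t N - kappa0 t N) * testH l s 0 -
    kappa t N / (2 * Real.pi) * (∫ r : ℝ, digammaIntegrand l s r) +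
    2 * ∑ d ∈ X, ∑' n : ℕ, primeTerm l s d.char n

end HigherSelberg

end

namespace HigherSelberg

/-! ### Bounds and termwise differentiation on the right half-plane -/

open Filter Topology Complex

/-! Part (i) is Fourier analysis followed by bookkeeping of logarithmic derivatives. Expanding
$1/\sinh$ geometrically shows that $\phi_w(0)$ is the Laplace transform of $g$ (`phi_eq_integral`);
since $g$ is even, $h$ is its Fourier transform, and inversion recovers $g$ from $h$. As $g(0)=0$,
this gives $\int h=0$. Pairing $h$ with the transform of a one-sided exponential gives $\int
h(r)/(c+ir)\,dr=2\pi\phi_{s+c}(0)$.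

Insert the series $\psi(b+ir)=-\gamma+\sum_k\{1/(k+1)-1/(b+k+ir)\}$ into the digamma integral: the
constants are annihilated by $\int h=0$, and what remains is $-2\pi\sum_k\phi_{s+b+k}(0)$. The
simple fractions in $\phi_w(0)$ telescope, so $\phi_w(0)$ is a trigamma value minus one simple
fraction. Summing over $k$ by residues modulo $l$ telescopes again, because $F=(\log\Gamma_2)''$
satisfies $F(w+1)=F(w)-\psi'(w)$. The trigamma values build $(\log I_l)''$ and the fractions build a
digamma value belonging to $\Xi_{\mathrm{par}}(s+l/2)$; the divergent logarithms cancel up to $\log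
l$, which the exponent of $I_l$ accounts for (`integral_testH_mul_digamma_eq`).

On the prime side, $g(2\log n)$ is explicit in powers of $n$. The factor $1/(n^{2l}-1)$ is the
geometric series coming from the shifts in $\prod_m L(2s+2lm,\chi)$, so the prime sum is a second
logarithmic derivative of the higher $L$-function minus a logarithmic derivative of $L$. The term
$h(0)=2\phi_s(0)$ splits in the same way between $\log\Gamma$ and the power of $s-1/2$. In all this
$\kappa$ and $\kappa_0$ enter only as constants.

Part (ii) holds factor by factor under $s\mapsto s+l$: the $L$-product loses its first factor,
$\log\Gamma$ acquires a principal logarithm, and $I_l(s)=I_l(s+l)\Gamma(s+l)$ follows from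
$\Gamma_2(z)=\Gamma_2(z+1)\Gamma(z)$ and Gauss's multiplication formula. -/

lemma mul_le_norm_add_natCast {δ : ℝ} (hδ1 : δ ≤ 1) {w : ℂ} (hw : δ ≤ w.re) (k : ℕ) :
    δ * (k + 1) ≤ ‖w + k‖ := by
  have h1 : (w + k).re ≤ ‖w + k‖ := re_le_norm _
  have h2 : (w + k).re = w.re + k := by simp
  have : (0 : ℝ) ≤ k := k.cast_nonneg
  nlinarith

lemma add_natCast_ne_zero_of_re_pos {w : ℂ} (hw : 0 < w.re) (k : ℕ) : w + k ≠ 0 := by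
  intro h
  have := congrArg re h
  simp at this
  have : (0 : ℝ) ≤ k := k.cast_nonneg
  linarith

lemma summable_const_div_succ_sq (C : ℝ) : Summable (fun k : ℕ => C / ((k : ℝ) + 1) ^ 2) := by
  have := (summable_nat_add_iff 1).mpr (Real.summable_one_div_nat_pow.mpr (one_lt_two))
  simpa [div_eq_mul_inv] using this.mul_left C

/-- Termwise differentiation on the right half-plane of a series whose derivatives are
`O(1 / k²)`, locally uniformly. -/
lemma hasDerivAt_tsum_of_re_pos {g g' : ℕ → ℂ → ℂ}
    (hg : ∀ k w, 0 < w.re → HasDerivAt (g k) (g' k w) w)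
    (hg' : ∀ δ R : ℝ, 0 < δ → δ ≤ 1 → 0 < R → ∃ C, ∀ k w, δ < w.re → ‖w‖ < R →
      ‖g' k w‖ ≤ C / ((k : ℝ) + 1) ^ 2)
    (h1 : Summable (g · 1)) {w : ℂ} (hw : 0 < w.re) :
    HasDerivAt (fun z => ∑' k, g k z) (∑' k, g' k w) w := by
  -- Taking δ below `min w.re 1` and radius `‖w‖ + 2` puts both `w` and the base point `1`, where
  -- convergence is known, in one convex region.
  obtain ⟨δ, hδ0, hδ⟩ := exists_between (lt_min hw one_pos)
  obtain ⟨C, hC⟩ := hg' δ (‖w‖ + 2) hδ0 (hδ.le.trans (min_le_right _ _)) (by positivity)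
  have ht : {z : ℂ | δ < z.re} ∩ Metric.ball 0 (‖w‖ + 2) =
      {z : ℂ | δ < z.re ∧ ‖z‖ < ‖w‖ + 2} := by ext; simp
  have ho : IsOpen {z : ℂ | δ < z.re ∧ ‖z‖ < ‖w‖ + 2} :=
    ht ▸ (isOpen_lt continuous_const continuous_re).inter Metric.isOpen_ball
  have hc : Convex ℝ {z : ℂ | δ < z.re ∧ ‖z‖ < ‖w‖ + 2} :=
    ht ▸ (convex_halfSpace_re_gt δ).inter (convex_ball _ _)
  refine hasDerivAt_tsum_of_isPreconnected (summable_const_div_succ_sq C) ho hc.isPreconnected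
    (fun k z hz => hg k z (hδ0.trans hz.1)) (fun k z hz => hC k z hz.1 hz.2) (y₀ := 1) ?_ h1 ?_
  · exact ⟨by simpa using hδ.trans_le (min_le_right _ _), by
      have := norm_nonneg w; simp; linarith⟩
  · exact ⟨hδ.trans_le (min_le_left _ _), by linarith⟩

/-! ### The functions `log Γ`, `Γ'/Γ` and `(Γ'/Γ)'` -/

lemma summable_logGamma_term (z : ℂ) :
    Summable (fun k : ℕ => z / (k + 1) - log (1 + z / (k + 1))) := by
  refine Summable.of_norm_bounded_eventually_nat (summable_const_div_succ_sq (‖z‖ ^ 2)) ?_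
  filter_upwards [eventually_ge_atTop ⌈2 * ‖z‖⌉₊] with k hk
  have hk' : 2 * ‖z‖ ≤ k := Nat.ceil_le.mp hk
  have hn : ‖z / ((k : ℂ) + 1)‖ = ‖z‖ / (k + 1) := by
    rw [norm_div]; congr 1
    exact_mod_cast norm_natCast (k + 1)
  have hle : ‖z / ((k : ℂ) + 1)‖ ≤ 1 / 2 := by
    rw [hn, div_le_iff₀ (by positivity)]; linarith
  have h := norm_log_one_add_sub_self_le (z := z / ((k : ℂ) + 1)) (by linarith)
  rw [norm_sub_rev]
  refine h.trans ?_
  have h2 : (1 - ‖z / ((k : ℂ) + 1)‖)⁻¹ ≤ 2 := by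
    rw [inv_le_comm₀ (by linarith) (by norm_num)]; linarith
  have h3 : ‖z / ((k : ℂ) + 1)‖ ^ 2 = ‖z‖ ^ 2 / (k + 1) ^ 2 := by rw [hn, div_pow]
  rw [h3]
  have : 0 ≤ ‖z‖ ^ 2 / ((k : ℝ) + 1) ^ 2 := by positivity
  nlinarith

lemma tendsto_harmonic_sub_log_ofReal :
    Tendsto (fun n : ℕ => (∑ k ∈ Finset.range n, 1 / ((k : ℂ) + 1)) - log n) atTop
      (𝓝 (Real.eulerMascheroniConstant : ℂ)) := by
  have h := (continuous_ofReal.tendsto _).comp Real.tendsto_harmonic_sub_log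
  refine h.congr fun n => ?_
  simp [harmonic, natCast_log]

/-- The exponentials of the partial sums are Euler's `GammaSeq` times a factor tending to 1, by the
definition of γ. Branches play no role, because each logarithm is exponentiated. -/
lemma exp_logGamma {z : ℂ} (hz : ∀ k : ℕ, z ≠ -k) : exp (logGamma z) = Gamma z := by
  have hne : ∀ k : ℕ, z + k ≠ 0 := fun k h => hz k (eq_neg_of_add_eq_zero_left h)
  have h1 := ((summable_logGamma_term z).hasSum.tendsto_sum_nat).const_add
    (-Real.eulerMascheroniConstant * z - log z)
  have h2 := (continuous_exp.tendsto _).comp h1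
  have h3 : Tendsto (fun n : ℕ => GammaSeq z n * exp (z * (((∑ k ∈ Finset.range n,
      1 / ((k : ℂ) + 1)) - log n) - Real.eulerMascheroniConstant))) atTop (𝓝 (Gamma z)) := by
    have := (tendsto_harmonic_sub_log_ofReal.sub_const
      (Real.eulerMascheroniConstant : ℂ)).const_mul z
    have := (GammaSeq_tendsto_Gamma z).mul ((continuous_exp.tendsto _).comp this)
    simpa using this
  refine tendsto_nhds_unique h2 (h3.congr' ?_)
  filter_upwards [eventually_ne_atTop 0] with n hn
  have hn' : (n : ℂ) ≠ 0 := Nat.cast_ne_zero.mpr hn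
  have hz0 : z ≠ 0 := by simpa using hz 0
  have hk1 : ∀ k : ℕ, (k : ℂ) + 1 ≠ 0 := fun k => Nat.cast_add_one_ne_zero k
  have e1 : ∀ k : ℕ, exp (z / ((k : ℂ) + 1) - log (1 + z / (k + 1))) =
      exp (z * (1 / ((k : ℂ) + 1))) * ((k + 1) / (z + (k + 1 : ℕ))) := by
    intro k
    have : 1 + z / ((k : ℂ) + 1) = (z + (k + 1 : ℕ)) / (k + 1) := by
      push_cast; field_simp [hk1 k]; ring
    rw [exp_sub, exp_log (by rw [this]; exact div_ne_zero (hne _) (hk1 k)), this,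
      div_div_eq_mul_div, mul_div_assoc]
    congr 2; ring
  simp only [Function.comp]
  rw [exp_add, exp_sub, exp_log hz0, exp_sum, Finset.prod_congr rfl (fun k _ => e1 k),
    Finset.prod_mul_distrib, ← exp_sum, ← Finset.mul_sum, Finset.prod_div_distrib, GammaSeq,
    Finset.prod_range_succ', cpow_def_of_ne_zero hn']
  have e2 : ((n.factorial : ℕ) : ℂ) = ∏ k ∈ Finset.range n, ((k : ℂ) + 1) := by
    rw [← Finset.prod_range_add_one_eq_factorial]; push_cast; rfl
  rw [e2]
  have e3 : exp (z * (((∑ k ∈ Finset.range n, 1 / ((k : ℂ) + 1)) - log n) -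
      Real.eulerMascheroniConstant)) = exp (z * ∑ k ∈ Finset.range n, 1 / ((k : ℂ) + 1)) *
      exp (-Real.eulerMascheroniConstant * z) * (exp (log n * z))⁻¹ := by
    rw [← exp_neg, ← exp_add, ← exp_add]; congr 1; ring
  rw [e3]
  have : exp (log n * z) ≠ 0 := exp_ne_zero _
  have : ∏ k ∈ Finset.range n, (z + ((k + 1 : ℕ) : ℂ)) ≠ 0 :=
    Finset.prod_ne_zero_iff.mpr fun k _ => hne _
  simp only [Nat.cast_zero, add_zero]
  field_simp

lemma ne_neg_natCast_of_re_pos {w : ℂ} (hw : 0 < w.re) (k : ℕ) : w ≠ -k := fun h =>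
  add_natCast_ne_zero_of_re_pos hw k (by rw [h]; ring)

lemma one_div_sub_one_div {w : ℂ} {k : ℕ} (h : w + k ≠ 0) :
    1 / ((k : ℂ) + 1) - 1 / (w + k) = (w - 1) / ((k + 1) * (w + k)) := by
  have : (k : ℂ) + 1 ≠ 0 := Nat.cast_add_one_ne_zero k
  field_simp; ring

lemma summable_digamma_term {w : ℂ} (hw : 0 < w.re) :
    Summable (fun k : ℕ => 1 / ((k : ℂ) + 1) - 1 / (w + k)) := by
  set δ := min w.re 1
  refine Summable.of_norm_bounded (summable_const_div_succ_sq (‖w - 1‖ / δ)) fun k => ?_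
  rw [one_div_sub_one_div (add_natCast_ne_zero_of_re_pos hw k), norm_div, norm_mul, div_div]
  have h1 : ‖(k : ℂ) + 1‖ = k + 1 := by exact_mod_cast norm_natCast (k + 1)
  have h2 := mul_le_norm_add_natCast (min_le_right w.re 1) (min_le_left w.re 1) k
  rw [h1]
  refine div_le_div_of_nonneg_left (norm_nonneg _) (by positivity) ?_
  calc δ * ((k : ℝ) + 1) ^ 2 = (k + 1) * (δ * (k + 1)) := by ring
    _ ≤ _ := by gcongr

lemma hasDerivAt_logGamma_aux {w : ℂ} (hw : 0 < w.re) :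
    HasDerivAt logGamma (-Real.eulerMascheroniConstant +
      ∑' k : ℕ, (1 / ((k : ℂ) + 1) - 1 / (w + k))) w := by
  have hk1 : ∀ k : ℕ, (k : ℂ) + 1 ≠ 0 := fun k => Nat.cast_add_one_ne_zero k
  have h1 : HasDerivAt (fun z => ∑' k : ℕ, (z / ((k : ℂ) + 1) - log (1 + z / (k + 1))))
      (∑' k : ℕ, (1 / ((k : ℂ) + 1) - 1 / (w + (k + 1)))) w := by
    refine hasDerivAt_tsum_of_re_pos (g := fun k z => z / ((k : ℂ) + 1) - log (1 + z / (k + 1)))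
      (g' := fun k z => 1 / ((k : ℂ) + 1) - 1 / (z + (k + 1))) (fun k z hz => ?_) ?_
      (summable_logGamma_term 1) hw
    · have hd := (hasDerivAt_id z).div_const ((k : ℂ) + 1)
      have hs : 1 + z / ((k : ℂ) + 1) ∈ slitPlane := by
        left
        have : z / ((k : ℂ) + 1) = z / ((k + 1 : ℝ) : ℂ) := by push_cast; rfl
        rw [add_re, this, div_ofReal_re]
        simp; positivity
      refine (hd.sub ((hd.const_add 1).clog hs)).congr_deriv ?_
      have : z + (k + 1) ≠ 0 := by
        have := add_natCast_ne_zero_of_re_pos hz (k + 1); push_cast at this; exact this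
      have h' : 1 + z / ((k : ℂ) + 1) = (z + (k + 1)) / (k + 1) := by
        field_simp [hk1 k]; ring
      simp only [id]
      rw [h']
      field_simp [hk1 k]
    · intro δ R hδ hδ1 hR
      refine ⟨R, fun k z hz hzR => ?_⟩
      have hz0 := hδ.trans hz
      have hne := add_natCast_ne_zero_of_re_pos hz0 (k + 1)
      push_cast at hne
      have e : 1 / ((k : ℂ) + 1) - 1 / (z + (k + 1)) = z / ((k + 1) * (z + (k + 1))) := by
        field_simp [hk1 k]; ring
      have h1 : ‖(k : ℂ) + 1‖ = k + 1 := by exact_mod_cast norm_natCast (k + 1)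
      have h2 : (k : ℝ) + 1 ≤ ‖z + (k + 1)‖ := by
        refine le_trans ?_ (re_le_norm _)
        simp; linarith
      rw [e, norm_div, norm_mul, h1, pow_two]
      gcongr
  have h2 := (((hasDerivAt_id w).const_mul (-Real.eulerMascheroniConstant : ℂ)).sub
    (hasDerivAt_log (Or.inl hw))).add h1
  refine h2.congr_deriv ?_
  have hs := summable_digamma_term hw
  -- The differentiated series starts at $1/(w+1)$; the summand $-\log z$ supplies the missing
  -- $-1/w$, so the index shifts down by one.
  have ht : HasSum (fun k : ℕ => 1 / ((k : ℂ) + 1) - 1 / (w + (k + 1)))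
      (w⁻¹ + ∑' k : ℕ, (1 / ((k : ℂ) + 1) - 1 / (w + k))) := by
    have hsum : Summable (fun k : ℕ => 1 / ((k : ℂ) + 1) - 1 / (w + (k + 1))) := by
      have hw1 : 0 < (w + 1).re := by simp; linarith
      have a := summable_digamma_term hw1
      refine a.congr fun k => ?_
      congr 2; ring
    rw [hsum.hasSum_iff_tendsto_nat]
    have hlim : Tendsto (fun n : ℕ => 1 / (w + n)) atTop (𝓝 0) := by
      refine squeeze_zero_norm' (a := fun n : ℕ => 1 / (n : ℝ)) ?_
        tendsto_one_div_atTop_nhds_zero_nat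
      filter_upwards [eventually_gt_atTop 0] with n hn
      rw [norm_div, norm_one]
      gcongr
      refine le_trans ?_ (re_le_norm _)
      simp; linarith
    have := (hs.hasSum.tendsto_sum_nat.const_add w⁻¹).sub hlim
    rw [sub_zero] at this
    refine this.congr fun n => ?_
    induction n with
    | zero => simp
    | succ n ih =>
      rw [Finset.sum_range_succ, Finset.sum_range_succ, ← ih]
      push_cast; ring
  rw [ht.tsum_eq]
  ring

/-- Differentiating $\exp(\log\Gamma)=\Gamma$ identifies the derivative with the logarithmic
derivative of Γ. Comparison with the termwise derivative then yields the digamma series. -/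
lemma hasDerivAt_logGamma {w : ℂ} (hw : 0 < w.re) : HasDerivAt logGamma (digamma w) w := by
  have h := hasDerivAt_logGamma_aux hw
  refine h.congr_deriv ?_
  have he : (fun z => exp (logGamma z)) =ᶠ[𝓝 w] Gamma := by
    filter_upwards [(isOpen_lt continuous_const continuous_re).mem_nhds hw] with z hz
    exact exp_logGamma (ne_neg_natCast_of_re_pos hz)
  have h2 := h.cexp.congr_of_eventuallyEq he.symm
  rw [digamma_def, logDeriv_apply, h2.deriv, ← he.self_of_nhds]
  field_simp [exp_ne_zero]

/-- The series expansion of the digamma function. -/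
lemma digamma_eq_tsum {w : ℂ} (hw : 0 < w.re) :
    digamma w = -Real.eulerMascheroniConstant +
      ∑' k : ℕ, (1 / ((k : ℂ) + 1) - 1 / (w + k)) :=
  (hasDerivAt_logGamma hw).unique (hasDerivAt_logGamma_aux hw)

/-- The trigamma function, as a series. -/
noncomputable def trigamma (w : ℂ) : ℂ := ∑' k : ℕ, 1 / (w + k) ^ 2

lemma summable_trigamma_term {w : ℂ} (hw : 0 < w.re) :
    Summable (fun k : ℕ => ‖1 / (w + k) ^ 2‖) := by
  set δ := min w.re 1
  refine Summable.of_nonneg_of_le (fun _ => norm_nonneg _) (fun k => ?_)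
    (summable_const_div_succ_sq (1 / δ ^ 2))
  have h2 := mul_le_norm_add_natCast (min_le_right w.re 1) (min_le_left w.re 1) k
  rw [norm_div, norm_one, norm_pow, div_div, ← mul_pow]
  gcongr

lemma hasDerivAt_digamma {w : ℂ} (hw : 0 < w.re) : HasDerivAt digamma (trigamma w) w := by
  have h1 : HasDerivAt (fun z => ∑' k : ℕ, (1 / ((k : ℂ) + 1) - 1 / (z + k))) (trigamma w) w := by
    refine hasDerivAt_tsum_of_re_pos (g := fun k z => 1 / ((k : ℂ) + 1) - 1 / (z + k))
      (g' := fun k z => 1 / (z + k) ^ 2) (fun k z hz => ?_) ?_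
      (summable_digamma_term (by simp)) hw
    · have := (((hasDerivAt_id z).add_const (k : ℂ)).inv
        (add_natCast_ne_zero_of_re_pos hz k)).const_sub (1 / ((k : ℂ) + 1))
      simp only [id, neg_div, neg_neg] at this
      simpa only [one_div, Pi.inv_apply] using this
    · intro δ R hδ hδ1 hR
      refine ⟨1 / δ ^ 2, fun k z hz _ => ?_⟩
      have h2 := mul_le_norm_add_natCast hδ1 hz.le k
      rw [norm_div, norm_one, norm_pow, div_div, ← mul_pow]
      gcongr
  refine (h1.const_add (-Real.eulerMascheroniConstant : ℂ)).congr_of_eventuallyEq ?_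
  filter_upwards [(isOpen_lt continuous_const continuous_re).mem_nhds hw] with z hz
  exact digamma_eq_tsum hz

lemma one_add_div_eq {z : ℂ} (k : ℕ) :
    1 + z / ((k : ℂ) + 1) = (z + (k + 1 : ℕ)) / (k + 1) := by
  have : (k : ℂ) + 1 ≠ 0 := Nat.cast_add_one_ne_zero k
  push_cast; field_simp; ring

/-- Pulling a positive real factor out of the principal logarithm is exact, so the difference is
$\log(1+z/n)$ eventually. -/
lemma tendsto_log_add_natCast_sub_log (z : ℂ) :
    Tendsto (fun n : ℕ => log (z + n) - log n) atTop (𝓝 0) := by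
  have h0 : Tendsto (fun n : ℕ => 1 + z / n) atTop (𝓝 1) := by
    simpa using (tendsto_const_div_atTop_nhds_zero_nat z).const_add 1
  have h1 : Tendsto (fun n : ℕ => log (1 + z / n)) atTop (𝓝 0) := by
    simpa [Function.comp_def] using (continuousAt_clog (x := 1) (by simp)).tendsto.comp h0
  refine h1.congr' ?_
  filter_upwards [eventually_ne_atTop 0, h0.eventually_ne one_ne_zero] with n hn hne
  have e : z + n = ((n : ℝ) : ℂ) * (1 + z / n) := by push_cast; field_simp; ring
  rw [e, log_ofReal_mul (by positivity) hne, ← natCast_log]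
  ring

/-- The identity is exact, not merely modulo $2\pi i$: since $k+1>0$,
$\log(1+u/(k+1))=\log(u+k+1)-\log(k+1)$, so the difference of the partial sums telescopes. The
leftover $H_n-\log(z+1+n)$ tends to γ. -/
lemma logGamma_add_one {z : ℂ} (hz : ∀ k : ℕ, z ≠ -k) :
    logGamma (z + 1) = logGamma z + log z := by
  have hne : ∀ k : ℕ, z + k ≠ 0 := fun k h => hz k (eq_neg_of_add_eq_zero_left h)
  have h1 := ((summable_logGamma_term z).hasSum.tendsto_sum_nat).const_add
    (-Real.eulerMascheroniConstant * z - log z)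
  have h2 := ((summable_logGamma_term (z + 1)).hasSum.tendsto_sum_nat).const_add
    (-Real.eulerMascheroniConstant * (z + 1) - log (z + 1))
  have h3 := tendsto_harmonic_sub_log_ofReal
  have h4 := tendsto_log_add_natCast_sub_log (z + 1)
  have h5 := (h1.add (((h3.sub h4).sub_const (Real.eulerMascheroniConstant : ℂ)).add_const
    (log z)))
  have e : logGamma z + (Real.eulerMascheroniConstant - 0 - Real.eulerMascheroniConstant + log z) =
    logGamma z + log z := by ring
  rw [← e]
  refine tendsto_nhds_unique h2 (h5.congr fun n => ?_)
  have key : ∀ n : ℕ, ∑ k ∈ Finset.range n, ((z + 1) / ((k : ℂ) + 1) - log (1 + (z + 1) / (k + 1)))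
      = ∑ k ∈ Finset.range n, (z / ((k : ℂ) + 1) - log (1 + z / (k + 1))) +
        ∑ k ∈ Finset.range n, 1 / ((k : ℂ) + 1) - (log (z + 1 + n) - log (z + 1)) := by
    intro n
    induction n with
    | zero => simp
    | succ n ih =>
      rw [Finset.sum_range_succ, Finset.sum_range_succ, Finset.sum_range_succ, ih]
      have hl : ∀ u : ℂ, u + (n + 1 : ℕ) ≠ 0 →
          log (1 + u / (n + 1)) = log (u + (n + 1 : ℕ)) - log ((n : ℂ) + 1) := by
        intro u hu
        have e : 1 + u / ((n : ℂ) + 1) = (((n + 1 : ℝ)⁻¹ : ℝ) : ℂ) * (u + (n + 1 : ℕ)) := by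
          rw [one_add_div_eq]; push_cast; ring
        rw [e, log_ofReal_mul (by positivity) hu, Real.log_inv, ofReal_neg, ofReal_log (by positivity)]
        push_cast; ring
      rw [hl z (hne _), hl (z + 1) (by have := hne (n + 2); push_cast at this ⊢; rwa [add_assoc,
        show (1 : ℂ) + (n + 1) = n + 2 by ring])]
      have : z + ((n + 1 : ℕ) : ℂ) = z + 1 + n := by push_cast; ring
      rw [this]
      push_cast; ring
  rw [key]
  ring

/-! ### The Barnes double gamma function -/

/-- The terms of the logarithm of the Weierstrass product of `1 / Γ₂(w)`. -/
noncomputable def logBarnesTerm (k : ℕ) (w : ℂ) : ℂ :=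
  (k + 1) * log (1 + (w - 1) / (k + 1)) + (-(w - 1) + (w - 1) ^ 2 / (2 * (k + 1)))

/-- The polynomial cancels the logarithm's Taylor expansion through order two, leaving $(k+1)\cdot
O(k^{-3})$. -/
lemma summable_logBarnesTerm (w : ℂ) : Summable (fun k : ℕ => logBarnesTerm k w) := by
  refine Summable.of_norm_bounded_eventually_nat (summable_const_div_succ_sq (‖w - 1‖ ^ 3)) ?_
  filter_upwards [eventually_ge_atTop ⌈2 * ‖w - 1‖⌉₊] with k hk
  have hk' : 2 * ‖w - 1‖ ≤ k := Nat.ceil_le.mp hk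
  set z := w - 1 with hz
  have hkn : ‖(k : ℂ) + 1‖ = k + 1 := by exact_mod_cast norm_natCast (k + 1)
  have hn : ‖z / ((k : ℂ) + 1)‖ = ‖z‖ / (k + 1) := by rw [norm_div, hkn]
  have hle : ‖z / ((k : ℂ) + 1)‖ ≤ 1 / 2 := by
    rw [hn, div_le_iff₀ (by positivity)]; linarith
  have h := norm_log_sub_logTaylor_le 2 (z := z / ((k : ℂ) + 1)) (by linarith)
  have e : logBarnesTerm k w =
      ((k : ℂ) + 1) * (log (1 + z / (k + 1)) - logTaylor (2 + 1) (z / (k + 1))) := by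
    have ht : ∀ x : ℂ, logTaylor (2 + 1) x = x - x ^ 2 / 2 := fun x => by
      simp [logTaylor, Finset.sum_range_succ]; ring
    rw [ht, logBarnesTerm, ← hz]
    field_simp
    ring
  rw [e, norm_mul, hkn]
  have h2 : (1 - ‖z / ((k : ℂ) + 1)‖)⁻¹ ≤ 2 := by
    rw [inv_le_comm₀ (by linarith) (by norm_num)]; linarith
  have h3 : ‖z / ((k : ℂ) + 1)‖ ^ (2 + 1) = ‖z‖ ^ 3 / (k + 1) ^ 3 := by rw [hn, div_pow]
  calc ((k : ℝ) + 1) * ‖log (1 + z / (k + 1)) - logTaylor (2 + 1) (z / (k + 1))‖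
      ≤ (k + 1) * (‖z‖ ^ 3 / (k + 1) ^ 3 * 2 / 2) := by
        gcongr
        refine h.trans ?_
        rw [h3]
        push_cast
        refine div_le_div₀ (by positivity) (by gcongr) (by norm_num) (by norm_num)
    _ = _ := by field_simp

/-- The logarithm of `Γ₂`. -/
noncomputable def logGamma2 (w : ℂ) : ℂ :=
  -(((-1 / 2 - Real.eulerMascheroniConstant / 2) * (w - 1) ^ 2 +
      (-1 / 2 - deriv riemannZeta 0) * (w - 1)) + ∑' k, logBarnesTerm k w)

lemma exp_logBarnesTerm {w : ℂ} (hw : ∀ k : ℕ, w ≠ -k) (k : ℕ) :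
    exp (logBarnesTerm k w) =
      (1 + (w - 1) / (k + 1)) ^ (k + 1) * exp (-(w - 1) + (w - 1) ^ 2 / (2 * (k + 1))) := by
  have hne : 1 + (w - 1) / ((k : ℂ) + 1) ≠ 0 := by
    rw [one_add_div_eq]
    refine div_ne_zero ?_ (Nat.cast_add_one_ne_zero k)
    intro h
    refine hw k ?_
    push_cast at h
    linear_combination h
  rw [logBarnesTerm, exp_add]
  congr 1
  have : ((k : ℂ) + 1) = ((k + 1 : ℕ) : ℂ) := by push_cast; rfl
  rw [this, exp_nat_mul, ← this, exp_log hne]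

lemma exp_logGamma2 {w : ℂ} (hw : ∀ k : ℕ, w ≠ -k) : exp (logGamma2 w) = Gamma2 w := by
  have h := (summable_logBarnesTerm w).hasSum.cexp
  rw [logGamma2, exp_neg, exp_add, Gamma2, invGamma2AddOne, ← h.tprod_eq]
  congr 3
  ext k
  exact exp_logBarnesTerm hw k

/-- The differentiated terms sum to $(w-1)(\psi(w)+\gamma)$; this γ cancels the one in the quadratic
prefactor. -/
lemma hasDerivAt_logGamma2 {w : ℂ} (hw : 0 < w.re) :
    HasDerivAt logGamma2 ((w - 1) + 1 / 2 + deriv riemannZeta 0 - (w - 1) * digamma w) w := by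
  have h1 : HasDerivAt (fun z => ∑' k : ℕ, logBarnesTerm k z)
      (∑' k : ℕ, (w - 1) * (1 / ((k : ℂ) + 1) - 1 / (w + k))) w := by
    refine hasDerivAt_tsum_of_re_pos (g := logBarnesTerm)
      (g' := fun k z => (z - 1) * (1 / ((k : ℂ) + 1) - 1 / (z + k))) (fun k z hz => ?_) ?_
      (summable_logBarnesTerm 1) hw
    · have hk1 : (k : ℂ) + 1 ≠ 0 := Nat.cast_add_one_ne_zero k
      have hzk := add_natCast_ne_zero_of_re_pos hz k
      have e : 1 + (z - 1) / ((k : ℂ) + 1) = (z + k) / (k + 1) := by field_simp; ring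
      have hs : 1 + (z - 1) / ((k : ℂ) + 1) ∈ slitPlane := by
        left
        have : (z + k) / ((k : ℂ) + 1) = (z + k) / ((k + 1 : ℝ) : ℂ) := by push_cast; rfl
        rw [e, this, div_ofReal_re]
        simp; positivity
      have hid := (hasDerivAt_id z).sub_const 1
      refine (((((hid.div_const ((k : ℂ) + 1)).const_add 1).clog hs).const_mul ((k : ℂ) + 1)).add
        (hid.neg.add ((hid.pow 2).div_const (2 * ((k : ℂ) + 1))))).congr_deriv ?_
      simp only [id]
      rw [e]
      field_simp
      push_cast
      ring
    · intro δ R hδ hδ1 hR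
      refine ⟨(R + 1) * ((R + 1) / δ), fun k z hz hzR => ?_⟩
      have hz0 := hδ.trans hz
      have h2 := mul_le_norm_add_natCast hδ1 hz.le k
      have h3 : ‖z - 1‖ ≤ R + 1 := (norm_sub_le _ _).trans (by simpa using hzR.le)
      have hkn : ‖(k : ℂ) + 1‖ = k + 1 := by exact_mod_cast norm_natCast (k + 1)
      rw [one_div_sub_one_div (add_natCast_ne_zero_of_re_pos hz0 k), norm_mul, norm_div, norm_mul,
        hkn]
      calc ‖z - 1‖ * (‖z - 1‖ / ((k + 1) * ‖z + k‖))
          ≤ (R + 1) * ((R + 1) / ((k + 1) * (δ * (k + 1)))) := by gcongr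
        _ = _ := by field_simp
  have hid := (hasDerivAt_id w).sub_const 1
  refine ((((hid.pow 2).const_mul (-1 / 2 - Real.eulerMascheroniConstant / 2 : ℂ)).add
    (hid.const_mul (-1 / 2 - deriv riemannZeta 0))).add h1).neg.congr_deriv ?_
  rw [tsum_mul_left, digamma_eq_tsum hw]
  simp
  ring

/-- The second derivative of `log Γ₂`. -/
lemma hasDerivAt_deriv_logGamma2 {w : ℂ} (hw : 0 < w.re) :
    HasDerivAt (fun w => (w - 1) + 1 / 2 + deriv riemannZeta 0 - (w - 1) * digamma w)
      (1 - digamma w - (w - 1) * trigamma w) w := by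
  have hid := (hasDerivAt_id w).sub_const 1
  refine (((hid.add_const (1 / 2 : ℂ)).add_const (deriv riemannZeta 0)).sub
    (hid.mul (hasDerivAt_digamma hw))).congr_deriv ?_
  simp
  ring

/-! ### Asymptotics of the digamma and trigamma functions -/

lemma tendsto_one_div_add_natCast {w : ℂ} (hw : 0 < w.re) :
    Tendsto (fun n : ℕ => 1 / (w + n)) atTop (𝓝 0) := by
  refine squeeze_zero_norm' (a := fun n : ℕ => 1 / (n : ℝ)) ?_
    tendsto_one_div_atTop_nhds_zero_nat
  filter_upwards [eventually_gt_atTop 0] with n hn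
  rw [norm_div, norm_one]
  gcongr
  refine le_trans ?_ (re_le_norm _)
  simp; linarith

lemma add_natCast_re_pos {w : ℂ} (hw : 0 < w.re) (n : ℕ) : 0 < (w + n).re := by
  simp; positivity

lemma digamma_add_natCast {w : ℂ} (hw : 0 < w.re) (n : ℕ) :
    digamma (w + n) = digamma w + ∑ k ∈ Finset.range n, 1 / (w + k) := by
  induction n with
  | zero => simp
  | succ n ih =>
    rw [Finset.sum_range_succ, ← add_assoc, ← ih, Nat.cast_succ, ← add_assoc,
      digamma_apply_add_one _ (ne_neg_natCast_of_re_pos (add_natCast_re_pos hw n)), one_div]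

lemma tendsto_digamma_add_natCast_sub_log {w : ℂ} (hw : 0 < w.re) :
    Tendsto (fun n : ℕ => digamma (w + n) - log n) atTop (𝓝 0) := by
  have h1 := ((summable_digamma_term hw).hasSum.tendsto_sum_nat).const_add
    (-Real.eulerMascheroniConstant : ℂ)
  rw [← digamma_eq_tsum hw] at h1
  have h2 := (tendsto_harmonic_sub_log_ofReal.sub h1).add_const (digamma w)
  have h3 := h2.sub_const (Real.eulerMascheroniConstant : ℂ)
  have e : (Real.eulerMascheroniConstant : ℂ) - digamma w + digamma w -
    Real.eulerMascheroniConstant = 0 := by ring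
  rw [e] at h3
  refine h3.congr fun n => ?_
  rw [digamma_add_natCast hw, Finset.sum_sub_distrib]
  ring

lemma trigamma_add_one {w : ℂ} (hw : 0 < w.re) : trigamma (w + 1) = trigamma w - 1 / w ^ 2 := by
  have h := (summable_trigamma_term hw).of_norm.tsum_eq_zero_add
  rw [trigamma, trigamma, h]
  simp only [Nat.cast_zero, add_zero, add_sub_cancel_left]
  refine tsum_congr fun k => ?_
  push_cast
  ring_nf

lemma norm_le_norm_add_ofReal {z : ℂ} (hz : 0 ≤ z.re) {r : ℝ} (hr : 0 ≤ r) :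
    ‖z‖ ≤ ‖z + r‖ := by
  rw [← sq_le_sq₀ (norm_nonneg _) (norm_nonneg _), Complex.sq_norm, Complex.sq_norm,
    normSq_apply, normSq_apply]
  simp
  nlinarith

/-- Compare $1/(w+n+1+k)^2$ with the telescoping term $1/((w+n+k)(w+n+1+k))$, whose sum over $k$ is
$1/(w+n)$. After multiplication by $w+n$ the error is dominated by a tail of a convergent trigamma
series. -/
lemma tendsto_mul_trigamma {w : ℂ} (hw : 0 < w.re) :
    Tendsto (fun n : ℕ => (w + n) * trigamma (w + n + 1)) atTop (𝓝 1) := by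
  have hw1 : 0 < (w + 1).re := by simp; linarith
  have hs := summable_trigamma_term hw1
  have htail := tendsto_sum_nat_add (fun k => ‖1 / (w + 1 + (k : ℂ)) ^ 2‖)
  have hdiff : Tendsto (fun n : ℕ => (w + n) * trigamma (w + n + 1) - 1) atTop (𝓝 0) := by
    refine squeeze_zero_norm (fun n => ?_) htail
    have hn := add_natCast_re_pos hw n
    have hne := add_natCast_ne_zero_of_re_pos hn
    have hn1 : 0 < (w + n + 1).re := by simp at hn ⊢; linarith
    have hne1 := add_natCast_ne_zero_of_re_pos hn1
    have hst := (summable_trigamma_term hn1)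
    have htel : HasSum (fun k : ℕ => 1 / ((w + n + k) * (w + n + 1 + k))) (1 / (w + n)) := by
      have hsm : Summable (fun k : ℕ => 1 / ((w + n + k) * (w + n + 1 + k))) := by
        refine Summable.of_norm_bounded (summable_trigamma_term hn) fun k => ?_
        rw [norm_div, norm_div, norm_mul, pow_two, norm_mul]
        have h0 : 0 < ‖w + n + k‖ := norm_pos_iff.mpr (hne k)
        gcongr
        have h1 := norm_le_norm_add_ofReal (add_natCast_re_pos hn k).le zero_le_one
        rwa [ofReal_one, show w + n + k + 1 = w + n + 1 + k by ring] at h1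
      rw [hsm.hasSum_iff_tendsto_nat]
      have := (tendsto_one_div_add_natCast hn).const_sub (1 / (w + n))
      rw [sub_zero] at this
      refine this.congr fun m => ?_
      induction m with
      | zero => simp
      | succ m ih =>
        rw [Finset.sum_range_succ, ← ih]
        have a := hne m
        have b := hne1 m
        have c := hne 0
        have e : w + n + ((m + 1 : ℕ) : ℂ) = w + n + 1 + m := by push_cast; ring
        rw [e]
        field_simp
        ring
    have hterm : HasSum (fun k : ℕ => (w + n) * (1 / (w + n + 1 + k) ^ 2 -
        1 / ((w + n + k) * (w + n + 1 + k)))) ((w + n) * trigamma (w + n + 1) - 1) := by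
      have h := (hst.of_norm.hasSum.sub htel).mul_left (w + n)
      have e : (w + n) * (1 / (w + n)) = 1 := by
        have c := hne 0
        rw [Nat.cast_zero, add_zero] at c
        field_simp
      rwa [mul_sub, e] at h
    have hbound : ∀ k : ℕ, ‖(w + n) * (1 / (w + n + 1 + k) ^ 2 -
        1 / ((w + n + k) * (w + n + 1 + k)))‖ ≤ ‖1 / (w + 1 + ((k + n : ℕ) : ℂ)) ^ 2‖ := by
      intro k
      have a := hne k
      have e1 : w + 1 + ((k + n : ℕ) : ℂ) = w + n + 1 + k := by push_cast; ring
      have e2 : (w + n) * (1 / (w + n + 1 + k) ^ 2 - 1 / ((w + n + k) * (w + n + 1 + k))) =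
          -((w + n) / (w + n + k)) * (1 / (w + n + 1 + k) ^ 2) := by
        field_simp
        ring
      rw [e1, e2, norm_mul, norm_neg, norm_div]
      refine mul_le_of_le_one_left (norm_nonneg _) (div_le_one_of_le₀ ?_ (norm_nonneg _))
      exact_mod_cast norm_le_norm_add_ofReal hn.le (Nat.cast_nonneg k)
    have hsum := (summable_nat_add_iff n).mpr hs
    exact hterm.tsum_eq ▸ tsum_of_norm_bounded hsum.hasSum hbound
  simpa using hdiff.add_const 1

/-- The second derivative of `log Γ₂`. -/
noncomputable def digamma2Deriv (w : ℂ) : ℂ := 1 - digamma w - (w - 1) * trigamma w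

/-- Makes `-digamma2Deriv` a discrete antiderivative of `trigamma`, so sums of trigamma values along
unit steps telescope. -/
lemma digamma2Deriv_add_one {w : ℂ} (hw : 0 < w.re) :
    digamma2Deriv (w + 1) = digamma2Deriv w - trigamma w := by
  have hw0 : w ≠ 0 := by simpa using add_natCast_ne_zero_of_re_pos hw 0
  rw [digamma2Deriv, digamma2Deriv, trigamma_add_one hw,
    digamma_apply_add_one _ (ne_neg_natCast_of_re_pos hw)]
  field_simp
  ring

lemma sum_trigamma {w : ℂ} (hw : 0 < w.re) (n : ℕ) :
    ∑ k ∈ Finset.range n, trigamma (w + k) = digamma2Deriv w - digamma2Deriv (w + n) := by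
  induction n with
  | zero => simp
  | succ n ih =>
    rw [Finset.sum_range_succ, ih, Nat.cast_succ, ← add_assoc,
      digamma2Deriv_add_one (add_natCast_re_pos hw n)]
    ring

/-- Combines $\psi(w+n)-\log n\to0$ with $(w+n)\psi'(w+n+1)\to1$; the limit 1 cancels the constant 1
in `digamma2Deriv`. -/
lemma tendsto_digamma2Deriv_add_log {w : ℂ} (hw : 0 < w.re) :
    Tendsto (fun n : ℕ => digamma2Deriv (w + n) + log n) atTop (𝓝 0) := by
  have h1 := tendsto_digamma_add_natCast_sub_log hw
  have h2 := tendsto_mul_trigamma hw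
  have h3 : Tendsto (fun n : ℕ => 1 / (w + n)) atTop (𝓝 0) := tendsto_one_div_add_natCast hw
  have h4 : Tendsto (fun n : ℕ => trigamma (w + n)) atTop (𝓝 0) := by
    have := (h3.mul h2).add (h3.mul h3)
    simp only [zero_mul, add_zero] at this
    refine this.congr fun n => ?_
    have hn := add_natCast_re_pos hw n
    have hne : w + n ≠ 0 := add_natCast_ne_zero_of_re_pos hw n
    rw [trigamma_add_one hn]
    field_simp
    ring
  have h5 := ((h1.const_sub 1).sub h2).add (h4.sub h3)
  simp only [sub_zero, add_zero, sub_self] at h5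
  refine h5.congr fun n => ?_
  have hn := add_natCast_re_pos hw n
  have hne : w + n ≠ 0 := add_natCast_ne_zero_of_re_pos hw n
  rw [digamma2Deriv, trigamma_add_one hn]
  field_simp
  ring

/-- The limit of `∑ₖ ((1/l²) ψ'((w + k + l)/l) - (1/l) / (w + k + l/2))`. -/
lemma tendsto_sum_trigamma_sub {l : ℕ} (hl : 1 ≤ l) {w : ℂ} (hw : -(l / 2 : ℝ) < w.re) :
    Tendsto (fun n : ℕ => ∑ k ∈ Finset.range (l * n),
      (1 / (l : ℂ) ^ 2 * trigamma ((w + k + l) / l) - 1 / l * (1 / (w + k + l / 2)))) atTop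
      (𝓝 (-(1 / l) * Real.log l + 1 / (l : ℂ) ^ 2 *
        ∑ r ∈ Finset.range l, digamma2Deriv ((w + l + r) / l) +
        1 / l * digamma (w + l / 2))) := by
  have hl0 : (l : ℂ) ≠ 0 := by exact_mod_cast (by omega : l ≠ 0)
  have hlp : (0 : ℝ) < l := by exact_mod_cast hl
  have hz : ∀ r : ℕ, 0 < ((w + l + r) / l).re := fun r => by
    rw [show ((w + l + r) / l) = (w + l + r) / ((l : ℝ) : ℂ) by push_cast; rfl, div_ofReal_re]
    simp only [add_re, natCast_re]
    have : (0 : ℝ) ≤ r := r.cast_nonneg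
    apply div_pos _ hlp
    linarith
  have hv : 0 < (w + l / 2).re := by
    rw [show (w + l / 2) = w + ((l / 2 : ℝ) : ℂ) by push_cast; rfl]
    simp only [add_re, ofReal_re]; linarith
  -- Writing $k=lj+r$ turns a unit step in $k$ into a unit step in $j$ of the argument $(w+l+r)/l$.
  have hsplit : ∀ (f : ℕ → ℂ) (n : ℕ), ∑ k ∈ Finset.range (l * n), f k =
      ∑ r ∈ Finset.range l, ∑ j ∈ Finset.range n, f (l * j + r) := by
    intro f n
    rw [Finset.sum_comm]
    induction n with
    | zero => simp
    | succ n ih => rw [Finset.sum_range_succ, ← ih, Nat.mul_succ, Finset.sum_range_add]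
  have h1 : ∀ r ∈ Finset.range l, Tendsto (fun n : ℕ => digamma2Deriv ((w + l + r) / l) -
      (digamma2Deriv ((w + l + r) / l + n) + log n)) atTop
      (𝓝 (digamma2Deriv ((w + l + r) / l) - 0)) := fun r _ =>
    (tendsto_digamma2Deriv_add_log (hz r)).const_sub _
  have h2 := (tendsto_finsetSum _ h1).const_mul (1 / (l : ℂ) ^ 2)
  have hln : Tendsto (fun n : ℕ => l * n) atTop atTop :=
    tendsto_id.const_mul_atTop' (by omega)
  have h3 := (((tendsto_digamma_add_natCast_sub_log hv).comp hln).const_sub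
    (digamma (w + l / 2))).const_mul (1 / (l : ℂ))
  have h4 := (h2.add h3).add_const (-(1 / l) * (Real.log l : ℂ))
  have e : 1 / (l : ℂ) ^ 2 * ∑ r ∈ Finset.range l, (digamma2Deriv ((w + l + r) / l) - 0) +
      1 / l * (digamma (w + l / 2) - 0) + -(1 / l) * (Real.log l : ℂ) =
      -(1 / l) * Real.log l + 1 / (l : ℂ) ^ 2 *
        ∑ r ∈ Finset.range l, digamma2Deriv ((w + l + r) / l) +
        1 / l * digamma (w + l / 2) := by simp only [sub_zero]; ring
  rw [← e]
  refine h4.congr' ?_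
  filter_upwards [eventually_ne_atTop 0] with n hn
  have hn' : (n : ℝ) ≠ 0 := Nat.cast_ne_zero.mpr hn
  have e1 : ∑ k ∈ Finset.range (l * n), trigamma ((w + k + l) / l) =
      ∑ r ∈ Finset.range l, (digamma2Deriv ((w + l + r) / l) -
        digamma2Deriv ((w + l + r) / l + n)) := by
    rw [hsplit]
    refine Finset.sum_congr rfl fun r _ => ?_
    rw [← sum_trigamma (hz r)]
    refine Finset.sum_congr rfl fun j _ => ?_
    congr 1
    push_cast; field_simp; ring
  have e2 : ∑ k ∈ Finset.range (l * n), 1 / (w + k + l / 2) =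
      digamma (w + l / 2 + ((l * n : ℕ) : ℂ)) - digamma (w + l / 2) := by
    rw [digamma_add_natCast hv, add_sub_cancel_left]
    refine Finset.sum_congr rfl fun k _ => ?_
    rw [add_right_comm]
  -- The $l$ residue classes contribute $l\cdot\log n/l^2$, which cancels the $\log n$ of
  -- $\log(ln)/l$; only $-\log l/l$ survives.
  have e3 : log ((l * n : ℕ) : ℂ) = (Real.log l : ℂ) + log n := by
    rw [← natCast_log, ← natCast_log, Nat.cast_mul, Real.log_mul hlp.ne' hn', ofReal_add]
  have e4 : ∑ k ∈ Finset.range (l * n),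
      (1 / (l : ℂ) ^ 2 * trigamma ((w + k + l) / l) - 1 / l * (1 / (w + k + l / 2))) =
      1 / (l : ℂ) ^ 2 * ∑ k ∈ Finset.range (l * n), trigamma ((w + k + l) / l) -
      1 / l * ∑ k ∈ Finset.range (l * n), 1 / (w + k + l / 2) := by
    rw [Finset.sum_sub_distrib, ← Finset.mul_sum, ← Finset.mul_sum]
  rw [e4, e1, e2]
  simp only [Function.comp, e3, Finset.sum_sub_distrib, Finset.sum_add_distrib, Finset.sum_const,
    Finset.card_range, nsmul_eq_mul]
  field_simp
  ring

/-! ### Functional equation of `Γ₂` and the multiplication formula for `Γ` -/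

lemma factorial_eq_stirlingSeq {n : ℕ} (hn : n ≠ 0) :
    (n.factorial : ℝ) = Stirling.stirlingSeq n * (√2 * √n * (n / Real.exp 1) ^ n) := by
  have h : √(2 * (n : ℝ)) * (n / Real.exp 1) ^ n ≠ 0 := by positivity
  rw [← Real.sqrt_mul (by norm_num), Stirling.stirlingSeq, div_mul_cancel₀ _ h]

lemma stirlingSeq_ne_zero {n : ℕ} (hn : n ≠ 0) : Stirling.stirlingSeq n ≠ 0 := by
  obtain ⟨m, rfl⟩ := Nat.exists_eq_succ_of_ne_zero hn
  exact (Stirling.stirlingSeq'_pos m).ne'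

/-- The ratio of the partial Weierstrass products at $z+1$ and $z$ is a closed form in
$(z+n)^{n+1}$, $\prod_{j\le n}(z+j)$ and $H_n$. Stirling's formula turns this into `GammaSeq z n`
times elementary factors with known limits. -/
lemma Gamma2_add_one {z : ℂ} (hz : ∀ k : ℕ, z ≠ -k) :
    Gamma2 z = Gamma2 (z + 1) * Gamma z := by
  have hne : ∀ k : ℕ, z + k ≠ 0 := fun k h => hz k (eq_neg_of_add_eq_zero_left h)
  have hz1 : ∀ k : ℕ, z + 1 ≠ -k := fun k h => hz (k + 1) (by push_cast; linear_combination h)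
  have hk1 : ∀ k : ℕ, (k : ℂ) + 1 ≠ 0 := fun k => Nat.cast_add_one_ne_zero k
  have hA := (continuous_exp.tendsto _).comp
    (((summable_logBarnesTerm (z + 1)).hasSum.tendsto_sum_nat).sub
      (summable_logBarnesTerm z).hasSum.tendsto_sum_nat)
  have hγ := tendsto_harmonic_sub_log_ofReal
  have hσ : Tendsto (fun n => ((Stirling.stirlingSeq n : ℝ) : ℂ)) atTop (𝓝 ((√Real.pi : ℝ) : ℂ)) :=
    (continuous_ofReal.tendsto _).comp Stirling.tendsto_stirlingSeq_sqrt_pi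
  have hpi : ((√2 : ℝ) : ℂ) * ((√Real.pi : ℝ) : ℂ) ≠ 0 := by
    rw [← ofReal_mul, ofReal_ne_zero]; positivity
  have h0 : Tendsto (fun n : ℕ => 1 + z / n) atTop (𝓝 1) := by
    simpa using (tendsto_const_div_atTop_nhds_zero_nat z).const_add 1
  have hB := ((((GammaSeq_tendsto_Gamma z).mul (tendsto_one_add_div_pow_exp z)).mul h0).mul
    ((continuous_exp.tendsto _).comp (hγ.const_mul (z - 1 / 2)))).div
    (hσ.const_mul ((√2 : ℝ) : ℂ)) hpi
  have hAB := tendsto_nhds_unique hA (hB.congr' ?_)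
  · have hG : Gamma2 z = exp (logGamma2 z) := (exp_logGamma2 hz).symm
    have hG1 : Gamma2 (z + 1) = exp (logGamma2 (z + 1)) := (exp_logGamma2 hz1).symm
    have e2 : exp ((Real.log (2 * Real.pi) : ℂ) / 2) = ((√2 : ℝ) : ℂ) * ((√Real.pi : ℝ) : ℂ) := by
      rw [← ofReal_mul, ← Real.sqrt_mul (by norm_num), Real.sqrt_eq_rpow,
        Real.rpow_def_of_pos (by positivity), ofReal_exp]
      congr 1; push_cast; ring
    -- The constant $\sqrt{2\pi}$ from Stirling is matched by $\zeta'(0)=-\tfrac12\log 2\pi$ in the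
    -- exponent of $\Gamma_2$.
    have hz' : deriv riemannZeta 0 = -(Real.log (2 * Real.pi) : ℂ) / 2 := by
      rw [deriv_riemannZeta_zero, ofReal_log (by positivity)]; push_cast; rfl
    have key : logGamma2 z = logGamma2 (z + 1) +
        ((∑' k, logBarnesTerm k (z + 1) - ∑' k, logBarnesTerm k z) +
        (-z - (z - 1 / 2) * Real.eulerMascheroniConstant + Real.log (2 * Real.pi) / 2)) := by
      rw [logGamma2, logGamma2, hz']; ring
    rw [hG, key, exp_add, exp_add, hAB, exp_add, e2, ← hG1, exp_sub, exp_neg]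
    have := exp_ne_zero z
    have := exp_ne_zero ((z - 1 / 2) * Real.eulerMascheroniConstant)
    have := left_ne_zero_of_mul hpi
    have := right_ne_zero_of_mul hpi
    field_simp
  · filter_upwards [eventually_ne_atTop 0] with n hn
    have hn' : (n : ℂ) ≠ 0 := Nat.cast_ne_zero.mpr hn
    have hratio : ∀ n : ℕ, exp (∑ k ∈ Finset.range n, logBarnesTerm k (z + 1) -
        ∑ k ∈ Finset.range n, logBarnesTerm k z) = (z + n) ^ (n + 1) /
        (∏ j ∈ Finset.range (n + 1), (z + j)) *
        exp (-n + (z - 1 / 2) * ∑ k ∈ Finset.range n, 1 / ((k : ℂ) + 1)) := by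
      intro n
      induction n with
      | zero =>
        have := hne 0
        simp only [Nat.cast_zero, add_zero] at this
        simp [this]
      | succ n ih =>
        rw [Finset.sum_range_succ, Finset.sum_range_succ, Finset.sum_range_succ,
          add_sub_add_comm, exp_add, ih, exp_sub, exp_logBarnesTerm hz1, exp_logBarnesTerm hz,
          Finset.prod_range_succ _ (n + 1)]
        have a := hne n
        have b := hne (n + 1)
        have e3 : 1 + (z + 1 - 1) / ((n : ℂ) + 1) = (z + (n + 1 : ℕ)) / (n + 1) := by
          rw [← one_add_div_eq]; ring
        have e4 : 1 + (z - 1) / ((n : ℂ) + 1) = (z + n) / (n + 1) := by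
          rw [one_add_div_eq]; push_cast; ring
        have e5 : exp (-((n + 1 : ℕ) : ℂ) + (z - 1 / 2) *
            (∑ k ∈ Finset.range n, 1 / ((k : ℂ) + 1) + 1 / (n + 1))) =
            exp (-(n : ℂ) + (z - 1 / 2) * ∑ k ∈ Finset.range n, 1 / ((k : ℂ) + 1)) *
            exp (-(z + 1 - 1) + (z + 1 - 1) ^ 2 / (2 * ((n : ℂ) + 1))) *
            (exp (-(z - 1) + (z - 1) ^ 2 / (2 * ((n : ℂ) + 1))))⁻¹ := by
          rw [← exp_neg, ← exp_add, ← exp_add]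
          congr 1
          have := hk1 n
          push_cast
          field_simp
          ring
        rw [e3, e4, e5, div_pow, div_pow]
        have := hk1 n
        have := exp_ne_zero (-(z - 1) + (z - 1) ^ 2 / (2 * ((n : ℂ) + 1)))
        generalize exp (-(z - 1) + (z - 1) ^ 2 / (2 * ((n : ℂ) + 1))) = E1 at *
        generalize exp (-(z + 1 - 1) + (z + 1 - 1) ^ 2 / (2 * ((n : ℂ) + 1))) = E2 at *
        generalize ∏ j ∈ Finset.range (n + 1), (z + (j : ℂ)) = Pr at *
        generalize z + ((n + 1 : ℕ) : ℂ) = u at *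
        generalize z + (n : ℂ) = v at *
        generalize (n : ℂ) + 1 = q at *
        rw [pow_succ u (n + 1)]
        field_simp
    simp only [Function.comp, Pi.div_apply]
    rw [hratio, GammaSeq, cpow_def_of_ne_zero hn']
    -- Stirling's formula introduces the $n!$ that `GammaSeq` contains but the product ratio does
    -- not, absorbing its $n^ne^{-n}$.
    have hf : ((n.factorial : ℕ) : ℂ) = (Stirling.stirlingSeq n : ℂ) *
        (((√2 : ℝ) : ℂ) * ((√n : ℝ) : ℂ) * ((n : ℂ) ^ n * exp (-n))) := by
      have := congrArg (fun x : ℝ => (x : ℂ)) (factorial_eq_stirlingSeq hn)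
      simp only [ofReal_natCast] at this
      rw [this]
      have e : exp (-(n : ℂ)) = ((Real.exp 1 : ℝ) : ℂ)⁻¹ ^ n := by
        rw [ofReal_exp, ← exp_neg, ← exp_nat_mul]; congr 1; push_cast; ring
      rw [e]
      push_cast
      rw [div_pow, inv_pow]
      ring
    have hs : exp (log n) = ((√n : ℝ) : ℂ) ^ 2 := by
      rw [exp_log hn', ← ofReal_pow, Real.sq_sqrt (by positivity)]; simp
    have hsq : exp (1 / 2 * log n) = ((√n : ℝ) : ℂ) := by
      rw [Real.sqrt_eq_rpow, Real.rpow_def_of_pos (by positivity), ofReal_exp]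
      congr 1; push_cast; ring
    have hpow : (z + n) ^ (n + 1) = (n : ℂ) ^ n * ((√n : ℝ) : ℂ) ^ 2 *
        ((1 + z / n) ^ n * (1 + z / n)) := by
      have : z + n = n * (1 + z / n) := by field_simp; ring
      rw [← hs, exp_log hn', this, mul_pow, pow_succ, pow_succ (1 + z / (n : ℂ))]
    have hexp : exp (-(n : ℂ) + (z - 1 / 2) * ∑ k ∈ Finset.range n, 1 / ((k : ℂ) + 1)) =
        exp (-n) * exp (log n * z) * (((√n : ℝ) : ℂ))⁻¹ *
        exp ((z - 1 / 2) * (∑ k ∈ Finset.range n, 1 / ((k : ℂ) + 1) - log n)) := by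
      rw [← hsq, ← exp_neg, ← exp_add, ← exp_add, ← exp_add]; congr 1; ring
    rw [hpow, hexp, hf]
    have h1 : (Stirling.stirlingSeq n : ℂ) ≠ 0 := ofReal_ne_zero.mpr (stirlingSeq_ne_zero hn)
    field_simp

/-- Isolates the part of Gauss's formula that does not involve the argument. In terms of Stirling
ratios the large powers of $n+1$ and $e$ cancel, leaving a quantity that tends to
$(2\pi)^{L/2}\sqrt{L+1}$. -/
lemma stirlingSeq_multiplication {L n : ℕ} :
    √(n : ℝ) ^ L * (n.factorial : ℝ) ^ (L + 1) * (L + 1 : ℝ) ^ ((L + 1) * (n + 1)) /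
      (((L + 1) * (n + 1) - 1).factorial : ℝ) =
    (√(n : ℝ) / √((n + 1 : ℕ) : ℝ)) ^ L * √2 ^ L * √(L + 1 : ℝ) *
      (Stirling.stirlingSeq (n + 1) ^ (L + 1) / Stirling.stirlingSeq ((L + 1) * (n + 1))) := by
  have h1 := factorial_eq_stirlingSeq (Nat.succ_ne_zero n)
  have hM : (L + 1) * (n + 1) ≠ 0 := by positivity
  have h2 := factorial_eq_stirlingSeq hM
  rw [Nat.factorial_succ] at h1
  rw [← Nat.mul_factorial_pred hM] at h2
  set σ := Stirling.stirlingSeq (n + 1)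
  set σ' := Stirling.stirlingSeq ((L + 1) * (n + 1))
  set F := (((L + 1) * (n + 1) - 1).factorial : ℝ)
  have hs : √((n + 1 : ℕ) : ℝ) ≠ 0 := by positivity
  have hss : ((n + 1 : ℕ) : ℝ) = √((n + 1 : ℕ) : ℝ) ^ 2 := (Real.sq_sqrt (by positivity)).symm
  have hq : √(L + 1 : ℝ) ≠ 0 := by positivity
  have hqq : (L + 1 : ℝ) = √(L + 1 : ℝ) ^ 2 := (Real.sq_sqrt (by positivity)).symm
  have hP : (((n + 1 : ℕ) : ℝ) / Real.exp 1) ^ ((L + 1) * (n + 1)) ≠ 0 := by positivity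
  have hQ : (L + 1 : ℝ) ^ ((L + 1) * (n + 1)) ≠ 0 := by positivity
  have e1 : (n.factorial : ℝ) ^ (L + 1) * √((n + 1 : ℕ) : ℝ) ^ (2 * (L + 1)) =
      (σ * √2 * √((n + 1 : ℕ) : ℝ)) ^ (L + 1) *
        (((n + 1 : ℕ) : ℝ) / Real.exp 1) ^ ((L + 1) * (n + 1)) := by
    rw [pow_mul √((n + 1 : ℕ) : ℝ), ← hss, ← mul_pow, mul_comm (L + 1) (n + 1), pow_mul _ (n + 1),
      ← mul_pow]
    rw [Nat.cast_mul, Nat.succ_eq_add_one] at h1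
    congr 1
    linear_combination h1
  have e2 : √(L + 1 : ℝ) * √((n + 1 : ℕ) : ℝ) * F = σ' * √2 *
      ((L + 1 : ℝ) ^ ((L + 1) * (n + 1)) *
        (((n + 1 : ℕ) : ℝ) / Real.exp 1) ^ ((L + 1) * (n + 1))) := by
    have e3 : √(((L + 1) * (n + 1) : ℕ) : ℝ) = √(L + 1 : ℝ) * √((n + 1 : ℕ) : ℝ) := by
      rw [← Real.sqrt_mul (by positivity)]; push_cast; rfl
    have e4 : (((L + 1) * (n + 1) : ℕ) : ℝ) = √(L + 1 : ℝ) ^ 2 * √((n + 1 : ℕ) : ℝ) ^ 2 := by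
      rw [← hss, ← hqq]; push_cast; rfl
    have e5 : (((L + 1) * (n + 1) : ℕ) : ℝ) / Real.exp 1 =
        (L + 1 : ℝ) * (((n + 1 : ℕ) : ℝ) / Real.exp 1) := by push_cast; ring
    rw [e5, mul_pow, e3, Nat.cast_mul _ (Nat.factorial _), e4] at h2
    have h0 : √(L + 1 : ℝ) * √((n + 1 : ℕ) : ℝ) ≠ 0 := mul_ne_zero hq hs
    apply mul_left_cancel₀ h0
    linear_combination h2
  have e1' := (eq_div_iff (pow_ne_zero (2 * (L + 1)) hs)).mpr e1
  have e2' : F = σ' * √2 * ((L + 1 : ℝ) ^ ((L + 1) * (n + 1)) *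
        (((n + 1 : ℕ) : ℝ) / Real.exp 1) ^ ((L + 1) * (n + 1))) /
        (√(L + 1 : ℝ) * √((n + 1 : ℕ) : ℝ)) := by
    rw [eq_div_iff (mul_ne_zero hq hs), ← e2]; ring
  rw [e1', e2']
  generalize (((n + 1 : ℕ) : ℝ) / Real.exp 1) ^ ((L + 1) * (n + 1)) = P at *
  generalize (L + 1 : ℝ) ^ ((L + 1) * (n + 1)) = Q at *
  generalize √((n + 1 : ℕ) : ℝ) = s at *
  obtain ⟨v, hv⟩ : ∃ v, √(n : ℝ) = v * s := ⟨√n / s, by field_simp⟩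
  rw [hv, mul_div_cancel_right₀ _ hs, mul_pow]
  field_simp
  ring

/-- The multiplication formula of Gauss. -/
lemma prod_Gamma_add_div {l : ℕ} (hl : 1 ≤ l) (x : ℂ) :
    ∏ r ∈ Finset.range l, Gamma ((x + r) / l) =
      exp (((l : ℂ) - 1) / 2 * Real.log (2 * Real.pi) + (1 / 2 - x) * Real.log l) * Gamma x := by
  obtain ⟨L, rfl⟩ := Nat.exists_eq_add_of_le' hl
  have hl0 : ((L + 1 : ℕ) : ℂ) ≠ 0 := Nat.cast_ne_zero.mpr (Nat.succ_ne_zero L)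
  have hA := tendsto_finsetProd (Finset.range (L + 1))
    (fun r _ => GammaSeq_tendsto_Gamma ((x + r) / ((L + 1 : ℕ) : ℂ)))
  -- With this index the denominator of `GammaSeq x` has exactly $(L+1)(n+1)$ factors, as many as
  -- $L+1$ denominators of `GammaSeq` at $n$ together.
  have hM : Tendsto (fun n : ℕ => (L + 1) * (n + 1) - 1) atTop atTop := by
    refine tendsto_atTop_mono (fun n => ?_) tendsto_id
    have : 1 * (n + 1) ≤ (L + 1) * (n + 1) := Nat.mul_le_mul_right _ (by omega)
    simp only [id]; omega
  have hN : Tendsto (fun n : ℕ => n + 1) atTop atTop := tendsto_add_atTop_nat 1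
  have hlN : Tendsto (fun n : ℕ => (L + 1) * (n + 1)) atTop atTop := by
    refine tendsto_atTop_mono (fun n => ?_) hM
    omega
  have hσ := Stirling.tendsto_stirlingSeq_sqrt_pi
  have hr : Tendsto (fun n : ℕ => (n : ℝ) / ((n + 1 : ℕ) : ℝ)) atTop (𝓝 1) := by
    have := tendsto_natCast_div_add_atTop (1 : ℝ)
    simpa using this
  have hr' : Tendsto (fun n : ℕ => √(n : ℝ) / √((n + 1 : ℕ) : ℝ)) atTop (𝓝 1) := by
    have := (Real.continuous_sqrt.tendsto _).comp hr
    rw [Real.sqrt_one] at this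
    refine this.congr fun n => ?_
    simp [Real.sqrt_div]
  have hpi : √Real.pi ≠ 0 := by positivity
  have hB := ((((hr'.pow L).mul_const (√2 ^ L)).mul_const (√(L + 1 : ℝ))).mul
    (((hσ.comp hN).pow (L + 1)).div (hσ.comp hlN) hpi))
  have hB' := (continuous_ofReal.tendsto _).comp hB
  have hq : Tendsto (fun n : ℕ => (((L + 1) * (n + 1) - 1 : ℕ) : ℝ) / n) atTop
      (𝓝 ((L + 1 : ℕ) : ℝ)) := by
    have h1 : Tendsto (fun n : ℕ => ((L + 1 : ℕ) : ℝ) + (L : ℝ) / n) atTop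
        (𝓝 (((L + 1 : ℕ) : ℝ) + 0)) :=
      (tendsto_const_div_atTop_nhds_zero_nat (L : ℝ)).const_add _
    rw [add_zero] at h1
    refine h1.congr' ?_
    filter_upwards [eventually_ne_atTop 0] with n hn
    have e : (L + 1) * (n + 1) - 1 = (L + 1) * n + L := by
      rw [Nat.mul_succ]; omega
    have hn' : (n : ℝ) ≠ 0 := Nat.cast_ne_zero.mpr hn
    rw [e]; push_cast; field_simp
  have hlog : Tendsto (fun n : ℕ => Real.log ((((L + 1) * (n + 1) - 1 : ℕ) : ℝ) / n)) atTop
      (𝓝 (Real.log ((L + 1 : ℕ) : ℝ))) :=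
    (Real.continuousAt_log (by positivity)).tendsto.comp hq
  have hE := (continuous_exp.tendsto _).comp
    (((continuous_ofReal.tendsto _).comp hlog).const_mul (-x))
  have hC := (((GammaSeq_tendsto_Gamma x).comp hM).mul hE).mul hB'
  have hAC := tendsto_nhds_unique hA (hC.congr' ?_)
  · rw [hAC]
    have hreal : (1 : ℝ) ^ L * √2 ^ L * √(L + 1 : ℝ) * (√Real.pi ^ (L + 1) / √Real.pi) =
        Real.exp ((L : ℝ) / 2 * Real.log (2 * Real.pi) + 1 / 2 * Real.log ((L + 1 : ℕ) : ℝ)) := by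
      have e1 : Real.exp ((L : ℝ) / 2 * Real.log (2 * Real.pi)) = (√2 * √Real.pi) ^ L := by
        rw [← Real.sqrt_mul (by norm_num), Real.sqrt_eq_rpow, Real.rpow_def_of_pos (by positivity),
          ← Real.exp_nat_mul]
        congr 1; ring
      have e2 : Real.exp (1 / 2 * Real.log ((L + 1 : ℕ) : ℝ)) = √(L + 1 : ℝ) := by
        rw [Real.sqrt_eq_rpow, Real.rpow_def_of_pos (by positivity)]
        congr 1; push_cast; ring
      rw [Real.exp_add, e1, e2, pow_succ √Real.pi, one_pow, mul_pow]
      field_simp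
    rw [hreal, ofReal_exp, mul_assoc, mul_comm (Gamma x), ← exp_add]
    congr 2
    push_cast
    ring
  · filter_upwards [eventually_ne_atTop 0] with n hn
    have hn' : (n : ℂ) ≠ 0 := Nat.cast_ne_zero.mpr hn
    have hM0 : (L + 1) * (n + 1) - 1 ≠ 0 := by
      have : 1 * (n + 1) ≤ (L + 1) * (n + 1) := Nat.mul_le_mul_right _ (by omega)
      omega
    have hM1 : (L + 1) * (n + 1) - 1 + 1 = (L + 1) * (n + 1) := by
      have : 1 * (n + 1) ≤ (L + 1) * (n + 1) := Nat.mul_le_mul_right _ (by omega)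
      omega
    simp only [Function.comp, Pi.div_apply]
    rw [← stirlingSeq_multiplication]
    simp only [GammaSeq, hM1]
    rw [Finset.prod_div_distrib, Finset.prod_mul_distrib, Finset.prod_const, Finset.card_range]
    have e1 : ∏ r ∈ Finset.range (L + 1), (n : ℂ) ^ ((x + r) / ((L + 1 : ℕ) : ℂ)) =
        exp (x * Real.log n) * ((√n : ℝ) : ℂ) ^ L := by
      have hs : ((√n : ℝ) : ℂ) = exp (1 / 2 * Real.log n) := by
        rw [Real.sqrt_eq_rpow, Real.rpow_def_of_pos (by positivity), ofReal_exp]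
        congr 1; push_cast; ring
      have hsum : ∑ r ∈ Finset.range (L + 1), ((x + r) / ((L + 1 : ℕ) : ℂ)) = x + L / 2 := by
        have h := Finset.sum_range_id_mul_two (L + 1)
        have h' : (∑ r ∈ Finset.range (L + 1), (r : ℂ)) * 2 = (L + 1) * L := by
          rw [Nat.add_sub_cancel] at h
          simpa using congrArg (Nat.cast : ℕ → ℂ) h
        rw [← Finset.sum_div, Finset.sum_add_distrib, Finset.sum_const, Finset.card_range,
          nsmul_eq_mul, div_eq_iff hl0]
        push_cast
        linear_combination h' / 2
      rw [hs, ← exp_nat_mul, ← exp_add]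
      simp only [cpow_def_of_ne_zero hn']
      rw [← exp_sum, ← Finset.mul_sum, hsum, natCast_log]
      congr 1; ring
    have e2 : ∏ r ∈ Finset.range (L + 1), ∏ j ∈ Finset.range (n + 1),
        ((x + r) / ((L + 1 : ℕ) : ℂ) + j) = (∏ i ∈ Finset.range ((L + 1) * (n + 1)), (x + i)) /
        ((L + 1 : ℕ) : ℂ) ^ ((L + 1) * (n + 1)) := by
      have hsplit : ∀ (f : ℕ → ℂ) (n : ℕ), ∏ k ∈ Finset.range ((L + 1) * n), f k =
          ∏ r ∈ Finset.range (L + 1), ∏ j ∈ Finset.range n, f ((L + 1) * j + r) := by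
        intro f n
        rw [Finset.prod_comm]
        induction n with
        | zero => simp
        | succ n ih => rw [Finset.prod_range_succ, ← ih, Nat.mul_succ, Finset.prod_range_add]
      have hpow : ((L + 1 : ℕ) : ℂ) ^ ((L + 1) * (n + 1)) = ∏ r ∈ Finset.range (L + 1),
          ∏ j ∈ Finset.range (n + 1), ((L + 1 : ℕ) : ℂ) := by
        rw [Finset.prod_const, Finset.prod_const, Finset.card_range, Finset.card_range, ← pow_mul,
          mul_comm]
      rw [hsplit, hpow, ← Finset.prod_div_distrib]
      refine Finset.prod_congr rfl fun r _ => ?_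
      rw [← Finset.prod_div_distrib]
      refine Finset.prod_congr rfl fun j _ => ?_
      push_cast at hl0 ⊢
      field_simp
      ring
    rw [e1, e2]
    have e3 : exp (-x * Real.log ((((L + 1) * (n + 1) - 1 : ℕ) : ℝ) / n)) =
        exp (x * Real.log n) / (((L + 1) * (n + 1) - 1 : ℕ) : ℂ) ^ x := by
      rw [cpow_def_of_ne_zero (Nat.cast_ne_zero.mpr hM0), ← exp_sub, ← natCast_log,
        Real.log_div (Nat.cast_ne_zero.mpr hM0) (Nat.cast_ne_zero.mpr hn)]
      congr 1; push_cast; ring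
    have h4 : (((L + 1) * (n + 1) - 1 : ℕ) : ℂ) ^ x ≠ 0 := by
      rw [cpow_def_of_ne_zero (Nat.cast_ne_zero.mpr hM0)]; exact exp_ne_zero _
    have h5 : ((((L + 1) * (n + 1) - 1).factorial : ℕ) : ℂ) ≠ 0 :=
      Nat.cast_ne_zero.mpr (Nat.factorial_ne_zero _)
    rw [e3]
    push_cast at hl0 ⊢
    field_simp

/-- The functional equation of `I_l`. -/
lemma Ifun_add {l : ℕ} (hl : 1 ≤ l) {s : ℂ} (hs : ∀ k : ℕ, s + l ≠ -k) :
    Ifun l s = Ifun l (s + l) * Gamma (s + l) := by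
  have hl0 : (l : ℂ) ≠ 0 := by exact_mod_cast (by omega : l ≠ 0)
  have h1 : ∀ r ∈ Finset.range l, Gamma2 ((s + l + r) / l) =
      Gamma2 ((s + l + l + r) / l) * Gamma ((s + l + r) / l) := by
    intro r _
    have e : (s + l + l + r) / l = (s + l + r) / l + 1 := by field_simp; ring
    rw [e]
    refine Gamma2_add_one fun k hk => hs (l * k + r) ?_
    rw [div_eq_iff hl0] at hk
    push_cast
    linear_combination hk
  rw [Ifun, Ifun, Finset.prod_congr rfl h1, Finset.prod_mul_distrib, prod_Gamma_add_div hl]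
  have hk : (Real.log (k1 l) : ℂ) = -(((l : ℂ) - 1) / 2 * Real.log (2 * Real.pi)) -
      1 / 2 * Real.log l := by
    rw [k1, Real.log_mul (by positivity) (by positivity), Real.log_rpow (by positivity),
      Real.log_rpow (by positivity)]
    push_cast; ring
  -- The definition of $k_1(l)$ and the quadratic exponent are what make the prefactor of $I_l$
  -- absorb Gauss's factor exactly.
  have e : exp (-(s / l) * Real.log (k1 l) - s * (s + l) / (2 * l) * Real.log l) =
      exp (-((s + l) / l) * Real.log (k1 l) - (s + l) * (s + l + l) / (2 * l) * Real.log l) *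
      (exp (((l : ℂ) - 1) / 2 * Real.log (2 * Real.pi) + (1 / 2 - (s + l)) * Real.log l))⁻¹ := by
    rw [hk, ← exp_neg, ← exp_add]
    congr 1
    field_simp
    ring
  rw [e]
  generalize hE : exp (((l : ℂ) - 1) / 2 * Real.log (2 * Real.pi) + (1 / 2 - (s + l)) * Real.log l) = E
  have hE0 : E ≠ 0 := hE ▸ exp_ne_zero _
  field_simp

end HigherSelberg

namespace HigherSelberg

open Filter Topology Complex MeasureTheory Set

/-! ### Laplace transforms -/

lemma mul_exp_neg_le {ρ : ℝ} (hρ : 0 < ρ) (u : ℝ) :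
    u * Real.exp (-ρ * u) ≤ 2 / ρ * Real.exp (-(ρ / 2) * u) := by
  have h1 : ρ / 2 * u ≤ Real.exp (ρ / 2 * u) := by
    have := Real.add_one_le_exp (ρ / 2 * u); linarith
  have h2 : Real.exp (-ρ * u) * Real.exp (ρ / 2 * u) = Real.exp (-(ρ / 2) * u) := by
    rw [← Real.exp_add]; congr 1; ring
  have h4 : u ≤ 2 / ρ * Real.exp (ρ / 2 * u) := by
    rw [div_mul_eq_mul_div, le_div_iff₀ hρ]; linarith
  calc u * Real.exp (-ρ * u) ≤ 2 / ρ * Real.exp (ρ / 2 * u) * Real.exp (-ρ * u) := by gcongr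
    _ = _ := by rw [← h2]; ring

lemma integrableOn_exp_neg_mul {a : ℂ} (ha : 0 < a.re) :
    IntegrableOn (fun u : ℝ => exp (-a * u)) (Ioi 0) :=
  integrableOn_exp_mul_complex_Ioi (by simpa using ha) 0

lemma integral_exp_neg_mul {a : ℂ} (ha : 0 < a.re) :
    ∫ u : ℝ in Ioi 0, exp (-a * u) = 1 / a := by
  rw [integral_exp_mul_complex_Ioi (by simpa using ha) 0]
  simp

lemma norm_exp_neg_mul (a : ℂ) (u : ℝ) : ‖exp (-a * u)‖ = Real.exp (-a.re * u) := by
  rw [norm_exp]; simp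

lemma integrableOn_mul_exp_neg_mul {a : ℂ} (ha : 0 < a.re) :
    IntegrableOn (fun u : ℝ => u * exp (-a * u)) (Ioi 0) := by
  have h := (exp_neg_integrableOn_Ioi 0 (half_pos ha)).const_mul (2 / a.re)
  refine h.mono' (by fun_prop) ?_
  filter_upwards [ae_restrict_mem measurableSet_Ioi] with u hu
  rw [norm_mul, norm_exp_neg_mul, norm_real, Real.norm_of_nonneg (le_of_lt hu)]
  exact mul_exp_neg_le ha u

lemma integral_mul_exp_neg_mul {a : ℂ} (ha : 0 < a.re) :
    ∫ u : ℝ in Ioi 0, u * exp (-a * u) = 1 / a ^ 2 := by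
  have ha0 : a ≠ 0 := fun h => by simp [h] at ha
  have hd : ∀ u : ℝ, HasDerivAt (fun u : ℝ => -(u / a + 1 / a ^ 2) * exp (-a * u))
      (u * exp (-a * u)) u := by
    intro u
    have h1 : HasDerivAt (fun u : ℝ => (u : ℂ)) 1 u := ofRealCLM.hasDerivAt
    refine ((((h1.div_const a).add_const (1 / a ^ 2)).neg).mul
      ((h1.const_mul (-a)).cexp)).congr_deriv ?_
    simp only [Pi.neg_apply]
    field_simp
    ring
  have hlim : Tendsto (fun u : ℝ => -(u / a + 1 / a ^ 2) * exp (-a * u)) atTop (𝓝 0) := by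
    have hb : Tendsto (fun u : ℝ => ‖a‖⁻¹ * (2 / a.re * Real.exp (-(a.re / 2) * u)) +
        (‖a‖ ^ 2)⁻¹ * Real.exp (-a.re * u)) atTop (𝓝 0) := by
      have e : ∀ c : ℝ, 0 < c → Tendsto (fun u : ℝ => Real.exp (-c * u)) atTop (𝓝 0) := fun c hc =>
        Real.tendsto_exp_atBot.comp (tendsto_id.const_mul_atTop_of_neg (neg_neg_of_pos hc))
      simpa using (((e _ (half_pos ha)).const_mul (2 / a.re)).const_mul ‖a‖⁻¹).add
        ((e _ ha).const_mul (‖a‖ ^ 2)⁻¹)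
    refine squeeze_zero_norm' ?_ hb
    filter_upwards [eventually_ge_atTop 0] with u hu
    rw [norm_mul, norm_neg, norm_exp_neg_mul]
    have h1 : ‖(u : ℂ) / a + 1 / a ^ 2‖ ≤ ‖a‖⁻¹ * u + (‖a‖ ^ 2)⁻¹ := by
      refine (norm_add_le _ _).trans (le_of_eq ?_)
      rw [norm_div, norm_real, Real.norm_of_nonneg hu, norm_div, norm_one, norm_pow]
      ring
    calc _ ≤ (‖a‖⁻¹ * u + (‖a‖ ^ 2)⁻¹) * Real.exp (-a.re * u) := by gcongr
      _ = ‖a‖⁻¹ * (u * Real.exp (-a.re * u)) + (‖a‖ ^ 2)⁻¹ * Real.exp (-a.re * u) := by ring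
      _ ≤ _ := add_le_add
        (mul_le_mul_of_nonneg_left (mul_exp_neg_le ha u) (by positivity)) le_rfl
  rw [integral_Ioi_of_hasDerivAt_of_tendsto' (fun u _ => hd u) (integrableOn_mul_exp_neg_mul ha)
    hlim]
  simp

/-! ### The series `φ_s` -/

lemma phiTerm_eq_zero_right (l : ℕ) (s : ℂ) (r : ℝ) (m : ℕ) :
    phiTerm l s r m = phiTerm l (s + I * r) 0 m := by
  simp only [phiTerm, ofReal_zero, mul_zero, add_zero]
  ring_nf

/-- The variable $r$ is only an imaginary shift of $s$, so $\phi$ need only be studied at $r=0$ for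
complex parameter. -/
lemma phi_eq_zero_right (l : ℕ) (s : ℂ) (r : ℝ) : phi l s r = phi l (s + I * r) 0 :=
  tsum_congr fun m => phiTerm_eq_zero_right l s r m

/-- With $z$ the middle point, the simple fractions combine to $1/(z^2-l^2/4)$, which cancels
$1/z^2$ to leading order and leaves decay of order four. -/
lemma phiTerm_eq {l : ℕ} (hl : 1 ≤ l) {w : ℂ} (hw : (1 - (l : ℝ)) / 2 < w.re) (m : ℕ) :
    phiTerm l w 0 m = -((l : ℂ) ^ 2 / 4) / ((w + l * m + l - 1 / 2) ^ 2 *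
      (w + l * m + l / 2 - 1 / 2) * (w + l * m + 3 * l / 2 - 1 / 2)) := by
  have hlp : (0 : ℝ) < l := by exact_mod_cast hl
  have hm : 0 ≤ (l : ℝ) * m := by positivity
  have hpos : ∀ c : ℝ, (l : ℝ) / 2 ≤ c → w + l * m + c - 1 / 2 ≠ 0 := by
    intro c hc h
    have := congrArg re h
    simp at this
    norm_num at this
    linarith
  have h1 := hpos l (by linarith)
  have h2 := hpos (l / 2) le_rfl
  have h3 := hpos (3 * l / 2) (by linarith)
  push_cast at h1 h2 h3
  have hl0 : (l : ℂ) ≠ 0 := by exact_mod_cast hlp.ne'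
  simp only [phiTerm, ofReal_zero, mul_zero, add_zero]
  have e2 : w + l * m + l / 2 - 1 / 2 = (w + l * m + l - 1 / 2) - l / 2 := by ring
  have e3 : w + l * m + 3 * l / 2 - 1 / 2 = (w + l * m + l - 1 / 2) + l / 2 := by ring
  rw [e2] at h2 ⊢
  rw [e3] at h3 ⊢
  generalize w + l * m + l - 1 / 2 = z at *
  generalize ha : z - (l : ℂ) / 2 = a at *
  generalize hb : z + (l : ℂ) / 2 = b at *
  field_simp
  rw [← ha, ← hb]
  ring

/-- Of the four powers of decay, two are spent on $r$, making $h$ integrable, and two on $m$, making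
the series summable. -/
lemma norm_phiTerm_le {l : ℕ} (hl : 1 ≤ l) {s : ℂ} (hs : (1 - (l : ℝ)) / 2 < s.re) :
    ∃ C : ℝ, 0 ≤ C ∧ ∀ (r : ℝ) (m : ℕ),
      ‖phiTerm l s r m‖ ≤ C / (1 + |r|) ^ 2 / ((m : ℝ) + 1) ^ 2 := by
  have hlp : (1 : ℝ) ≤ l := by exact_mod_cast hl
  set α := s.re + l / 2 - 1 / 2 with hα
  have hα0 : 0 < α := by rw [hα]; linarith
  set δ := min α 1
  have hδ : 0 < δ := lt_min hα0 one_pos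
  have hδα : δ ≤ α := min_le_left _ _
  have hδ1 : δ ≤ 1 := min_le_right _ _
  set B := (1 + |s.im|) / δ + 1
  have hB : 0 < B := by positivity
  refine ⟨(l : ℝ) ^ 2 / 4 * B ^ 2 / δ ^ 2, by positivity, fun r m => ?_⟩
  rw [phiTerm_eq_zero_right, phiTerm_eq hl (by simpa using hs)]
  set y : ℂ := s + I * r + l * m + l / 2 - 1 / 2 with hy
  have hyre : y.re = α + l * m := by simp [hy, hα]; ring
  have hyim : y.im = s.im + r := by simp [hy]
  have hy0 : 0 ≤ y.re := by rw [hyre]; positivity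
  have e2 : s + I * r + l * m + l - 1 / 2 = y + ((l / 2 : ℝ) : ℂ) := by
    rw [hy]; push_cast; ring
  have e3 : s + I * r + l * m + 3 * l / 2 - 1 / 2 = y + ((l : ℝ) : ℂ) := by
    rw [hy]; push_cast; ring
  rw [e2, e3]
  have n2 := norm_le_norm_add_ofReal hy0 (show (0 : ℝ) ≤ l / 2 by positivity)
  have n3 := norm_le_norm_add_ofReal hy0 (show (0 : ℝ) ≤ l by positivity)
  have h1 : δ * (m + 1) ≤ ‖y‖ := by
    refine le_trans ?_ (re_le_norm y)
    rw [hyre]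
    have : (0 : ℝ) ≤ m := m.cast_nonneg
    nlinarith
  have h2 : 1 + |r| ≤ B * ‖y‖ := by
    have a : |r| ≤ |s.im| + ‖y‖ := by
      have := abs_im_le_norm y
      rw [hyim] at this
      have h' : |r| ≤ |s.im + r| + |s.im| := by
        have := abs_sub (s.im + r) s.im
        simpa using this
      linarith
    have b : δ ≤ ‖y‖ := by
      refine le_trans ?_ h1
      have : (0 : ℝ) ≤ m := m.cast_nonneg
      nlinarith
    have c : 1 + |s.im| ≤ (1 + |s.im|) / δ * ‖y‖ := by
      rw [div_mul_eq_mul_div, le_div_iff₀ hδ]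
      exact mul_le_mul_of_nonneg_left b (by positivity)
    have : B * ‖y‖ = (1 + |s.im|) / δ * ‖y‖ + ‖y‖ := by simp only [B]; ring
    linarith
  have hnum : ‖-((l : ℂ) ^ 2 / 4)‖ = (l : ℝ) ^ 2 / 4 := by
    rw [norm_neg, norm_div, norm_pow, norm_natCast]; norm_num
  rw [norm_div, hnum, norm_mul, norm_mul, norm_pow]
  have hden : ((1 + |r|) / B) ^ 2 * (δ * (m + 1)) ^ 2 ≤
      ‖y + ((l / 2 : ℝ) : ℂ)‖ ^ 2 * ‖y‖ * ‖y + ((l : ℝ) : ℂ)‖ := by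
    have h2' : (1 + |r|) / B ≤ ‖y‖ := by rw [div_le_iff₀ hB]; linarith
    calc _ ≤ ‖y‖ ^ 2 * ‖y‖ ^ 2 := by gcongr
      _ = ‖y‖ ^ 2 * ‖y‖ * ‖y‖ := by ring
      _ ≤ _ := by gcongr
  refine (div_le_div_of_nonneg_left (by positivity) (by positivity) hden).trans (le_of_eq ?_)
  field_simp

lemma summable_phiTerm {l : ℕ} (hl : 1 ≤ l) {s : ℂ} (hs : (1 - (l : ℝ)) / 2 < s.re) (r : ℝ) :
    Summable (phiTerm l s r) := by
  obtain ⟨C, -, hC⟩ := norm_phiTerm_le hl hs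
  exact Summable.of_norm_bounded (summable_const_div_succ_sq _) (hC r)

lemma norm_testH_le {l : ℕ} (hl : 1 ≤ l) {s : ℂ} (hs : (1 - (l : ℝ)) / 2 < s.re) :
    ∃ C : ℝ, 0 ≤ C ∧ ∀ r : ℝ, ‖testH l s r‖ ≤ C * (1 + |r|) ^ (-2 : ℝ) := by
  obtain ⟨C, hC0, hC⟩ := norm_phiTerm_le hl hs
  have hphi : ∀ r : ℝ, ‖phi l s r‖ ≤ C / (1 + |r|) ^ 2 * ∑' m : ℕ, 1 / ((m : ℝ) + 1) ^ 2 := by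
    intro r
    have h := (summable_const_div_succ_sq 1).hasSum.mul_left (C / (1 + |r|) ^ 2)
    refine tsum_of_norm_bounded h fun m => ?_
    rw [mul_one_div]
    exact hC r m
  set S := ∑' m : ℕ, 1 / ((m : ℝ) + 1) ^ 2
  refine ⟨2 * C * S, by positivity, fun r => ?_⟩
  have h2 := hphi (-r)
  rw [abs_neg] at h2
  refine (norm_add_le _ _).trans ((add_le_add (hphi r) h2).trans (le_of_eq ?_))
  rw [Real.rpow_neg (by positivity)]
  norm_cast
  field_simp
  norm_cast

/-- The integrand of the Laplace transform that yields `phiTerm`. -/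
noncomputable def laplaceTerm (l : ℕ) (w : ℂ) (m : ℕ) (u : ℝ) : ℂ :=
  exp (-(w + l * m + l - 1 / 2) * u) * ((u - 2 / l * Real.sinh (l * u / 2) : ℝ) : ℂ)

lemma laplaceTerm_eq {l : ℕ} (w : ℂ) (m : ℕ) (u : ℝ) :
    laplaceTerm l w m u = u * exp (-(w + l * m + l - 1 / 2) * u) -
      (1 / l * exp (-(w + l * m + l / 2 - 1 / 2) * u) -
      1 / l * exp (-(w + l * m + 3 * l / 2 - 1 / 2) * u)) := by
  have e1 : exp (-(w + l * m + l / 2 - 1 / 2) * u) =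
      exp (-(w + l * m + l - 1 / 2) * u) * exp (l * u / 2) := by
    rw [← exp_add]; congr 1; ring
  have e2 : exp (-(w + l * m + 3 * l / 2 - 1 / 2) * u) =
      exp (-(w + l * m + l - 1 / 2) * u) * exp (-(l * u / 2)) := by
    rw [← exp_add]; congr 1; ring
  rw [laplaceTerm, e1, e2]
  push_cast
  rw [Complex.sinh]
  ring

lemma integrableOn_laplaceTerm {l : ℕ} (hl : 1 ≤ l) {w : ℂ}
    (hw : (1 - (l : ℝ)) / 2 < w.re) (m : ℕ) :
    IntegrableOn (laplaceTerm l w m) (Ioi 0) ∧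
      ∫ u in Ioi 0, laplaceTerm l w m u = phiTerm l w 0 m := by
  have hm : 0 ≤ (l : ℝ) * m := by positivity
  have hpos : ∀ c : ℝ, (l : ℝ) / 2 ≤ c → 0 < (w + l * m + c - 1 / 2).re := by
    intro c hc
    simp
    norm_num
    linarith
  have h1 := hpos l (by linarith)
  have h2 := hpos (l / 2) le_rfl
  have h3 := hpos (3 * l / 2) (by linarith)
  push_cast at h1 h2 h3
  have i1 := integrableOn_mul_exp_neg_mul h1
  have i2 := (integrableOn_exp_neg_mul h2).const_mul (1 / (l : ℂ))
  have i3 := (integrableOn_exp_neg_mul h3).const_mul (1 / (l : ℂ))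
  have e : laplaceTerm l w m = fun u : ℝ => u * exp (-(w + l * m + l - 1 / 2) * u) -
      (1 / l * exp (-(w + l * m + l / 2 - 1 / 2) * u) -
      1 / l * exp (-(w + l * m + 3 * l / 2 - 1 / 2) * u)) := funext (laplaceTerm_eq w m)
  rw [e]
  refine ⟨i1.sub (i2.sub i3), ?_⟩
  have k1 := integral_sub i1 (i2.sub i3)
  have k2 := integral_sub i2 i3
  simp only [Pi.sub_apply] at k1 k2
  rw [k1, k2, integral_mul_exp_neg_mul h1, integral_const_mul, integral_const_mul,
    integral_exp_neg_mul h2, integral_exp_neg_mul h3]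
  simp only [phiTerm, ofReal_zero, mul_zero, add_zero]
  ring

/-- Because $\sinh x\ge x$ for $x\ge0$, the real factor has constant sign. The integrals of the
norms are therefore minus the terms of $\phi$ at $\mathrm{Re}\,w$, so the interchange of sum and
integral needs no further estimate. -/
lemma norm_laplaceTerm {l : ℕ} (hl : 1 ≤ l) (w : ℂ) (m : ℕ) {u : ℝ} (hu : 0 ≤ u) :
    ((‖laplaceTerm l w m u‖ : ℝ) : ℂ) = -laplaceTerm l (w.re : ℂ) m u := by
  have h1 : u - 2 / l * Real.sinh (l * u / 2) ≤ 0 := by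
    have := Real.self_le_sinh_iff.mpr (show 0 ≤ l * u / 2 by positivity)
    have h2 : 2 / l * (l * u / 2) ≤ 2 / l * Real.sinh (l * u / 2) := by gcongr
    have h3 : 2 / l * (l * u / 2) = u := by field_simp
    linarith
  rw [laplaceTerm, norm_mul, norm_exp_neg_mul, norm_real, Real.norm_of_nonpos h1, laplaceTerm]
  push_cast
  rw [← mul_neg]
  congr 2
  simp

/-- The function `φ` is the Laplace transform of the test function `g`. -/
lemma phi_eq_integral {l : ℕ} (hl : 1 ≤ l) {w : ℂ} (hw : (1 - (l : ℝ)) / 2 < w.re) :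
    phi l w 0 = ∫ u in Ioi 0, testG l w u := by
  have hlp : (0 : ℝ) < l := by exact_mod_cast hl
  have hsum : Summable fun m => ∫ u in Ioi 0, ‖laplaceTerm l w m u‖ := by
    rw [← summable_ofReal]
    have hw' : (1 - (l : ℝ)) / 2 < ((w.re : ℝ) : ℂ).re := by simpa using hw
    refine (summable_phiTerm hl hw' 0).neg.congr fun m => ?_
    rw [← (integrableOn_laplaceTerm hl hw' m).2, ← integral_complex_ofReal, ← integral_neg]
    refine setIntegral_congr_fun measurableSet_Ioi fun u hu => ?_
    exact (norm_laplaceTerm hl w m (le_of_lt hu)).symm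
  have h := hasSum_integral_of_summable_integral_norm
    (fun m => (integrableOn_laplaceTerm hl hw m).1) hsum
  simp only [fun m => (integrableOn_laplaceTerm hl hw m).2] at h
  rw [phi, h.tsum_eq]
  refine setIntegral_congr_fun measurableSet_Ioi fun u hu => ?_
  have hu' : (0 : ℝ) < u := hu
  have hq : ‖exp (-(l * u : ℂ))‖ < 1 := by
    rw [norm_exp, show (-(l * u : ℂ)).re = -(l * u) by simp, Real.exp_lt_one_iff]
    have := mul_pos hlp hu'
    linarith
  -- Summing over $m$ gives $1/(1-e^{-lu})=e^{lu/2}/(2\sinh(lu/2))$, the denominator of $g$.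
  have hgeo := (hasSum_geometric_of_norm_lt_one hq).mul_left
    (exp (-(w + l - 1 / 2) * u) * ((u - 2 / l * Real.sinh (l * u / 2) : ℝ) : ℂ))
  have hterm : ∀ m : ℕ, laplaceTerm l w m u =
      exp (-(w + l - 1 / 2) * u) * ((u - 2 / l * Real.sinh (l * u / 2) : ℝ) : ℂ) *
      exp (-(l * u : ℂ)) ^ m := by
    intro m
    rw [laplaceTerm, ← exp_nat_mul, mul_right_comm, ← exp_add]
    congr 2
    ring
  simp only [hterm]
  rw [hgeo.tsum_eq, testG, if_neg hu'.ne', abs_of_pos hu']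
  have hE : exp ((l : ℂ) * u / 2) ≠ 0 := exp_ne_zero _
  have e1 : 1 - exp (-(l * u : ℂ)) = (exp ((l : ℂ) * u / 2))⁻¹ * (2 * Real.sinh (l * u / 2)) := by
    push_cast
    rw [Complex.sinh, mul_div_cancel₀ _ two_ne_zero, mul_sub, inv_mul_cancel₀ hE, ← exp_neg,
      ← exp_add]
    congr 2; ring
  have e2 : exp (-(w + l - 1 / 2) * u) = exp (-(w + l / 2 - 1 / 2) * u) *
      (exp ((l : ℂ) * u / 2))⁻¹ := by
    rw [← exp_neg, ← exp_add]; congr 1; ring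
  have hs : (Real.sinh (l * u / 2) : ℂ) ≠ 0 := by
    rw [ofReal_ne_zero]
    exact (Real.sinh_pos_iff.mpr (by positivity)).ne'
  rw [e1, e2]
  rw [show ((u - 2 / l * Real.sinh (l * u / 2) : ℝ) : ℂ) =
    u - 2 / l * (Real.sinh (l * u / 2) : ℂ) by push_cast; rfl]
  field_simp

end HigherSelberg

namespace HigherSelberg

open Filter Topology Complex MeasureTheory Set FourierTransform

/-! ### The test function and Fourier inversion -/

/-- `dslope Real.sinh 0` is $\sinh x/x$ with the value 1 at the origin. Written through it, $g$
needs no case split and is visibly continuous and bounded by an exponential. -/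
lemma continuous_dslope_sinh : Continuous (dslope Real.sinh 0) := by
  rw [continuous_iff_continuousAt]
  intro x
  rcases eq_or_ne x 0 with rfl | hx
  · exact continuousAt_dslope_same.mpr Real.differentiable_sinh.differentiableAt
  · exact (continuousAt_dslope_of_ne hx).mpr Real.continuous_sinh.continuousAt

lemma one_le_dslope_sinh (x : ℝ) : 1 ≤ dslope Real.sinh 0 x := by
  rcases lt_trichotomy x 0 with hx | rfl | hx
  · rw [dslope_of_ne _ hx.ne, slope_def_field, Real.sinh_zero, sub_zero, sub_zero,
      le_div_iff_of_neg hx, one_mul]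
    exact Real.sinh_le_self_iff.mpr hx.le
  · simp [dslope_same]
  · rw [dslope_of_ne _ hx.ne', slope_def_field, Real.sinh_zero, sub_zero, sub_zero,
      le_div_iff₀ hx, one_mul]
    exact Real.self_le_sinh_iff.mpr hx.le

lemma testG_eq {l : ℕ} (hl : 1 ≤ l) (s : ℂ) (u : ℝ) :
    testG l s u = exp (-(s + l / 2 - 1 / 2) * |u|) *
      ((1 / l * ((dslope Real.sinh 0 (l * u / 2))⁻¹ - 1) : ℝ) : ℂ) := by
  have hlp : (0 : ℝ) < l := by exact_mod_cast hl
  rcases eq_or_ne u 0 with rfl | hu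
  · simp [testG]
  · have hx : (l : ℝ) * u / 2 ≠ 0 := by positivity
    rw [testG, if_neg hu, dslope_of_ne _ hx, slope_def_field, Real.sinh_zero, sub_zero, sub_zero]
    push_cast
    have hl0 : (l : ℂ) ≠ 0 := by exact_mod_cast hlp.ne'
    field_simp

lemma continuous_testG {l : ℕ} (hl : 1 ≤ l) (s : ℂ) : Continuous (testG l s) := by
  rw [funext (testG_eq hl s)]
  have h1 := continuous_dslope_sinh
  have h2 : Continuous fun u : ℝ => (dslope Real.sinh 0 (l * u / 2))⁻¹ :=
    (h1.comp (by fun_prop)).inv₀ fun u => (one_pos.trans_le (one_le_dslope_sinh _)).ne'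
  fun_prop

lemma testG_neg (l : ℕ) (s : ℂ) (u : ℝ) : testG l s (-u) = testG l s u := by
  rcases eq_or_ne u 0 with rfl | hu
  · simp
  · rw [testG, testG, if_neg hu, if_neg (neg_ne_zero.mpr hu), abs_neg, mul_neg, neg_div,
      Real.sinh_neg]
    push_cast
    rw [mul_neg, neg_mul, neg_div_neg_eq]

lemma norm_testG_le {l : ℕ} (hl : 1 ≤ l) (s : ℂ) (u : ℝ) :
    ‖testG l s u‖ ≤ Real.exp (-(s.re + l / 2 - 1 / 2) * |u|) := by
  have hlp : (1 : ℝ) ≤ l := by exact_mod_cast hl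
  have h1 := one_le_dslope_sinh (l * u / 2)
  rw [testG_eq hl, norm_mul, norm_exp_neg_mul, norm_real]
  have e : (s + l / 2 - 1 / 2).re = s.re + l / 2 - 1 / 2 := by simp
  rw [e]
  refine mul_le_of_le_one_right (Real.exp_pos _).le ?_
  have h2 : (dslope Real.sinh 0 (l * u / 2))⁻¹ ≤ 1 := inv_le_one_of_one_le₀ h1
  have h3 : 0 ≤ (dslope Real.sinh 0 (l * u / 2))⁻¹ := by positivity
  rw [norm_mul, norm_div, norm_one, Real.norm_natCast, Real.norm_eq_abs, abs_of_nonpos (by linarith)]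
  have h4 : 1 / (l : ℝ) ≤ 1 := by rw [div_le_one (by linarith)]; exact hlp
  calc 1 / (l : ℝ) * -((dslope Real.sinh 0 (l * u / 2))⁻¹ - 1) ≤ 1 * 1 := by
        gcongr
        · linarith
        · linarith
    _ = 1 := one_mul 1

lemma integrable_testG {l : ℕ} (hl : 1 ≤ l) {s : ℂ} (hs : (1 - (l : ℝ)) / 2 < s.re) :
    Integrable (testG l s) := by
  have hα : 0 < s.re + l / 2 - 1 / 2 := by linarith
  have h1 : IntegrableOn (testG l s) (Ioi 0) := by
    refine (exp_neg_integrableOn_Ioi 0 hα).mono' (continuous_testG hl s).aestronglyMeasurable ?_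
    filter_upwards [ae_restrict_mem measurableSet_Ioi] with u hu
    have := norm_testG_le hl s u
    rwa [abs_of_pos hu] at this
  have h2 : IntegrableOn (testG l s) (Iic 0) := by
    rw [integrableOn_Iic_iff_integrableOn_Iio]
    have := h1.comp_neg
    simp only [testG_neg] at this
    simpa using this
  rw [← integrableOn_univ, ← Iic_union_Ioi (a := (0 : ℝ))]
  exact h2.union h1

lemma exp_mul_testG (l : ℕ) (s w : ℂ) {u : ℝ} (hu : 0 < u) :
    exp (-w * u) * testG l s u = testG l (s + w) u := by
  rw [testG, testG, if_neg hu.ne', if_neg hu.ne', abs_of_pos hu]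
  have e : exp (-(s + w + l / 2 - 1 / 2) * u) =
      exp (-w * u) * exp (-(s + l / 2 - 1 / 2) * u) := by
    rw [← exp_add]; congr 1; ring
  rw [e]
  ring

/-- The positive half-line gives $\phi_s(2\pi\xi)$ by the Laplace formula at a shifted parameter; by
evenness the negative one gives $\phi_s(-2\pi\xi)$. -/
lemma fourier_testG {l : ℕ} (hl : 1 ≤ l) {s : ℂ} (hs : (1 - (l : ℝ)) / 2 < s.re) (ξ : ℝ) :
    𝓕 (testG l s) ξ = testH l s (2 * Real.pi * ξ) := by
  have hint : Integrable fun u : ℝ => exp (((-2 * Real.pi * u * ξ : ℝ) : ℂ) * I) • testG l s u := by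
    refine (integrable_testG hl hs).mono ?_ ?_
    · exact ((by fun_prop : Continuous fun u : ℝ => exp (((-2 * Real.pi * u * ξ : ℝ) : ℂ) * I)).smul
        (continuous_testG hl s)).aestronglyMeasurable
    · filter_upwards with u
      rw [norm_smul, norm_exp_ofReal_mul_I, one_mul]
  have hhalf : ∀ η : ℝ, ∫ u in Ioi (0 : ℝ), exp (((-2 * Real.pi * u * η : ℝ) : ℂ) * I) • testG l s u =
      phi l s (2 * Real.pi * η) := by
    intro η
    rw [phi_eq_zero_right, phi_eq_integral hl (by simpa using hs)]
    refine setIntegral_congr_fun measurableSet_Ioi fun u hu => ?_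
    rw [smul_eq_mul, ← exp_mul_testG l s _ hu]
    congr 2
    push_cast; ring
  rw [Real.fourier_real_eq_integral_exp_smul,
    ← intervalIntegral.integral_Iic_add_Ioi hint.integrableOn hint.integrableOn (b := 0), hhalf,
    add_comm, testH]
  congr 1
  have := hhalf (-ξ)
  rw [mul_neg] at this
  have key := integral_comp_neg_Iic (0 : ℝ)
    (fun u : ℝ => exp (((-2 * Real.pi * u * -ξ : ℝ) : ℂ) * I) • testG l s u)
  rw [neg_zero] at key
  rw [← this, ← key]
  refine setIntegral_congr_fun measurableSet_Iic fun u _ => ?_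
  simp only [testG_neg]
  congr 3
  simp

lemma continuous_testH {l : ℕ} (hl : 1 ≤ l) {s : ℂ} (hs : (1 - (l : ℝ)) / 2 < s.re) :
    Continuous (testH l s) := by
  have h := VectorFourier.fourierIntegral_continuous Real.continuous_fourierChar
    (L := innerₗ ℝ) continuous_inner (integrable_testG hl hs)
  have h' : Continuous (𝓕 (testG l s)) := h
  have e : testH l s = fun r => 𝓕 (testG l s) (r / (2 * Real.pi)) := by
    ext r
    rw [fourier_testG hl hs, mul_div_cancel₀ _ (by positivity)]
  rw [e]
  exact h'.comp (by fun_prop)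

lemma integrable_testH {l : ℕ} (hl : 1 ≤ l) {s : ℂ} (hs : (1 - (l : ℝ)) / 2 < s.re) :
    Integrable (testH l s) := by
  obtain ⟨C, -, hC⟩ := norm_testH_le hl hs
  refine ((integrable_one_add_norm (μ := volume) (E := ℝ) (r := 2) (by simp)).const_mul C).mono'
    (continuous_testH hl hs).aestronglyMeasurable ?_
  filter_upwards with r
  exact hC r

/-- Fourier inversion applies as $g$ is continuous and integrable and $h$ is integrable; evenness of
$g$ replaces the inverse transform by the direct one. -/
lemma fourier_testH {l : ℕ} (hl : 1 ≤ l) {s : ℂ} (hs : (1 - (l : ℝ)) / 2 < s.re) (u : ℝ) :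
    𝓕 (fun ξ => testH l s (2 * Real.pi * ξ)) u = testG l s u := by
  have e : 𝓕 (testG l s) = fun ξ => testH l s (2 * Real.pi * ξ) := funext (fourier_testG hl hs)
  have hi : Integrable (𝓕 (testG l s)) := by
    rw [e]
    exact (integrable_testH hl hs).comp_mul_left' (by positivity)
  have h := (continuous_testG hl s).fourierInv_fourier_eq (integrable_testG hl hs) hi
  have h' := congrFun h (-u)
  rw [Real.fourierInv_eq_fourier_neg, neg_neg, testG_neg, e] at h'
  exact h'

/-- This is inversion at the origin, where $g$ vanishes. It removes every constant from the digamma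
series. -/
lemma integral_testH {l : ℕ} (hl : 1 ≤ l) {s : ℂ} (hs : (1 - (l : ℝ)) / 2 < s.re) :
    ∫ r : ℝ, testH l s r = 0 := by
  have h := fourier_testH hl hs 0
  rw [Real.fourier_real_eq_integral_exp_smul] at h
  simp only [mul_zero, ofReal_zero, zero_mul, exp_zero, one_smul] at h
  rw [Measure.integral_comp_mul_left, testG, if_pos rfl] at h
  have h2 : |(2 * Real.pi)⁻¹| ≠ 0 := by positivity
  exact (smul_eq_zero.mp h).resolve_left h2

/-- Move the Fourier transform across the integral, with $1/(c+2\pi i\xi)$ as the transform of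
$e^{-cu}$ on $u>0$. Multiplying $g$ by $e^{-cu}$ there merely shifts $s$ by $c$. -/
lemma integral_testH_div {l : ℕ} (hl : 1 ≤ l) {s : ℂ} (hs : (1 - (l : ℝ)) / 2 < s.re) {c : ℝ}
    (hc : 0 < c) : ∫ r : ℝ, testH l s r * (1 / (c + I * r)) = 2 * Real.pi * phi l (s + c) 0 := by
  set f : ℝ → ℂ := (Ioi 0).indicator fun u : ℝ => exp (-(c : ℂ) * u) with hf
  have hc' : 0 < (c : ℂ).re := by simpa using hc
  have hfi : Integrable f :=
    (integrable_indicator_iff measurableSet_Ioi).mpr (integrableOn_exp_neg_mul hc')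
  have hff : ∀ ξ : ℝ, 𝓕 f ξ = 1 / (c + I * (2 * Real.pi * ξ : ℝ)) := by
    intro ξ
    rw [Real.fourier_real_eq_integral_exp_smul]
    have hre : 0 < ((c : ℂ) + I * (2 * Real.pi * ξ : ℝ)).re := by simpa using hc
    rw [← integral_exp_neg_mul hre, ← integral_indicator measurableSet_Ioi]
    congr 1 with u
    by_cases hu : u ∈ Ioi (0 : ℝ)
    · rw [hf, indicator_of_mem hu, indicator_of_mem hu, smul_eq_mul, ← exp_add]
      congr 1; push_cast; ring
    · rw [hf, indicator_of_notMem hu, indicator_of_notMem hu, smul_zero]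
  have hHi : Integrable fun ξ => testH l s (2 * Real.pi * ξ) :=
    (integrable_testH hl hs).comp_mul_left' (by positivity)
  have h : ∫ ξ, 𝓕 f ξ • testH l s (2 * Real.pi * ξ) =
      ∫ x, f x • 𝓕 (fun ξ => testH l s (2 * Real.pi * ξ)) x := by
    simpa using! VectorFourier.integral_fourierIntegral_smul_eq_flip (L := innerₗ ℝ)
      Real.continuous_fourierChar continuous_inner hfi hHi
  have hrhs : ∫ x, f x • 𝓕 (fun ξ => testH l s (2 * Real.pi * ξ)) x = phi l (s + c) 0 := by
    rw [phi_eq_integral hl (by simp; linarith), ← integral_indicator measurableSet_Ioi]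
    congr 1 with u
    rw [fourier_testH hl hs]
    by_cases hu : u ∈ Ioi (0 : ℝ)
    · rw [hf, indicator_of_mem hu, indicator_of_mem hu, smul_eq_mul, exp_mul_testG _ _ _ hu]
    · rw [hf, indicator_of_notMem hu, indicator_of_notMem hu, zero_smul]
  rw [hrhs] at h
  have hlhs : ∫ ξ, 𝓕 f ξ • testH l s (2 * Real.pi * ξ) =
      |(2 * Real.pi)⁻¹| • ∫ r : ℝ, testH l s r * (1 / (c + I * r)) := by
    rw [← Measure.integral_comp_mul_left (fun r : ℝ => testH l s r * (1 / ((c : ℂ) + I * r)))]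
    congr 1 with ξ
    rw [hff, smul_eq_mul, mul_comm]
  rw [hlhs, abs_of_pos (by positivity), real_smul] at h
  rw [← h]
  have : (Real.pi : ℂ) ≠ 0 := ofReal_ne_zero.mpr Real.pi_ne_zero
  push_cast
  field_simp

/-! ### The digamma integral -/

/-- The denominator dominates both $b(k+1)$ and $b(1+|r|)/2$, hence a multiple of their geometric
mean. The exponents are a compromise: $-3/2$ is summable in $k$, and $1/2$ against the decay of $h$
leaves the integrable $-3/2$ in $r$. -/
lemma norm_one_div_sub_one_div_le {b : ℝ} (hb : 0 < b) (hb1 : b ≤ 1) (k : ℕ) (r : ℝ) :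
    ‖1 / ((k : ℂ) + 1) - 1 / (b + I * r + k)‖ ≤
      2 / b * (1 + |r|) ^ (1 / 2 : ℝ) * ((k : ℝ) + 1) ^ (-(3 / 2) : ℝ) := by
  have hre : b ≤ ((b : ℂ) + I * r).re := by simp
  have h1 := mul_le_norm_add_natCast hb1 hre k
  have hre' : 0 < ((b : ℂ) + I * r).re := lt_of_lt_of_le hb hre
  have hne := add_natCast_ne_zero_of_re_pos hre' k
  rw [one_div_sub_one_div hne]
  set y := (b : ℂ) + I * r + k with hy
  have hyn : 0 < ‖y‖ := norm_pos_iff.mpr hne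
  have h2 : b * (1 + |r|) ≤ 2 * ‖y‖ := by
    have a : |r| ≤ ‖y‖ := by
      have := abs_im_le_norm y
      simpa [hy] using this
    nlinarith
  have h3 : ‖(b : ℂ) + I * r - 1‖ ≤ 1 + |r| := by
    have e : (b : ℂ) + I * r - 1 = -((1 - b : ℝ) : ℂ) + I * r := by push_cast; ring
    rw [e]
    refine (norm_add_le _ _).trans ?_
    rw [norm_neg, norm_real, norm_mul, norm_I, one_mul, norm_real, Real.norm_of_nonneg (by linarith),
      Real.norm_eq_abs]
    linarith
  have hkn : ‖(k : ℂ) + 1‖ = k + 1 := by exact_mod_cast norm_natCast (k + 1)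
  have hk1 : (0 : ℝ) < (k : ℝ) + 1 := by positivity
  have hr1 : (0 : ℝ) < 1 + |r| := by positivity
  rw [norm_div, norm_mul, hkn, div_le_iff₀ (by positivity)]
  have e1 : ((k : ℝ) + 1) ^ (-(3 / 2) : ℝ) * (k + 1) = ((k : ℝ) + 1) ^ (-(1 / 2) : ℝ) := by
    rw [← Real.rpow_add_one hk1.ne']; norm_num
  have e2 : (1 + |r|) ^ (1 / 2 : ℝ) * (1 + |r|) ^ (1 / 2 : ℝ) = 1 + |r| := by
    rw [← Real.rpow_add hr1]; norm_num
  have e3 : ((k : ℝ) + 1) ^ (1 / 2 : ℝ) * ((k : ℝ) + 1) ^ (1 / 2 : ℝ) = k + 1 := by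
    rw [← Real.rpow_add hk1]; norm_num
  have e4 : ((k : ℝ) + 1) ^ (-(1 / 2) : ℝ) = (((k : ℝ) + 1) ^ (1 / 2 : ℝ))⁻¹ := Real.rpow_neg hk1.le _
  have hA : 0 < (1 + |r|) ^ (1 / 2 : ℝ) := by positivity
  have hB : 0 < ((k : ℝ) + 1) ^ (1 / 2 : ℝ) := by positivity
  have e5 : 2 / b * (1 + |r|) ^ (1 / 2 : ℝ) * ((k : ℝ) + 1) ^ (-(3 / 2) : ℝ) *
      ((k + 1) * ‖y‖) = 2 / b * (1 + |r|) ^ (1 / 2 : ℝ) * (((k : ℝ) + 1) ^ (1 / 2 : ℝ))⁻¹ * ‖y‖ := by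
    rw [← e4, ← e1]; ring
  rw [e5]
  refine h3.trans ?_
  generalize (1 + |r|) ^ (1 / 2 : ℝ) = A at *
  generalize ((k : ℝ) + 1) ^ (1 / 2 : ℝ) = B at *
  rw [← e2, mul_comm (2 / b) A, mul_assoc, mul_assoc]
  refine mul_le_mul_of_nonneg_left ?_ hA.le
  rw [← e2] at h2
  rw [← e3] at h1
  have h4 : (A * B * b) ^ 2 ≤ (2 * ‖y‖) ^ 2 := by
    calc (A * B * b) ^ 2 = (b * (A * A)) * (b * (B * B)) := by ring
      _ ≤ (2 * ‖y‖) * (2 * ‖y‖) := by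
        refine mul_le_mul h2 (by linarith) (by positivity) (by positivity)
      _ = _ := by ring
  have h5 := (sq_le_sq₀ (by positivity) (by positivity)).mp h4
  have e6 : 2 / b * (B⁻¹ * ‖y‖) = 2 * ‖y‖ / (b * B) := by field_simp
  rw [e6, le_div_iff₀ (by positivity)]
  linarith

lemma continuous_digamma_line {b : ℝ} (hb : 0 < b) :
    Continuous fun r : ℝ => digamma (b + I * r) := by
  rw [continuous_iff_continuousAt]
  intro r
  have h : ContinuousAt digamma (b + I * r) := (hasDerivAt_digamma (by simpa using hb)).continuousAt
  exact h.comp (f := fun r : ℝ => (b : ℂ) + I * r) (by fun_prop)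

/-- The integral of `h(r) (Γ'/Γ)(b + i r)` converges, and it is `-2π ∑ₖ φ_{s+b+k}(0)`. -/
lemma integral_testH_mul_digamma {l : ℕ} (hl : 1 ≤ l) {s : ℂ} (hs : (1 - (l : ℝ)) / 2 < s.re)
    {b : ℝ} (hb : 0 < b) (hb1 : b ≤ 1) :
    Integrable (fun r : ℝ => testH l s r * digamma (b + I * r)) ∧
      HasSum (fun k : ℕ => phi l (s + b + k) 0)
        (-1 / (2 * Real.pi) * ∫ r : ℝ, testH l s r * digamma (b + I * r)) := by
  obtain ⟨C, hC0, hC⟩ := norm_testH_le hl hs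
  set F : ℕ → ℝ → ℂ := fun k r => testH l s r * (1 / ((k : ℂ) + 1) - 1 / (b + I * r + k)) with hF
  have hre : ∀ r : ℝ, 0 < ((b : ℂ) + I * r).re := fun r => by simpa using hb
  have hbound : ∀ k r, ‖F k r‖ ≤ 2 * C / b * (1 + |r|) ^ (-(3 / 2) : ℝ) *
      ((k : ℝ) + 1) ^ (-(3 / 2) : ℝ) := by
    intro k r
    have hr1 : (0 : ℝ) < 1 + |r| := by positivity
    have e : (1 + |r|) ^ (-(3 / 2) : ℝ) = (1 + |r|) ^ (-2 : ℝ) * (1 + |r|) ^ (1 / 2 : ℝ) := by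
      rw [← Real.rpow_add hr1]; norm_num
    rw [hF, norm_mul]
    calc _ ≤ (C * (1 + |r|) ^ (-2 : ℝ)) *
          (2 / b * (1 + |r|) ^ (1 / 2 : ℝ) * ((k : ℝ) + 1) ^ (-(3 / 2) : ℝ)) := by
          gcongr
          · exact hC r
          · exact norm_one_div_sub_one_div_le hb hb1 k r
      _ = _ := by rw [e]; ring
  have hcont : ∀ k, Continuous (F k) := by
    intro k
    refine (continuous_testH hl hs).mul (continuous_const.sub (continuous_const.div ?_ ?_))
    · fun_prop
    · exact fun r => add_natCast_ne_zero_of_re_pos (hre r) k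
  have hJ : Integrable fun r : ℝ => (1 + |r|) ^ (-(3 / 2) : ℝ) :=
    integrable_one_add_norm (μ := volume) (E := ℝ) (r := 3 / 2) (by norm_num)
  have hFi : ∀ k, Integrable (F k) := fun k =>
    ((hJ.const_mul (2 * C / b)).mul_const _).mono' (hcont k).aestronglyMeasurable
      (Eventually.of_forall (hbound k))
  have hks : Summable fun k : ℕ => ((k : ℝ) + 1) ^ (-(3 / 2) : ℝ) := by
    have := (summable_nat_add_iff 1).mpr (Real.summable_nat_rpow.mpr (show -(3 / 2 : ℝ) < -1 by norm_num))
    simpa using this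
  have hsum : Summable fun k => ∫ r, ‖F k r‖ := by
    refine Summable.of_nonneg_of_le (fun k => integral_nonneg fun r => norm_nonneg _) (fun k => ?_)
      (hks.mul_left (∫ r : ℝ, 2 * C / b * (1 + |r|) ^ (-(3 / 2) : ℝ)))
    rw [← integral_mul_const]
    exact integral_mono (hFi k).norm ((hJ.const_mul _).mul_const _) (hbound k)
  have htsum : ∀ r, ∑' k, F k r =
      testH l s r * digamma (b + I * r) + testH l s r * Real.eulerMascheroniConstant := by
    intro r
    rw [hF, tsum_mul_left, digamma_eq_tsum (hre r)]
    ring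
  have hint : Integrable (fun r : ℝ => testH l s r * digamma (b + I * r)) := by
    have hG : Integrable fun r => ∑' k, F k r := by
      refine ((hJ.const_mul (2 * C / b)).mul_const
        (∑' k : ℕ, ((k : ℝ) + 1) ^ (-(3 / 2) : ℝ))).mono' ?_ ?_
      · rw [funext htsum]
        exact (((continuous_testH hl hs).mul (continuous_digamma_line hb)).add
          ((continuous_testH hl hs).mul continuous_const)).aestronglyMeasurable
      · filter_upwards with r
        exact tsum_of_norm_bounded (hks.hasSum.mul_left _) (hbound · r)
    -- The series omits the $-\gamma$ of the digamma function, so the γ-multiple of $h$ is removed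
    -- separately.
    have := hG.sub ((integrable_testH hl hs).mul_const (Real.eulerMascheroniConstant : ℂ))
    refine this.congr (Eventually.of_forall fun r => ?_)
    simp only [Pi.sub_apply, htsum]
    ring
  refine ⟨hint, ?_⟩
  have h := hasSum_integral_of_summable_integral_norm hFi hsum
  have e1 : ∀ k, ∫ r, F k r = -(2 * Real.pi) * phi l (s + b + k) 0 := by
    intro k
    have hbk : 0 < b + k := by positivity
    have hd := integral_testH_div hl hs hbk
    have h1 := (integrable_testH hl hs).mul_const (1 / ((k : ℂ) + 1))
    -- The part with $1/(k+1)$ integrates to zero since $\int h=0$, leaving the integral against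
    -- $1/(b+k+ir)$.
    have e : ∀ r : ℝ, testH l s r * (1 / (((b + k : ℝ) : ℂ) + I * r)) =
        testH l s r * (1 / ((k : ℂ) + 1)) - F k r := by
      intro r
      rw [hF]
      push_cast
      rw [add_right_comm]
      ring
    rw [integral_congr_ae (Eventually.of_forall e), integral_sub h1 (hFi k), integral_mul_const,
      integral_testH hl hs] at hd
    push_cast at hd
    rw [← add_assoc] at hd
    linear_combination -hd
  have e2 : ∫ r, ∑' k, F k r = ∫ r : ℝ, testH l s r * digamma (b + I * r) := by
    rw [integral_congr_ae (Eventually.of_forall htsum),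
      integral_add hint ((integrable_testH hl hs).mul_const _), integral_mul_const,
      integral_testH hl hs]
    simp
  simp only [e1] at h
  rw [e2] at h
  have h2 := h.mul_left (-1 / (2 * Real.pi : ℂ))
  have e3 : ∀ k : ℕ, -1 / (2 * Real.pi : ℂ) * (-(2 * Real.pi) * phi l (s + b + k) 0) =
      phi l (s + b + k) 0 := fun k => by field_simp
  simpa only [e3] using h2

end HigherSelberg

namespace HigherSelberg

open Filter Topology Complex

/-! ### Telescoping of $\phi$ and the logarithm of $I_l$ -/

lemma tendsto_one_div_add_mul {l : ℕ} (hl : 1 ≤ l) {y : ℂ} (hy : 0 < y.re) :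
    Tendsto (fun n : ℕ => 1 / (y + l * n)) atTop (𝓝 0) := by
  have h : Tendsto (fun n : ℕ => l * n) atTop atTop := tendsto_id.const_mul_atTop' (by omega)
  refine ((tendsto_one_div_add_natCast hy).comp h).congr fun n => ?_
  simp

/-- The function `φ` in terms of the trigamma function. -/
lemma phi_eq_trigamma {l : ℕ} (hl : 1 ≤ l) {w : ℂ} (hw : (1 - (l : ℝ)) / 2 < w.re) :
    phi l w 0 = 1 / (l : ℂ) ^ 2 * trigamma ((w - 1 / 2 + l) / l) -
      1 / l * (1 / (w - 1 / 2 + l / 2)) := by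
  have hlp : (0 : ℝ) < l := by exact_mod_cast hl
  have hl0 : (l : ℂ) ≠ 0 := by exact_mod_cast hlp.ne'
  have hz : 0 < ((w - 1 / 2 + l) / l).re := by
    rw [show ((w - 1 / 2 + l) / l) = (w - 1 / 2 + l) / ((l : ℝ) : ℂ) by push_cast; rfl,
      div_ofReal_re]
    apply div_pos _ hlp
    simp; norm_num; linarith
  have hy : 0 < (w - 1 / 2 + l / 2).re := by
    simp; norm_num; linarith
  set y := w - 1 / 2 + l / 2 with hy'
  have h1 := ((summable_trigamma_term hz).of_norm.hasSum.mul_left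
    (1 / (l : ℂ) ^ 2)).tendsto_sum_nat
  -- The simple fractions of the $m$-th term are $1/(y+lm)$ and $1/(y+l(m+1))$, so their partial
  -- sums telescope.
  have h2 := ((tendsto_one_div_add_mul hl hy).const_sub (1 / y)).const_mul (1 / (l : ℂ))
  have h3 := h1.sub h2
  rw [sub_zero] at h3
  refine tendsto_nhds_unique (summable_phiTerm hl hw 0).hasSum.tendsto_sum_nat (h3.congr fun n => ?_)
  induction n with
  | zero => simp
  | succ n ih =>
    rw [Finset.sum_range_succ, Finset.sum_range_succ, ← ih]
    have e1 : w + l * n + l - 1 / 2 + I * ((0 : ℝ) : ℂ) = l * ((w - 1 / 2 + l) / l + n) := by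
      push_cast; field_simp; ring
    have e2 : w + l * n + l / 2 - 1 / 2 + I * ((0 : ℝ) : ℂ) = y + l * n := by
      rw [hy']; push_cast; ring
    have e3 : w + l * n + 3 * l / 2 - 1 / 2 + I * ((0 : ℝ) : ℂ) = y + l * (n + 1 : ℕ) := by
      rw [hy']; push_cast; ring
    rw [phiTerm, e1, e2, e3]
    rw [mul_pow, ← one_div_mul_one_div]
    ring

/-- The logarithm of `I_l`. -/
noncomputable def logI (l : ℕ) (s : ℂ) : ℂ :=
  -(s / l) * Real.log (k1 l) - s * (s + l) / (2 * l) * Real.log l +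
    ∑ r ∈ Finset.range l, logGamma2 ((s + l + r) / l)

/-- The first derivative of `log I_l`. -/
noncomputable def logIDeriv (l : ℕ) (s : ℂ) : ℂ :=
  -(1 / l) * Real.log (k1 l) - (2 * s + l) / (2 * l) * Real.log l +
    ∑ r ∈ Finset.range l, 1 / l * (((s + l + r) / l - 1) + 1 / 2 + deriv riemannZeta 0 -
      ((s + l + r) / l - 1) * digamma ((s + l + r) / l))

/-- The second derivative of `log I_l`. -/
noncomputable def logIDeriv2 (l : ℕ) (s : ℂ) : ℂ :=
  -(1 / l) * Real.log l + 1 / (l : ℂ) ^ 2 *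
    ∑ r ∈ Finset.range l, digamma2Deriv ((s + l + r) / l)

lemma add_div_re_pos {l : ℕ} (hl : 1 ≤ l) {s : ℂ} (hs : -(l : ℝ) < s.re) (r : ℕ) :
    0 < ((s + l + r) / l).re := by
  have hlp : (0 : ℝ) < l := by exact_mod_cast hl
  rw [show ((s + l + r) / l) = (s + l + r) / ((l : ℝ) : ℂ) by push_cast; rfl, div_ofReal_re]
  have : (0 : ℝ) ≤ r := r.cast_nonneg
  apply div_pos _ hlp
  simp; linarith

lemma exp_logI {l : ℕ} (hl : 1 ≤ l) {s : ℂ} (hs : -(l : ℝ) < s.re) :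
    exp (logI l s) = Ifun l s := by
  rw [logI, exp_add, exp_sum, Ifun]
  congr 1
  exact Finset.prod_congr rfl fun r _ =>
    exp_logGamma2 (ne_neg_natCast_of_re_pos (add_div_re_pos hl hs r))

lemma hasDerivAt_add_div (l r : ℕ) (s : ℂ) :
    HasDerivAt (fun s : ℂ => (s + l + r) / l) (1 / l) s :=
  (((hasDerivAt_id s).add_const (l : ℂ)).add_const (r : ℂ)).div_const (l : ℂ)

lemma hasDerivAt_logI {l : ℕ} (hl : 1 ≤ l) {s : ℂ} (hs : -(l : ℝ) < s.re) :
    HasDerivAt (logI l) (logIDeriv l s) s := by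
  have hid := hasDerivAt_id s
  have h1 := ((hid.div_const (l : ℂ)).neg.mul_const (Real.log (k1 l) : ℂ)).sub
    (((hid.mul (hid.add_const (l : ℂ))).div_const (2 * (l : ℂ))).mul_const (Real.log l : ℂ))
  have h2 : HasDerivAt (fun s : ℂ => ∑ r ∈ Finset.range l, logGamma2 ((s + l + r) / l))
      (∑ r ∈ Finset.range l, 1 / l * (((s + l + r) / l - 1) + 1 / 2 + deriv riemannZeta 0 -
      ((s + l + r) / l - 1) * digamma ((s + l + r) / l))) s := by
    refine HasDerivAt.fun_sum fun r _ => ?_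
    refine ((hasDerivAt_logGamma2 (add_div_re_pos hl hs r)).comp s
      (hasDerivAt_add_div l r s)).congr_deriv ?_
    ring
  refine (h1.add h2).congr_deriv ?_
  rw [logIDeriv]
  congr 1
  simp only [id]
  ring

lemma hasDerivAt_logIDeriv {l : ℕ} (hl : 1 ≤ l) {s : ℂ} (hs : -(l : ℝ) < s.re) :
    HasDerivAt (logIDeriv l) (logIDeriv2 l s) s := by
  have hid := hasDerivAt_id s
  have h1 := ((((hid.const_mul 2).add_const (l : ℂ)).div_const (2 * (l : ℂ))).mul_const
    (Real.log l : ℂ)).const_sub (-(1 / (l : ℂ)) * Real.log (k1 l))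
  have h2 : HasDerivAt (fun s : ℂ => ∑ r ∈ Finset.range l, 1 / (l : ℂ) * (((s + l + r) / l - 1) +
      1 / 2 + deriv riemannZeta 0 - ((s + l + r) / l - 1) * digamma ((s + l + r) / l)))
      (∑ r ∈ Finset.range l, 1 / (l : ℂ) * (digamma2Deriv ((s + l + r) / l) * (1 / l))) s := by
    refine HasDerivAt.fun_sum fun r _ => HasDerivAt.const_mul _ ?_
    exact (hasDerivAt_deriv_logGamma2 (add_div_re_pos hl hs r)).comp s
      (hasDerivAt_add_div l r s)
  refine (h1.add h2).congr_deriv ?_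
  rw [logIDeriv2, Finset.mul_sum]
  congr 1
  · field_simp
  · refine Finset.sum_congr rfl fun r _ => ?_
    ring

/-- The digamma integral in terms of `log I_l`. -/
lemma integral_testH_mul_digamma_eq {l : ℕ} (hl : 1 ≤ l) {s : ℂ} (hs : (1 - (l : ℝ)) / 2 < s.re)
    {b : ℝ} (hb : 1 / 2 ≤ b) (hb1 : b ≤ 1) :
    -1 / (2 * Real.pi) * ∫ r : ℝ, testH l s r * digamma (b + I * r) =
      logIDeriv2 l (s + b - 1 / 2) + 1 / l * digamma (s + b - 1 / 2 + l / 2) := by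
  have h := (integral_testH_mul_digamma hl hs (by linarith) hb1).2.tendsto_sum_nat
  -- The series is known to converge, so its sum may be computed along the partial sums of length
  -- $ln$, where grouping by residues applies.
  have hln : Tendsto (fun n : ℕ => l * n) atTop atTop := tendsto_id.const_mul_atTop' (by omega)
  have hw : -((l : ℝ) / 2) < (s + b - 1 / 2).re := by
    simp; norm_num; linarith
  refine tendsto_nhds_unique (h.comp hln) ((tendsto_sum_trigamma_sub hl hw).congr fun n => ?_)
  refine Finset.sum_congr rfl fun k _ => ?_
  rw [phi_eq_trigamma hl (by simp; linarith)]
  congr 3 <;> ring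

/-! ### Higher Dirichlet `L`-functions -/

/-- The coefficients `χ(n) Λ(n)`. -/
noncomputable def mangoldtCoeff {q : ℕ} (χ : DirichletCharacter ℂ q) : ℕ → ℂ :=
  (fun n : ℕ => χ n) * (fun n : ℕ => (ArithmeticFunction.vonMangoldt n : ℂ))

/-- The coefficients `χ(n) Λ(n) / (n ^ K - 1)`. -/
noncomputable def higherMangoldtCoeff {q : ℕ} (χ : DirichletCharacter ℂ q) (K : ℕ) : ℕ → ℂ :=
  fun n => mangoldtCoeff χ n / ((n : ℂ) ^ K - 1)

lemma mangoldtCoeff_one {q : ℕ} (χ : DirichletCharacter ℂ q) : mangoldtCoeff χ 1 = 0 := by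
  simp [mangoldtCoeff]

lemma term_mangoldtCoeff_add {q : ℕ} (χ : DirichletCharacter ℂ q) (K : ℕ) (z : ℂ) (m n : ℕ)
    (hn : n ≠ 0) : LSeries.term (mangoldtCoeff χ) (z + K * m) n =
      LSeries.term (mangoldtCoeff χ) z n * (((n : ℂ) ^ K)⁻¹) ^ m := by
  have hn' : (n : ℂ) ≠ 0 := Nat.cast_ne_zero.mpr hn
  have e : (K : ℂ) * m = ((K * m : ℕ) : ℂ) := by push_cast; rfl
  rw [LSeries.term_of_ne_zero hn, LSeries.term_of_ne_zero hn, cpow_add _ _ hn', e, cpow_natCast,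
    pow_mul, inv_pow, ← div_eq_mul_inv, div_div]

lemma norm_inv_pow_le {n K : ℕ} (hn : 2 ≤ n) (hK : 1 ≤ K) : ‖(((n : ℂ) ^ K)⁻¹)‖ ≤ 1 / 2 := by
  rw [norm_inv, norm_pow, norm_natCast, one_div]
  have h2 : (2 : ℝ) ≤ n := by exact_mod_cast hn
  gcongr
  exact h2.trans (le_self_pow₀ (by linarith) (by omega))

/-- Interchange the sums over shifts and integers: $\sum_{m\ge1}n^{-Km}=1/(n^K-1)$ for $n\ge2$. The
ratio is at most $1/2$ there, which gives absolute convergence of the double series. -/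
lemma hasSum_LSeries_mangoldtCoeff {q : ℕ} (χ : DirichletCharacter ℂ q) {K : ℕ} (hK : 1 ≤ K) {z : ℂ}
    (hz : 1 < z.re + K) :
    LSeriesSummable (higherMangoldtCoeff χ K) z ∧
      HasSum (fun m : ℕ => LSeries (mangoldtCoeff χ) (z + K * (m + 1 : ℕ)))
        (LSeries (higherMangoldtCoeff χ K) z) := by
  obtain ⟨F, hF⟩ : ∃ F : ℕ × ℕ → ℂ,
      ∀ m n, F (m, n) = LSeries.term (mangoldtCoeff χ) (z + K * (m + 1 : ℕ)) n :=
    ⟨fun p => LSeries.term (mangoldtCoeff χ) (z + K * (p.1 + 1 : ℕ)) p.2, fun _ _ => rfl⟩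
  have hz' : 1 < (z + K).re := by simpa using hz
  have hs0 : LSeriesSummable (mangoldtCoeff χ) (z + K) :=
    DirichletCharacter.LSeriesSummable_twist_vonMangoldt χ hz'
  have hsm : ∀ m : ℕ, LSeriesSummable (mangoldtCoeff χ) (z + K * (m + 1 : ℕ)) := fun m => by
    refine DirichletCharacter.LSeriesSummable_twist_vonMangoldt χ ?_
    have : (0 : ℝ) ≤ K * m := by positivity
    simp
    linarith
  have hterm : ∀ m n : ℕ, n ≠ 0 → F (m, n) =
      LSeries.term (mangoldtCoeff χ) (z + K) n * (((n : ℂ) ^ K)⁻¹) ^ m := by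
    intro m n hn
    rw [hF, ← term_mangoldtCoeff_add χ K _ m n hn]
    congr 1
    push_cast; ring
  have hterm1 : ∀ w, LSeries.term (mangoldtCoeff χ) w 1 = 0 := fun w => by
    rw [LSeries.term_of_ne_zero one_ne_zero, mangoldtCoeff_one, zero_div]
  have hbound : ∀ p, ‖F p‖ ≤ (1 / 2 : ℝ) ^ p.1 * ‖LSeries.term (mangoldtCoeff χ) (z + K) p.2‖ := by
    rintro ⟨m, n⟩
    rcases Nat.lt_or_ge n 2 with hn | hn
    · interval_cases n
      · rw [hF, LSeries.term_zero, norm_zero]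
        positivity
      · rw [hF, hterm1, norm_zero]
        positivity
    · rw [hterm m n (by omega), norm_mul, norm_pow, mul_comm]
      gcongr
      exact norm_inv_pow_le hn hK
  have hsum : Summable F := by
    refine Summable.of_norm_bounded (Summable.mul_of_nonneg
      (summable_geometric_of_lt_one (by norm_num) (by norm_num : (1 / 2 : ℝ) < 1)) hs0.norm
      (fun _ => by positivity) (fun _ => norm_nonneg _)) hbound
  have h1 : HasSum (fun m : ℕ => LSeries (mangoldtCoeff χ) (z + K * (m + 1 : ℕ))) (∑' p, F p) :=
    hsum.hasSum.prod_fiberwise fun m => by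
      simpa only [hF] using! (hsm m).hasSum
  have h2 : HasSum (LSeries.term (higherMangoldtCoeff χ K) z) (∑' p, F p) := by
    have hswap : HasSum (fun p : ℕ × ℕ => F p.swap) (∑' p, F p) :=
      (Equiv.prodComm ℕ ℕ).hasSum_iff.mpr hsum.hasSum
    refine hswap.prod_fiberwise fun n => ?_
    simp only [Prod.swap_prod_mk]
    rcases Nat.lt_or_ge n 2 with hn | hn
    -- At $n=1$ the denominator $n^K-1$ vanishes, but so does $\Lambda(1)$; $n=0$ contributes
    -- nothing to an `LSeries`.
    · have e : ∀ m, F (m, n) = 0 := fun m => by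
        interval_cases n
        · rw [hF, LSeries.term_zero]
        · rw [hF, hterm1]
      have e' : LSeries.term (higherMangoldtCoeff χ K) z n = 0 := by
        interval_cases n
        · simp
        · rw [LSeries.term_of_ne_zero one_ne_zero, higherMangoldtCoeff, mangoldtCoeff_one]; simp
      simp only [e, e']
      exact hasSum_zero
    · have hn0 : n ≠ 0 := by omega
      have hr := norm_inv_pow_le hn hK
      have hg := (hasSum_geometric_of_norm_lt_one (lt_of_le_of_lt hr (by norm_num))).mul_left
        (LSeries.term (mangoldtCoeff χ) (z + K) n)
      simp only [fun m => hterm m n hn0]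
      suffices e : LSeries.term (mangoldtCoeff χ) (z + K) n * (1 - ((n : ℂ) ^ K)⁻¹)⁻¹ =
          LSeries.term (higherMangoldtCoeff χ K) z n from e ▸ hg
      have h1 := term_mangoldtCoeff_add χ K z 1 n hn0
      rw [Nat.cast_one, mul_one, pow_one] at h1
      rw [h1, LSeries.term_of_ne_zero hn0, LSeries.term_of_ne_zero hn0, higherMangoldtCoeff]
      field_simp
  exact ⟨h2.summable, by rw [LSeries, h2.tsum_eq]; exact h1⟩

lemma abscissa_higherMangoldtCoeff_le {q : ℕ} (χ : DirichletCharacter ℂ q) {K : ℕ} (hK : 1 ≤ K) :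
    LSeries.abscissaOfAbsConv (higherMangoldtCoeff χ K) ≤ ((1 - K : ℝ) : EReal) := by
  refine LSeries.abscissaOfAbsConv_le_of_forall_lt_LSeriesSummable fun y hy => ?_
  refine (hasSum_LSeries_mangoldtCoeff χ hK (z := y) ?_).1
  simp
  linarith

variable {q : ℕ} [NeZero q]

lemma LFunction_ne_zero (χ : DirichletCharacter ℂ q) {w : ℂ} (hw : 1 < w.re) : χ.LFunction w ≠ 0 :=
  DirichletCharacter.LFunction_ne_zero_of_one_le_re χ (Or.inr fun h => by simp [h] at hw) hw.le

lemma differentiableAt_LFunction (χ : DirichletCharacter ℂ q) {w : ℂ} (hw : 1 < w.re) :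
    DifferentiableAt ℂ χ.LFunction w :=
  DirichletCharacter.differentiableAt_LFunction χ w (Or.inl fun h => by simp [h] at hw)

lemma logDeriv_LFunction (χ : DirichletCharacter ℂ q) {w : ℂ} (hw : 1 < w.re) :
    logDeriv χ.LFunction w = -LSeries (mangoldtCoeff χ) w := by
  rw [mangoldtCoeff, DirichletCharacter.LSeries_twist_vonMangoldt_eq χ hw, logDeriv_apply,
    DirichletCharacter.deriv_LFunction_eq_deriv_LSeries χ hw,
    DirichletCharacter.LFunction_eq_LSeries χ hw]
  ring

/-- Every $n\ge2$ in the Dirichlet series satisfies $n^{-\mathrm{Re}\,w}\le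
n^{-2}2^{-(\mathrm{Re}\,w-2)}$. Along the shifts of $w$ this is geometric decay, hence convergence
of the product at every $s$. -/
lemma norm_LFunction_sub_one_le (χ : DirichletCharacter ℂ q) :
    ∃ C : ℝ, ∀ w : ℂ, 2 ≤ w.re → ‖χ.LFunction w - 1‖ ≤ C * (1 / 2) ^ (w.re - 2) := by
  have hS : Summable fun n : ℕ => 1 / ((n : ℝ) + 2) ^ 2 := by
    have := (summable_nat_add_iff 2).mpr (Real.summable_one_div_nat_pow.mpr (one_lt_two))
    simpa using this
  refine ⟨∑' n : ℕ, 1 / ((n : ℝ) + 2) ^ 2, fun w hw => ?_⟩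
  have hw1 : 1 < w.re := by linarith
  have hs := DirichletCharacter.LSeriesSummable_of_one_lt_re χ hw1
  rw [DirichletCharacter.LFunction_eq_LSeries χ hw1, LSeries, ← hs.sum_add_tsum_nat_add 2]
  simp only [Finset.sum_range_succ, Finset.sum_range_zero, LSeries.term_zero, zero_add]
  have h1 : LSeries.term (fun n : ℕ => χ n) w 1 = 1 := by
    rw [LSeries.term_of_ne_zero one_ne_zero]; simp
  rw [h1, add_sub_cancel_left]
  refine tsum_of_norm_bounded (hS.hasSum.mul_right _) fun n => ?_
  rw [LSeries.norm_term_eq, if_neg (by omega)]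
  have hn : (0 : ℝ) < (n : ℝ) + 2 := by positivity
  have e : (((n + 2 : ℕ) : ℝ)) ^ w.re = ((n : ℝ) + 2) ^ 2 * ((n : ℝ) + 2) ^ (w.re - 2) := by
    rw [← Real.rpow_two, ← Real.rpow_add hn]; push_cast; congr 1; ring
  have h2 : (2 : ℝ) ^ (w.re - 2) ≤ ((n : ℝ) + 2) ^ (w.re - 2) := by
    refine Real.rpow_le_rpow (by norm_num) (by linarith [n.cast_nonneg (α := ℝ)]) (by linarith)
  rw [e, Real.div_rpow zero_le_one zero_le_two, Real.one_rpow, div_mul_div_comm, one_mul]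
  exact div_le_div₀ zero_le_one (χ.norm_le_one _) (by positivity) (by gcongr)

/-- The terms of the product for `s ↦ L_{2l∞}(2s, χ)`. -/
noncomputable def higherLTerm (l : ℕ) (χ : DirichletCharacter ℂ q) (m : ℕ) (s : ℂ) : ℂ :=
  χ.LFunction (2 * s + (2 * l : ℕ) * (m + 1))

lemma higherLTerm_bound {l : ℕ} (hl : 1 ≤ l) (χ : DirichletCharacter ℂ q) (σ : ℝ) :
    ∃ u : ℕ → ℝ, Summable u ∧ ∀ᶠ m : ℕ in atTop, ∀ s : ℂ, σ ≤ s.re → ‖higherLTerm l χ m s - 1‖ ≤ u m := by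
  obtain ⟨C, hC⟩ := norm_LFunction_sub_one_le χ
  have hC0 : 0 ≤ C := by
    have := (norm_nonneg _).trans (hC 2 (by simp))
    simpa using this
  refine ⟨fun m => C * (1 / 2) ^ (2 * σ) * (1 / 2) ^ m,
    (summable_geometric_of_lt_one (by norm_num) (by norm_num)).mul_left _, ?_⟩
  filter_upwards [eventually_ge_atTop ⌈2 - 2 * σ⌉₊] with m hm s hs
  have hm' : 2 - 2 * σ ≤ m := Nat.ceil_le.mp hm
  have hl1 : (1 : ℝ) ≤ l := by exact_mod_cast hl
  have hre : (2 * s + (2 * l : ℕ) * (m + 1)).re = 2 * s.re + 2 * l * (m + 1) := by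
    simp
  have h1 : (m : ℝ) + 1 ≤ l * (m + 1) := by nlinarith
  have hge : 2 * σ + m ≤ (2 * s + (2 * l : ℕ) * (m + 1)).re - 2 := by rw [hre]; linarith
  refine (hC _ (by linarith)).trans ?_
  rw [mul_assoc, ← Real.rpow_natCast, ← Real.rpow_add (by norm_num)]
  refine mul_le_mul_of_nonneg_left ?_ hC0
  exact Real.rpow_le_rpow_of_exponent_ge (by norm_num) (by norm_num) hge

lemma summable_higherLTerm_sub_one {l : ℕ} (hl : 1 ≤ l) (χ : DirichletCharacter ℂ q) (s : ℂ) :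
    Summable fun m => ‖higherLTerm l χ m s - 1‖ := by
  obtain ⟨u, hu, hb⟩ := higherLTerm_bound hl χ s.re
  refine Summable.of_norm_bounded_eventually_nat hu ?_
  filter_upwards [hb] with m hm
  rw [norm_norm]
  exact hm s le_rfl

lemma multipliable_higherLTerm {l : ℕ} (hl : 1 ≤ l) (χ : DirichletCharacter ℂ q) (s : ℂ) :
    Multipliable fun m => higherLTerm l χ m s := by
  simpa using multipliable_one_add_of_summable (summable_higherLTerm_sub_one hl χ s)

lemma higherL_eq_tprod (l : ℕ) (χ : DirichletCharacter ℂ q) (s : ℂ) :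
    higherL (2 * l) χ (2 * s) = ∏' m, higherLTerm l χ m s := rfl

/-- The functional equation of the higher Dirichlet `L`-function. -/
lemma higherL_add {l : ℕ} (hl : 1 ≤ l) (χ : DirichletCharacter ℂ q) (s : ℂ) :
    higherL (2 * l) χ (2 * s) =
      χ.LFunction (2 * (s + l)) * higherL (2 * l) χ (2 * (s + l)) := by
  have e : ∀ m, higherLTerm l χ (m + 1) s = higherLTerm l χ m (s + l) := fun m => by
    rw [higherLTerm, higherLTerm]; congr 1; push_cast; ring
  -- Splitting off the first factor requires only that the remaining product be multipliable, so
  -- zeros of $L$ are allowed.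
  rw [higherL_eq_tprod, higherL_eq_tprod, tprod_eq_zero_mul']
  · simp only [e]
    congr 1
    rw [higherLTerm]; congr 1; push_cast; ring
  · simp only [e]
    exact multipliable_higherLTerm hl χ _

lemma one_lt_re_higherLTerm {l : ℕ} (hl : 1 ≤ l) {s : ℂ} (hs : (1 - (l : ℝ)) / 2 < s.re) (m : ℕ) :
    1 < (2 * s + (2 * l : ℕ) * (m + 1) : ℂ).re := by
  have hm0 : (0 : ℝ) ≤ l * m := by positivity
  simp
  linarith

lemma isOpen_re_gt (σ : ℝ) : IsOpen {s : ℂ | σ < s.re} := isOpen_lt continuous_const continuous_re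

lemma differentiableOn_higherLTerm {l : ℕ} (hl : 1 ≤ l) (χ : DirichletCharacter ℂ q) (m : ℕ) :
    DifferentiableOn ℂ (higherLTerm l χ m) {s | (1 - (l : ℝ)) / 2 < s.re} := by
  intro s hs
  have h := differentiableAt_LFunction χ (one_lt_re_higherLTerm hl hs m)
  exact (h.comp s (f := fun s : ℂ => 2 * s + (2 * l : ℕ) * (m + 1)) (by fun_prop)).differentiableWithinAt

lemma hasProdLocallyUniformlyOn_higherLTerm {l : ℕ} (hl : 1 ≤ l) (χ : DirichletCharacter ℂ q) :
    HasProdLocallyUniformlyOn (higherLTerm l χ) (fun s => higherL (2 * l) χ (2 * s))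
      {s | (1 - (l : ℝ)) / 2 < s.re} := by
  obtain ⟨u, hu, hb⟩ := higherLTerm_bound hl χ ((1 - (l : ℝ)) / 2)
  have := Summable.hasProdLocallyUniformlyOn_nat_one_add
    (f := fun m s => higherLTerm l χ m s - 1) (isOpen_re_gt ((1 - (l : ℝ)) / 2)) hu
    (hb.mono fun m hm s hs => hm s (le_of_lt hs))
    (fun m => ((differentiableOn_higherLTerm hl χ m).sub_const 1).continuousOn)
  simpa [higherL_eq_tprod] using this

lemma differentiableOn_higherL {l : ℕ} (hl : 1 ≤ l) (χ : DirichletCharacter ℂ q) :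
    DifferentiableOn ℂ (fun s => higherL (2 * l) χ (2 * s)) {s | (1 - (l : ℝ)) / 2 < s.re} :=
  (hasProdLocallyUniformlyOn_higherLTerm hl χ).differentiableOn
    (.of_forall fun t => by
      simpa [Finset.prod_fn] using
        DifferentiableOn.finsetProd fun m (_ : m ∈ t) => differentiableOn_higherLTerm hl χ m)
    (isOpen_re_gt _)

lemma higherL_ne_zero {l : ℕ} (hl : 1 ≤ l) (χ : DirichletCharacter ℂ q) {s : ℂ}
    (hs : (1 - (l : ℝ)) / 2 < s.re) : higherL (2 * l) χ (2 * s) ≠ 0 := by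
  have h := tprod_one_add_ne_zero_of_summable (f := fun m => higherLTerm l χ m s - 1)
    (fun m => by
      rw [add_sub_cancel]
      exact LFunction_ne_zero χ (one_lt_re_higherLTerm hl hs m))
    (summable_higherLTerm_sub_one hl χ s)
  simpa [higherL_eq_tprod] using h

lemma logDeriv_higherLTerm {l : ℕ} (hl : 1 ≤ l) (χ : DirichletCharacter ℂ q) {s : ℂ}
    (hs : (1 - (l : ℝ)) / 2 < s.re) (m : ℕ) : logDeriv (higherLTerm l χ m) s =
      -2 * LSeries (mangoldtCoeff χ) (2 * s + (2 * l : ℕ) * (m + 1 : ℕ)) := by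
  have hw := one_lt_re_higherLTerm hl hs m
  have hd : HasDerivAt (fun s : ℂ => 2 * s + (2 * l : ℕ) * ((m : ℂ) + 1)) (2 * 1) s :=
    ((hasDerivAt_id s).const_mul 2).add_const _
  have h := logDeriv_comp (f := χ.LFunction) (g := fun s : ℂ => 2 * s + (2 * l : ℕ) * ((m : ℂ) + 1))
    (differentiableAt_LFunction χ hw) hd.differentiableAt
  rw [hd.deriv, logDeriv_LFunction χ hw] at h
  refine h.trans ?_
  push_cast
  ring

/-- Locally uniform convergence allows termwise logarithmic differentiation; each factor gives
$-2\sum\chi\Lambda$ at a shifted point, and the shifts sum to the geometric coefficients. -/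
lemma logDeriv_higherL {l : ℕ} (hl : 1 ≤ l) (χ : DirichletCharacter ℂ q) {s : ℂ}
    (hs : (1 - (l : ℝ)) / 2 < s.re) : logDeriv (fun s => higherL (2 * l) χ (2 * s)) s =
      -2 * LSeries (higherMangoldtCoeff χ (2 * l)) (2 * s) := by
  have hsum := ((hasSum_LSeries_mangoldtCoeff χ (K := 2 * l) (z := 2 * s) (by omega)
    (by simp; linarith)).2).mul_left (-2)
  have h := logDeriv_tprod_eq_tsum (isOpen_re_gt ((1 - (l : ℝ)) / 2)) hs (f := higherLTerm l χ)
    (fun m => LFunction_ne_zero χ (one_lt_re_higherLTerm hl hs m))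
    (differentiableOn_higherLTerm hl χ)
    (by simpa only [logDeriv_higherLTerm hl χ hs] using hsum.summable)
    (hasProdLocallyUniformlyOn_higherLTerm hl χ).multipliableLocallyUniformlyOn
    (higherL_ne_zero hl χ hs)
  simp only [logDeriv_higherLTerm hl χ hs, hsum.tsum_eq] at h
  exact h

lemma hasDerivAt_logDeriv_higherL {l : ℕ} (hl : 1 ≤ l) (χ : DirichletCharacter ℂ q) {s : ℂ}
    (hs : (1 - (l : ℝ)) / 2 < s.re) : HasDerivAt (logDeriv fun s => higherL (2 * l) χ (2 * s))
      (4 * LSeries (LSeries.logMul (higherMangoldtCoeff χ (2 * l))) (2 * s)) s := by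
  have hab : LSeries.abscissaOfAbsConv (higherMangoldtCoeff χ (2 * l)) < ((2 * s).re : EReal) := by
    refine (abscissa_higherMangoldtCoeff_le χ (by omega)).trans_lt ?_
    rw [EReal.coe_lt_coe_iff]
    simp
    linarith
  have h1 := ((LSeries_hasDerivAt hab).comp s ((hasDerivAt_id s).const_mul 2)).const_mul (-2)
  refine (h1.congr_of_eventuallyEq ?_).congr_deriv (by ring)
  filter_upwards [(isOpen_re_gt _).mem_nhds hs] with z hz
  exact logDeriv_higherL hl χ hz

/-- At $u=2\log n$ the exponential is $n^{1-2s-l}$ and $2\sinh(lu/2)=n^l-n^{-l}$. The two parts of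
$g$ become $2\log n\,n^{-2s}/(n^{2l}-1)$ and $n^{-2s-l}/l$, up to the factor $n$ cancelled by $1/n$.
-/
lemma primeTerm_eq {q : ℕ} (l : ℕ) (χ : DirichletCharacter ℂ q) (s : ℂ) (n : ℕ) :
    primeTerm l s χ n =
      2 * LSeries.term (LSeries.logMul (higherMangoldtCoeff χ (2 * l))) (2 * s) n -
        1 / l * LSeries.term (mangoldtCoeff χ) (2 * s + l) n := by
  rcases Nat.lt_or_ge n 2 with hn | hn
  · interval_cases n
    · simp [primeTerm]
    · rw [LSeries.term_of_ne_zero one_ne_zero, LSeries.term_of_ne_zero one_ne_zero,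
        LSeries.logMul, higherMangoldtCoeff, mangoldtCoeff_one]
      simp [primeTerm]
  have hn0 : n ≠ 0 := by omega
  have hnc : (n : ℂ) ≠ 0 := Nat.cast_ne_zero.mpr hn0
  have hnr : (0 : ℝ) < n := by positivity
  have hlog : 0 < Real.log n := Real.log_pos (by exact_mod_cast hn)
  rw [LSeries.term_of_ne_zero hn0, LSeries.term_of_ne_zero hn0, LSeries.logMul,
    higherMangoldtCoeff, primeTerm, testG, if_neg (by positivity), abs_of_pos (by positivity)]
  have e1 : exp (-(s + l / 2 - 1 / 2) * ((2 * Real.log n : ℝ) : ℂ)) =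
      n / ((n : ℂ) ^ (2 * s) * (n : ℂ) ^ l) := by
    have : -(s + l / 2 - 1 / 2) * ((2 * Real.log n : ℝ) : ℂ) =
        log n - (log n * (2 * s) + l * log n) := by
      push_cast; ring
    rw [this, exp_sub, exp_log hnc, exp_add, exp_nat_mul, exp_log hnc, cpow_def_of_ne_zero hnc]
  have e2 : (2 * Real.sinh (l * (2 * Real.log n) / 2) : ℂ) =
      (n : ℂ) ^ l - ((n : ℂ) ^ l)⁻¹ := by
    have : (l : ℝ) * (2 * Real.log n) / 2 = l * Real.log n := by ring
    rw [this, Real.sinh_eq, Real.exp_neg, Real.exp_nat_mul, Real.exp_log hnr]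
    push_cast
    ring
  have e3 : (n : ℂ) ^ (2 * s + l) = (n : ℂ) ^ (2 * s) * (n : ℂ) ^ l := by
    rw [cpow_add _ _ hnc, cpow_natCast]
  have hm : mangoldtCoeff χ n = χ n * ArithmeticFunction.vonMangoldt n := rfl
  have e4 : (n : ℂ) ^ l - ((n : ℂ) ^ l)⁻¹ = ((n : ℂ) ^ (2 * l) - 1) / (n : ℂ) ^ l := by
    rw [mul_comm 2 l, pow_mul]; field_simp
  rw [e1, e2, e3, e4, hm]
  push_cast
  field_simp

lemma hasSum_primeTerm {q l : ℕ} (hl : 1 ≤ l) (χ : DirichletCharacter ℂ q) {s : ℂ}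
    (hs : (1 - (l : ℝ)) / 2 < s.re) : HasSum (primeTerm l s χ)
      (2 * LSeries (LSeries.logMul (higherMangoldtCoeff χ (2 * l))) (2 * s) -
        1 / l * LSeries (mangoldtCoeff χ) (2 * s + l)) := by
  have hab : LSeries.abscissaOfAbsConv (higherMangoldtCoeff χ (2 * l)) < ((2 * s).re : EReal) := by
    refine (abscissa_higherMangoldtCoeff_le χ (by omega)).trans_lt ?_
    rw [EReal.coe_lt_coe_iff]
    simp
    linarith
  have h1 := (LSeriesSummable_logMul_of_lt_re hab).hasSum.mul_left 2
  have h2 : LSeriesSummable (mangoldtCoeff χ) (2 * s + l) :=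
    DirichletCharacter.LSeriesSummable_twist_vonMangoldt χ (by simp; linarith)
  rw [funext (primeTerm_eq l χ s)]
  exact h1.sub (h2.hasSum.mul_left _)

/-! ### Logarithmic derivatives as factors -/

section LogDeriv

variable {f g : ℂ → ℂ} {a b x : ℂ}

/-- Logarithmic derivatives are carried as the factor $a$ in $f'=af$. These add over products
without choosing a branch of the logarithm. -/
lemma hasDerivAt_mul_of_logDeriv (hf : HasDerivAt f (a * f x) x) (hg : HasDerivAt g (b * g x) x) :
    HasDerivAt (fun z => f z * g z) ((a + b) * (f x * g x)) x :=
  (hf.mul hg).congr_deriv (by ring)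

lemma hasDerivAt_inv_of_logDeriv (hf : HasDerivAt f (a * f x) x) (h0 : f x ≠ 0) :
    HasDerivAt (fun z => (f z)⁻¹) (-a * (f x)⁻¹) x :=
  (hf.inv h0).congr_deriv (by field_simp)

lemma hasDerivAt_pow_of_logDeriv (hf : HasDerivAt f (a * f x) x) (n : ℕ) :
    HasDerivAt (fun z => f z ^ n) (n * a * f x ^ n) x := by
  refine (hf.pow n).congr_deriv ?_
  cases n with
  | zero => simp
  | succ n => simp only [Nat.add_sub_cancel]; ring

lemma hasDerivAt_prod_of_logDeriv {ι : Type*} (S : Finset ι) {f : ι → ℂ → ℂ} {a : ι → ℂ}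
    (hf : ∀ i ∈ S, HasDerivAt (f i) (a i * f i x) x) :
    HasDerivAt (fun z => ∏ i ∈ S, f i z) ((∑ i ∈ S, a i) * ∏ i ∈ S, f i x) x := by
  classical
  induction S using Finset.induction_on with
  | empty => simpa using hasDerivAt_const x (1 : ℂ)
  | insert i S hi ih =>
    simp only [Finset.prod_insert hi, Finset.sum_insert hi]
    exact hasDerivAt_mul_of_logDeriv (hf i (Finset.mem_insert_self i S))
      (ih fun j hj => hf j (Finset.mem_insert_of_mem hj))

lemma hasDerivAt_logDeriv_mul (hf : DifferentiableAt ℂ f x) (h0 : f x ≠ 0) :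
    HasDerivAt f (logDeriv f x * f x) x :=
  hf.hasDerivAt.congr_deriv (by rw [logDeriv_apply, div_mul_cancel₀ _ h0])

lemma logDeriv_eq_of_hasDerivAt (hf : HasDerivAt f (a * f x) x) (h0 : f x ≠ 0) :
    logDeriv f x = a := by
  rw [logDeriv_apply, hf.deriv, mul_div_cancel_right₀ _ h0]

end LogDeriv

lemma hasDerivAt_Gamma_of_re_pos {w : ℂ} (hw : 0 < w.re) :
    HasDerivAt Gamma (digamma w * Gamma w) w :=
  hasDerivAt_logDeriv_mul (differentiableAt_Gamma _ (ne_neg_natCast_of_re_pos hw))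
    (Gamma_ne_zero_of_re_pos hw)

/-! ### The constant -/

lemma constC_pos (t : CongType) (N : ℕ) [NeZero N] (X : Finset CharTuple) : 0 < constC t N X := by
  have hN : (0 : ℝ) < N := Nat.cast_pos.mpr (NeZero.pos N)
  have hA : 0 < constA t N X := Finset.prod_pos fun d _ => by
    cases t <;> simp only [CharTuple.factorA] <;> positivity
  unfold constC
  positivity

/-! ### The functional equation -/

lemma Ifun_mul_Ifun_add {l : ℕ} (hl : 1 ≤ l) {s : ℂ} (hs : ∀ n : ℕ, 2 * (s + l) ≠ 1 - n) :
    Ifun l (s + 1 / 2) * Ifun l s = Ifun l (s + l + 1 / 2) * Ifun l (s + l) *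
      (Gamma (s + l + 1 / 2) * Gamma (s + l)) := by
  rw [Ifun_add hl (s := s), Ifun_add hl (s := s + 1 / 2),
    show s + 1 / 2 + (l : ℂ) = s + l + 1 / 2 by ring]
  · ring
  · intro k h
    -- Poles of $\Gamma(s+l+1/2)$ and $\Gamma(s+l)$ correspond to even $n\ge2$ and odd $n\ge1$ in
    -- the excluded set; $n=0$ excludes $s+l=1/2$.
    refine hs (2 * k + 2) ?_
    push_cast
    linear_combination 2 * h
  · intro k h
    refine hs (2 * k + 1) ?_
    push_cast
    linear_combination 2 * h

/-- Since $l>0$, $\log l+\log((s+l-1/2)/l)$ is exactly the principal $\log(s+l-1/2)$. Exactness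
matters because the result is multiplied by a complex number and exponentiated. -/
lemma mul_log_add_logGamma_add {l : ℕ} (hl : 1 ≤ l) {s : ℂ} (hs : ∀ n : ℕ, 2 * (s + l) ≠ 1 - n) (a : ℂ) :
    a * ((s + l) / l * Real.log l + logGamma ((s + l + l - 1 / 2) / l)) =
      a * (s / l * Real.log l + logGamma ((s + l - 1 / 2) / l)) + a * log (s + l - 1 / 2) := by
  have hlp : (0 : ℝ) < l := by exact_mod_cast hl
  have hl0 : (l : ℂ) ≠ 0 := by exact_mod_cast hlp.ne'
  have hw : ∀ k : ℕ, (s + l - 1 / 2) / l ≠ -k := fun k h => by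
    rw [div_eq_iff hl0] at h
    refine hs (2 * (k * l)) ?_
    push_cast
    linear_combination 2 * h
  have h0 : (s + l - 1 / 2) / l ≠ 0 := by simpa using hw 0
  have h1 := logGamma_add_one hw
  rw [show (s + l - 1 / 2) / l + 1 = (s + l + l - 1 / 2) / l by field_simp; ring] at h1
  have h2 := log_ofReal_mul hlp h0
  rw [ofReal_natCast, mul_div_cancel₀ _ hl0] at h2
  rw [h1, h2, add_div, div_self hl0]
  ring

theorem XiHigherPar_eq_div (t : CongType) (N : ℕ) [NeZero N] (X : Finset CharTuple) {l : ℕ}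
    (hl : 1 ≤ l) {s : ℂ} (hs : ∀ n : ℕ, 2 * (s + l) ≠ 1 - n) :
    XiHigherPar t N X l s = XiHigherPar t N X l (s + l) / XiPar t N X (s + l) := by
  have hl0 : (l : ℂ) ≠ 0 := by exact_mod_cast (by omega : l ≠ 0)
  have hC : (constC t N X : ℂ) ≠ 0 := ofReal_ne_zero.mpr (constC_pos t N X).ne'
  have hw : s + l - 1 / 2 ≠ 0 := fun h => hs 0 (by push_cast; linear_combination 2 * h)
  have hprod : ∏ d ∈ X, higherL (2 * l) d.char (2 * s) =
      (∏ d ∈ X, (d.char.LFunction (2 * (s + l)))) *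
        ∏ d ∈ X, higherL (2 * l) d.char (2 * (s + l)) := by
    rw [← Finset.prod_mul_distrib]
    exact Finset.prod_congr rfl fun d _ => higherL_add hl d.char s
  -- The quadratic $s(s+l)/(2l)$ increases by $s+l$ under the shift, producing the power
  -- $C^{-(s+l)}$ of $\Xi_{\mathrm{par}}$.
  have hexp : exp (-((s + l) * (s + l + l) / (2 * l)) * Real.log (constC t N X) +
      (kappa t N - kappa0 t N) / 2 *
        ((s + l) / l * Real.log l + logGamma ((s + l + l - 1 / 2) / l))) =
      exp (-(s * (s + l) / (2 * l)) * Real.log (constC t N X) +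
      (kappa t N - kappa0 t N) / 2 *
        (s / l * Real.log l + logGamma ((s + l - 1 / 2) / l))) *
      ((constC t N X : ℂ) ^ (-(s + l)) *
        (s + l - 1 / 2) ^ (((kappa t N : ℂ) - kappa0 t N) / 2)) := by
    rw [cpow_def_of_ne_zero hC, cpow_def_of_ne_zero hw, ← exp_add, ← exp_add,
      mul_log_add_logGamma_add hl hs, ← ofReal_log (constC_pos t N X).le]
    congr 1
    field_simp
    ring
  have hA : (constC t N X : ℂ) ^ (-(s + l)) ≠ 0 := by
    rw [cpow_def_of_ne_zero hC]; exact exp_ne_zero _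
  have hB : (s + l - 1 / 2) ^ (((kappa t N : ℂ) - kappa0 t N) / 2) ≠ 0 := by
    rw [cpow_def_of_ne_zero hw]; exact exp_ne_zero _
  rw [XiHigherPar, XiHigherPar, XiPar, hexp, hprod, Ifun_mul_Ifun_add hl hs, Finset.prod_inv_distrib,
    mul_pow _ (Gamma (s + l + 1 / 2) * Gamma (s + l)), mul_pow (Gamma (s + l + 1 / 2))]
  clear hexp hprod
  generalize (s + l - 1 / 2) ^ (((kappa t N : ℂ) - kappa0 t N) / 2) = B at hB ⊢
  -- No nonvanishing of the $L$-product is required: at its zeros, inverse and division take the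
  -- value 0, matching the zero on the left and the stated reading of the quotient.
  field_simp

/-! ### Logarithmic derivatives of the parabolic factors -/

/-- For $\mathrm{Re}\,w>1/2$ the base $w-1/2$ avoids the branch cut, both Gamma values are finite
and nonzero, and $2w$ lies where $L$ has no zeros. -/
lemma XiPar_ne_zero_and_hasDerivAt (t : CongType) (N : ℕ) [NeZero N] (X : Finset CharTuple) {w : ℂ}
    (hw : 1 / 2 < w.re) : XiPar t N X w ≠ 0 ∧ HasDerivAt (XiPar t N X)
      ((-Real.log (constC t N X) + (kappa t N - kappa0 t N) / 2 / (w - 1 / 2) -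
        kappa t N * (digamma (w + 1 / 2) + digamma w) +
        2 * ∑ d ∈ X, LSeries (mangoldtCoeff d.char) (2 * w)) * XiPar t N X w) w := by
  have hC : (constC t N X : ℂ) ≠ 0 := ofReal_ne_zero.mpr (constC_pos t N X).ne'
  have hre : 0 < (w - 1 / 2).re := by simpa using hw
  have hw0 : w - 1 / 2 ≠ 0 := fun h => by rw [h] at hre; simp at hre
  have hr1 : 0 < (w + 1 / 2).re := by simp; linarith
  have hr2 : 0 < w.re := by linarith
  have hr3 : 1 < (2 * w).re := by simp; linarith
  have hG1 := Gamma_ne_zero_of_re_pos hr1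
  have hG2 := Gamma_ne_zero_of_re_pos hr2
  have hA : (constC t N X : ℂ) ^ (-w) ≠ 0 := by
    rw [cpow_def_of_ne_zero hC]; exact exp_ne_zero _
  have hB : (w - 1 / 2) ^ (((kappa t N : ℂ) - kappa0 t N) / 2) ≠ 0 := by
    rw [cpow_def_of_ne_zero hw0]; exact exp_ne_zero _
  have hL : ∀ d ∈ X, d.char.LFunction (2 * w) ≠ 0 := fun d _ => LFunction_ne_zero d.char hr3
  have d1 : HasDerivAt (fun w => (constC t N X : ℂ) ^ (-w))
      (-Real.log (constC t N X) * (constC t N X : ℂ) ^ (-w)) w :=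
    ((hasDerivAt_neg w).const_cpow (Or.inl hC)).congr_deriv (by
      rw [ofReal_log (constC_pos t N X).le]; ring)
  have d2 : HasDerivAt (fun w => (w - 1 / 2) ^ (((kappa t N : ℂ) - kappa0 t N) / 2))
      ((kappa t N - kappa0 t N) / 2 / (w - 1 / 2) *
        (w - 1 / 2) ^ (((kappa t N : ℂ) - kappa0 t N) / 2)) w := by
    refine (((hasDerivAt_id w).sub_const (1 / 2)).cpow_const (Or.inl hre)).congr_deriv ?_
    simp only [id]
    rw [cpow_sub _ _ hw0, cpow_one]
    ring
  have d3 : HasDerivAt (fun w => Gamma (w + 1 / 2)) (digamma (w + 1 / 2) * Gamma (w + 1 / 2)) w :=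
    (hasDerivAt_Gamma_of_re_pos hr1).comp_add_const w (1 / 2)
  have d4 := hasDerivAt_Gamma_of_re_pos hr2
  have d5 : ∀ d ∈ X, HasDerivAt (fun w => (d.char.LFunction (2 * w))⁻¹)
      (2 * LSeries (mangoldtCoeff d.char) (2 * w) * (d.char.LFunction (2 * w))⁻¹) w := fun d hd => by
    have h := hasDerivAt_logDeriv_mul (differentiableAt_LFunction d.char hr3) (hL d hd)
    rw [logDeriv_LFunction d.char hr3] at h
    refine (hasDerivAt_inv_of_logDeriv (a := -2 * LSeries (mangoldtCoeff d.char) (2 * w))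
      (f := fun w => d.char.LFunction (2 * w))
      ((h.comp w ((hasDerivAt_id w).const_mul 2)).congr_deriv (by ring)) (hL d hd)).congr_deriv ?_
    ring
  constructor
  · rw [XiPar]
    refine mul_ne_zero (mul_ne_zero (mul_ne_zero (mul_ne_zero hA hB) ?_) ?_) ?_
    · exact inv_ne_zero (pow_ne_zero _ hG1)
    · exact inv_ne_zero (pow_ne_zero _ hG2)
    · exact Finset.prod_ne_zero_iff.mpr fun d hd => inv_ne_zero (hL d hd)
  · refine (hasDerivAt_mul_of_logDeriv (hasDerivAt_mul_of_logDeriv (hasDerivAt_mul_of_logDeriv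
      (hasDerivAt_mul_of_logDeriv d1 d2)
      (hasDerivAt_inv_of_logDeriv (hasDerivAt_pow_of_logDeriv d3 (kappa t N)) (pow_ne_zero _ hG1)))
      (hasDerivAt_inv_of_logDeriv (hasDerivAt_pow_of_logDeriv d4 (kappa t N)) (pow_ne_zero _ hG2)))
      (hasDerivAt_prod_of_logDeriv X d5)).congr_deriv ?_
    rw [XiPar, ← Finset.mul_sum]
    ring

/-- The logarithmic derivative of the higher parabolic factor. -/
noncomputable def logDerivXiHigherPar (t : CongType) (N : ℕ) [NeZero N] (X : Finset CharTuple)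
    (l : ℕ) (s : ℂ) : ℂ :=
  -((2 * s + l) / (2 * l)) * Real.log (constC t N X) +
    (kappa t N - kappa0 t N) / 2 *
      (1 / l * Real.log l + 1 / l * digamma ((s + l - 1 / 2) / l)) +
    kappa t N * (logIDeriv l (s + 1 / 2) + logIDeriv l s) +
    ∑ d ∈ X, logDeriv (fun s => higherL (2 * l) d.char (2 * s)) s

lemma hasDerivAt_Ifun {l : ℕ} (hl : 1 ≤ l) {s : ℂ} (hs : -(l : ℝ) < s.re) :
    HasDerivAt (Ifun l) (logIDeriv l s * Ifun l s) s := by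
  have h := (hasDerivAt_logI hl hs).cexp
  rw [exp_logI hl hs, mul_comm] at h
  refine h.congr_of_eventuallyEq ?_
  filter_upwards [(isOpen_re_gt _).mem_nhds hs] with z hz
  exact (exp_logI hl hz).symm

lemma sub_half_div_re_pos {l : ℕ} (hl : 1 ≤ l) {s : ℂ} (hs : (1 - (l : ℝ)) / 2 < s.re) :
    0 < ((s + l - 1 / 2) / l).re := by
  have hlp : (1 : ℝ) ≤ l := by exact_mod_cast hl
  rw [← ofReal_natCast, div_ofReal_re]
  refine div_pos ?_ (by linarith)
  simp
  linarith

lemma hasDerivAt_sub_half_div (l : ℕ) (s : ℂ) :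
    HasDerivAt (fun s : ℂ => (s + l - 1 / 2) / l) (1 / l) s :=
  (((hasDerivAt_id s).add_const (l : ℂ)).sub_const (1 / 2)).div_const (l : ℂ)

lemma XiHigherPar_ne_zero_and_hasDerivAt (t : CongType) (N : ℕ) [NeZero N] (X : Finset CharTuple)
    {l : ℕ} (hl : 1 ≤ l) {s : ℂ} (hs : (1 - (l : ℝ)) / 2 < s.re) :
    XiHigherPar t N X l s ≠ 0 ∧
      HasDerivAt (XiHigherPar t N X l) (logDerivXiHigherPar t N X l s * XiHigherPar t N X l s) s := by
  have hs1 : -(l : ℝ) < s.re := by linarith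
  have hs2 : -(l : ℝ) < (s + 1 / 2).re := by simp; linarith
  have hI1 : Ifun l s ≠ 0 := exp_logI hl hs1 ▸ exp_ne_zero _
  have hI2 : Ifun l (s + 1 / 2) ≠ 0 := exp_logI hl hs2 ▸ exp_ne_zero _
  have hid := hasDerivAt_id s
  have d1 := (((hid.mul (hid.add_const (l : ℂ))).div_const (2 * (l : ℂ))).neg.mul_const
    (Real.log (constC t N X) : ℂ)).add
    ((((hid.div_const (l : ℂ)).mul_const (Real.log l : ℂ)).add
      ((hasDerivAt_logGamma (sub_half_div_re_pos hl hs)).comp s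
        (hasDerivAt_sub_half_div l s))).const_mul (((kappa t N : ℂ) - kappa0 t N) / 2))
  have d2 := hasDerivAt_pow_of_logDeriv (hasDerivAt_mul_of_logDeriv
    ((hasDerivAt_Ifun hl hs2).comp_add_const s (1 / 2)) (hasDerivAt_Ifun hl hs1)) (kappa t N)
  have d3 := hasDerivAt_prod_of_logDeriv X (x := s)
    (f := fun d s => higherL (2 * l) d.char (2 * s)) fun d _ => hasDerivAt_logDeriv_mul
      ((differentiableOn_higherL hl d.char).differentiableAt ((isOpen_re_gt _).mem_nhds hs))
      (higherL_ne_zero hl d.char hs)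
  constructor
  · rw [XiHigherPar]
    exact mul_ne_zero (mul_ne_zero (exp_ne_zero _) (pow_ne_zero _ (mul_ne_zero hI2 hI1)))
      (Finset.prod_ne_zero_iff.mpr fun d _ => higherL_ne_zero hl d.char hs)
  · refine (hasDerivAt_mul_of_logDeriv (hasDerivAt_mul_of_logDeriv
      (d1.cexp.congr_deriv (mul_comm _ _)) d2) d3).congr_deriv ?_
    simp only [XiHigherPar, logDerivXiHigherPar, Function.comp_apply, id, Pi.mul_apply, Pi.add_apply,
      Pi.neg_apply]
    congr 1
    field_simp
    ring

lemma hasDerivAt_logDerivXiHigherPar (t : CongType) (N : ℕ) [NeZero N] (X : Finset CharTuple)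
    {l : ℕ} (hl : 1 ≤ l) {s : ℂ} (hs : (1 - (l : ℝ)) / 2 < s.re) :
    HasDerivAt (logDerivXiHigherPar t N X l)
      (-(1 / l) * Real.log (constC t N X) +
        (kappa t N - kappa0 t N) / 2 * (1 / (l : ℂ) ^ 2 * trigamma ((s + l - 1 / 2) / l)) +
        kappa t N * (logIDeriv2 l (s + 1 / 2) + logIDeriv2 l s) +
        ∑ d ∈ X, 4 * LSeries (LSeries.logMul (higherMangoldtCoeff d.char (2 * l))) (2 * s)) s := by
  have hs1 : -(l : ℝ) < s.re := by linarith
  have hs2 : -(l : ℝ) < (s + 1 / 2).re := by simp; linarith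
  have d1 := ((((hasDerivAt_id s).const_mul 2).add_const (l : ℂ)).div_const
    (2 * (l : ℂ))).neg.mul_const (Real.log (constC t N X) : ℂ)
  have d2 := ((((hasDerivAt_digamma (sub_half_div_re_pos hl hs)).comp s
    (hasDerivAt_sub_half_div l s)).const_mul (1 / (l : ℂ))).const_add
    (1 / (l : ℂ) * Real.log l)).const_mul (((kappa t N : ℂ) - kappa0 t N) / 2)
  have d3 := (((hasDerivAt_logIDeriv hl hs2).comp_add_const s (1 / 2)).add
    (hasDerivAt_logIDeriv hl hs1)).const_mul (kappa t N : ℂ)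
  have d4 := HasDerivAt.fun_sum (u := X) fun d _ => hasDerivAt_logDeriv_higherL hl d.char hs
  refine (((d1.add d2).add d3).add d4).congr_deriv ?_
  congr 3
  · field_simp
  · ring

lemma deriv_logDeriv_XiHigherPar (t : CongType) (N : ℕ) [NeZero N] (X : Finset CharTuple)
    {l : ℕ} (hl : 1 ≤ l) {s : ℂ} (hs : (1 - (l : ℝ)) / 2 < s.re) :
    deriv (logDeriv (XiHigherPar t N X l)) s =
      -(1 / l) * Real.log (constC t N X) +
        (kappa t N - kappa0 t N) / 2 * (1 / (l : ℂ) ^ 2 * trigamma ((s + l - 1 / 2) / l)) +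
        kappa t N * (logIDeriv2 l (s + 1 / 2) + logIDeriv2 l s) +
        ∑ d ∈ X, 4 * LSeries (LSeries.logMul (higherMangoldtCoeff d.char (2 * l))) (2 * s) := by
  rw [← (hasDerivAt_logDerivXiHigherPar t N X hl hs).deriv]
  refine EventuallyEq.deriv_eq ?_
  filter_upwards [(isOpen_re_gt _).mem_nhds hs] with z hz
  have h := XiHigherPar_ne_zero_and_hasDerivAt t N X hl hz
  exact logDeriv_eq_of_hasDerivAt h.2 h.1

lemma re_add_half_pos {l : ℕ} {s : ℂ} (hs : (1 - (l : ℝ)) / 2 < s.re) :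
    1 / 2 < (s + l / 2).re := by
  simp
  linarith

lemma logDeriv_XiPar_add (t : CongType) (N : ℕ) [NeZero N] (X : Finset CharTuple) {l : ℕ} {s : ℂ}
    (hs : (1 - (l : ℝ)) / 2 < s.re) : logDeriv (fun w => XiPar t N X (w + l / 2)) s =
      -Real.log (constC t N X) + (kappa t N - kappa0 t N) / 2 / (s + l / 2 - 1 / 2) -
        kappa t N * (digamma (s + l / 2 + 1 / 2) + digamma (s + l / 2)) +
        2 * ∑ d ∈ X, LSeries (mangoldtCoeff d.char) (2 * (s + l / 2)) := by
  have h := XiPar_ne_zero_and_hasDerivAt t N X (re_add_half_pos hs)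
  exact logDeriv_eq_of_hasDerivAt (h.2.comp_add_const s ((l : ℂ) / 2)) h.1

/-- The line $b=1$ produces $I_l(s+1/2)$ and the line $b=1/2$ produces $I_l(s)$. -/
lemma integrable_digammaIntegrand_and_integral_eq {l : ℕ} (hl : 1 ≤ l) {s : ℂ}
    (hs : (1 - (l : ℝ)) / 2 < s.re) : MeasureTheory.Integrable (digammaIntegrand l s) ∧
      -1 / (2 * Real.pi) * ∫ r : ℝ, digammaIntegrand l s r =
        logIDeriv2 l (s + 1 / 2) + logIDeriv2 l s +
          1 / l * (digamma (s + l / 2 + 1 / 2) + digamma (s + l / 2)) := by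
  have i1 := (integral_testH_mul_digamma hl hs one_pos le_rfl).1
  have i2 := (integral_testH_mul_digamma hl hs (b := 1 / 2) (by norm_num) (by norm_num)).1
  have e1 := integral_testH_mul_digamma_eq hl hs (b := 1) (by norm_num) le_rfl
  have e2 := integral_testH_mul_digamma_eq hl hs (b := 1 / 2) le_rfl (by norm_num)
  have he : digammaIntegrand l s = fun r : ℝ => testH l s r * digamma ((1 : ℝ) + I * r) +
      testH l s r * digamma ((1 / 2 : ℝ) + I * r) := by
    funext r
    rw [digammaIntegrand]
    push_cast
    ring
  refine ⟨he ▸ i1.add i2, ?_⟩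
  rw [he, MeasureTheory.integral_add i1 i2, mul_add, e1, e2]
  push_cast
  rw [show s + 1 - 1 / 2 = s + 1 / 2 by ring, show s + 1 / 2 - 1 / 2 = s by ring,
    show s + 1 / 2 + (l : ℂ) / 2 = s + l / 2 + 1 / 2 by ring]
  ring

/-- Everything is now explicit and the match is linear. In $h(0)=2\phi_s(0)$ the trigamma value
comes from $\log\Gamma$ and the simple fraction from the power of $s-1/2$. -/
lemma parabolicTerms_eq (t : CongType) (N : ℕ) [NeZero N] (X : Finset CharTuple)
    {l : ℕ} (hl : 1 ≤ l) {s : ℂ} (hs : (1 - (l : ℝ)) / 2 < s.re) :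
    parabolicTerms t N X l s = deriv (logDeriv (XiHigherPar t N X l)) s -
      1 / l * logDeriv (fun w => XiPar t N X (w + l / 2)) s := by
  have hint := (integrable_digammaIntegrand_and_integral_eq hl hs).2
  have hH : testH l s 0 = 2 * phi l s 0 := by rw [testH, neg_zero]; ring
  have hsum : ∑ d ∈ X, ∑' n : ℕ, primeTerm l s d.char n =
      2 * ∑ d ∈ X, LSeries (LSeries.logMul (higherMangoldtCoeff d.char (2 * l))) (2 * s) -
        1 / l * ∑ d ∈ X, LSeries (mangoldtCoeff d.char) (2 * (s + l / 2)) := by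
    rw [Finset.mul_sum, Finset.mul_sum, ← Finset.sum_sub_distrib]
    refine Finset.sum_congr rfl fun d _ => ?_
    rw [(hasSum_primeTerm hl d.char hs).tsum_eq, show 2 * s + (l : ℂ) = 2 * (s + l / 2) by ring]
  rw [deriv_logDeriv_XiHigherPar t N X hl hs, logDeriv_XiPar_add t N X hs, parabolicTerms, hsum, hH,
    phi_eq_trigamma hl hs, ← Finset.mul_sum, show s - 1 / 2 + (l : ℂ) = s + l - 1 / 2 by ring,
    show s - 1 / 2 + (l : ℂ) / 2 = s + l / 2 - 1 / 2 by ring]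
  -- Correspondingly, on the right $-\frac1l\log C$ from the second derivative cancels $+\frac1l\log
  -- C$ from $\Xi_{\mathrm{par}}$.
  have hg : testG l s 0 = 0 := if_pos rfl
  rw [hg]
  linear_combination (kappa t N : ℂ) * hint

end HigherSelberg

/-! ### The main theorem -/

open HigherSelberg in
theorem proposition3p5p4 (t : HigherSelberg.CongType) (N : ℕ) [NeZero N]
    (X : Finset HigherSelberg.CharTuple) (hX : X ⊆ HigherSelberg.admissibleTuples t N)
    (l : ℕ) (hl : 1 ≤ l) :
    (∀ s : ℂ, (1 - (l : ℝ)) / 2 < s.re →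
      (∀ r : ℝ, Summable (phiTerm l s r)) ∧
      MeasureTheory.Integrable (digammaIntegrand l s) ∧
      (∀ d ∈ X, Summable (primeTerm l s d.char)) ∧
      AnalyticAt ℂ (XiHigherPar t N X l) s ∧ XiHigherPar t N X l s ≠ 0 ∧
      AnalyticAt ℂ (XiPar t N X) (s + l / 2) ∧ XiPar t N X (s + l / 2) ≠ 0 ∧
      parabolicTerms t N X l s =
        deriv (logDeriv (XiHigherPar t N X l)) s -
          1 / l * logDeriv (fun w => XiPar t N X (w + l / 2)) s) ∧
    (∀ s : ℂ, (∀ n : ℕ, 2 * (s + l) ≠ 1 - n) →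
      XiHigherPar t N X l s = XiHigherPar t N X l (s + l) / XiPar t N X (s + l)) := by
  refine ⟨fun s hs => ⟨summable_phiTerm hl hs, (integrable_digammaIntegrand_and_integral_eq hl hs).1,
    fun d _ => (hasSum_primeTerm hl d.char hs).summable, ?_,
    (XiHigherPar_ne_zero_and_hasDerivAt t N X hl hs).1, ?_,
    (XiPar_ne_zero_and_hasDerivAt t N X (re_add_half_pos hs)).1, parabolicTerms_eq t N X hl hs⟩,
    fun s hs => XiHigherPar_eq_div t N X hl hs⟩
  · refine DifferentiableOn.analyticAt (fun z hz => ?_) ((isOpen_re_gt _).mem_nhds hs)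
    exact (XiHigherPar_ne_zero_and_hasDerivAt t N X hl hz).2.differentiableAt.differentiableWithinAt
  · refine DifferentiableOn.analyticAt (fun z hz => ?_)
      ((isOpen_re_gt _).mem_nhds (re_add_half_pos hs))
    exact (XiPar_ne_zero_and_hasDerivAt t N X hz).2.differentiableAt.differentiableWithinAt
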